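/- **Setting.** Let $U\subseteq\mathbb R^m$ be open (a coordinate patch of the target $M$) and let a Courant algebroid over $U$ be given in a local frame with constant fibre metric: a nondegenerate symmetric matrix $\eta_{ab}$ ($1\le a,b\le k$), smooth anchor components $\rho_a{}^\mu$ and smooth totally antisymmetric structure functions $C_{abc}$ on $U$, with $\eta^{ab}\rho_a{}^\mu\rho_b{}^\nu=0$, $\rho_b{}^\mu\partial_\mu\rho_a{}^\nu-\rho_a{}^\mu\partial_\mu\rho_b{}^\nu+\eta^{ef}\rho_e{}^\nu C_{fab}=0$ and $$\rho_d{}^\mu\partial_\mu C_{abc}-\rho_a{}^\mu\partial_\mu C_{bcd}+\rho_b{}^\mu\partial_\mu C_{cda}-\rho_c{}^\mu\partial_\mu C_{dab}+\eta^{ef}(C_{eab}C_{cdf}+C_{eac}C_{dbf}+C_{ead}C_{bcf})=0 .$$ Fields, ghosts and ghost for ghost $\varphi$ are $X^\mu,A^a,B_\mu,\epsilon^a,\psi_\mu,\widetilde\psi_\mu$, of form degrees $0,1,2,0,1,0$ and ghost numbers $0,0,0,1,1,2$; the antifield $\varphi^\dagger$ has $\deg\varphi+\deg\varphi^\dagger=3$,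 $\mathrm{gh}\,\varphi+\mathrm{gh}\,\varphi^\dagger=-1$. Local forms are polynomials in these symbols other than $X^\mu$ and in the de Rham differentials of all symbols, with coefficients smooth functions of $X$, and $\alpha\beta=(-1)^{\deg\alpha\deg\beta+\mathrm{gh}\,\alpha\,\mathrm{gh}\,\beta}\beta\alpha$. The integral $\int=\int_{T[1]\Sigma}$ over the closed three-dimensional world volume $\Sigma$ is the class of the part of form degree $3$ modulo total derivatives $\mathrm d(\cdot)$. **Classical and AKSZ action.** $S_{\rm cl}=\int\big(-B_\mu\mathrm dX^\mu+\tfrac12\eta_{ab}A^a\mathrm dA^b+\rho_a{}^\mu B_\mu A^a+\tfrac1{3!}C_{abc}A^aA^bA^c\big)$, and $S_{\rm BV,0}$ is the same expression with $X,A,B$ replaced by the superfields $$\mathbf X^\mu=X^\mu+B^{\dagger\mu}+\psi^{\dagger\mu}+\widetilde\psi^{\dagger\mu},\quad \mathbf A^a=\epsilon^a+A^a+\eta^{ab}A^\dagger_b-\eta^{ab}\epsilon^\dagger_b,\quad \mathbf B_\mu=\widetilde\psi_\mu+\psi_\mu+B_\mu-X^\dagger_\mu ,$$ multiplied with the product $\alpha\odot\beta=(-1)^{\mathrm{gh}\,\alpha\deg\beta}\alpha\beta$,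 which is graded commutative in the total degree; functions of $\mathbf X$ are Taylor expanded about $X$. **BRST operations.** Let $C^a_{bc}=\eta^{ad}C_{dbc}$ and let $s_0$ be the derivation of form degree $0$ and ghost number $1$ that commutes with $\mathrm d$, annihilates antifields, and satisfies $$\begin{aligned} s_0X^\mu&=\rho_a{}^\mu\epsilon^a,\qquad s_0A^a=\mathrm d\epsilon^a+\eta^{ab}\rho_b{}^\mu\psi_\mu+C^a_{bc}A^b\epsilon^c,\qquad s_0\epsilon^a=-\eta^{ab}\rho_b{}^\mu\widetilde\psi_\mu-\tfrac12C^a_{bc}\epsilon^b\epsilon^c,\\ s_0B_\mu&=-\mathrm d\psi_\mu-\partial_\mu\rho_a{}^\nu(B_\nu\epsilon^a-\psi_\nu A^a)-\tfrac12\partial_\mu C_{abc}A^aA^b\epsilon^c,\\ s_0\psi_\mu&=\mathrm d\widetilde\psi_\mu+\partial_\mu\rho_a{}^\nu(\widetilde\psi_\nu A^a+\psi_\nu\epsilon^a)+\tfrac12\partial_\mu C_{abc}A^a\epsilon^b\epsilon^c,\\ s_0\widetilde\psi_\mu&=-\partial_\mu\rho_a{}^\nu\widetilde\psi_\nu\epsilon^a-\tfrac16\partial_\mu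 C_{abc}\epsilon^a\epsilon^b\epsilon^c . \end{aligned}$$ With the field equations $F^\mu=\mathrm dX^\mu-\rho_a{}^\mu A^a$ and $G^a=\mathrm dA^a+\eta^{ab}\rho_b{}^\mu B_\mu+\tfrac12C^a_{bc}A^bA^c$, let $\mathfrak f$ move a field equation in an expression (at most linear in $F,G$) to the left-most position and replace it by $F^\mu\mapsto B^{\dagger\mu}$, $G^a\mapsto-\eta^{ab}A^\dagger_b$, leaving terms without field equation unchanged. Put $\mathcal O_{(1)}\varphi=s_0\varphi$, $\mathcal O_{(2)}\varphi=\mathfrak f(s_0\mathcal O_{(1)}\varphi)$, and $\varphi^\dagger\cdot\mathcal O_{(3)}\varphi=\varphi^\dagger\cdot\mathfrak f\big(s_0(\mathfrak f(\mathcal O_{(2)}\varphi))\big)\big|_{\mathrm{gh}=0}$, where before the last $\mathfrak f$ derivatives are moved off the ghosts by integration by parts and the total derivative is dropped: $\alpha$ is replaced by $\alpha-\mathrm d\Theta(\alpha)$, where $\Theta(\alpha)$ is obtained by applying the derivation $\sum_c c\,\partial/\partial(\mathrm dc)$ (left derivatives, $c$ running over $\epsilon^a,\psi_\mu,\widetilde\psi_\mu$)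 to $\alpha$ and dividing each term by its number of ghosts. **Proposition.** The AKSZ-BV master action of the untwisted ($H=0$) Courant sigma model is $$S_{\rm BV,0}=S_{\rm cl}+\sum_{n=1}^{3}\sum_{\varphi}\int\frac{(-1)^{\mathrm{gh}\,\varphi+n}}{\beta_\dagger!\,\beta_n}\,\varphi^\dagger\cdot\mathcal O_{(n)}\varphi ,$$ where $\varphi$ runs over the six species and the factors are attached term by term (monomial by monomial): $\beta_\dagger!$ is the product over the species of the factorials of the number of antifields of that species in the term, and $\beta_n$ is the number of species $\varphi$ for which the term occurs in $\varphi^\dagger\cdot\mathcal O_{(n)}\varphi$. -/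

import Mathlib

noncomputable section

namespace CourantSigma

/-! ### Smooth functions on a coordinate patch of the target -/

/-- Extension of a function on `U` by zero. -/
def extFn {m : ℕ} {U : TopologicalSpace.Opens (Fin m → ℝ)} (f : U → ℝ) : (Fin m → ℝ) → ℝ :=
  Function.extend Subtype.val f 0

theorem extFn_apply {m : ℕ} {U : TopologicalSpace.Opens (Fin m → ℝ)} (f : U → ℝ)
    {x : Fin m → ℝ} (hx : x ∈ U) : extFn f x = f ⟨x, hx⟩ :=
  Subtype.val_injective.extend_apply f 0 ⟨x, hx⟩

open scoped ContDiff in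
/-- The algebra `C^∞(U)` of smooth real functions on an open set `U ⊆ ℝᵐ`. -/
def SmoothFn {m : ℕ} (U : TopologicalSpace.Opens (Fin m → ℝ)) : Subalgebra ℝ (U → ℝ) where
  carrier := {f | ContDiffOn ℝ ∞ (extFn f) (U : Set (Fin m → ℝ))}
  mul_mem' {f g} hf hg :=
    (ContDiffOn.mul hf hg).congr fun x hx => by
      simp [extFn_apply _ (show x ∈ U from hx)]
  add_mem' {f g} hf hg :=
    (ContDiffOn.add hf hg).congr fun x hx => by
      simp [extFn_apply _ (show x ∈ U from hx)]
  algebraMap_mem' r :=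
    (contDiffOn_const (c := r)).congr fun x hx => extFn_apply _ hx

/-- The coordinate function `x^μ`. -/
def coord {m : ℕ} (U : TopologicalSpace.Opens (Fin m → ℝ)) (μ : Fin m) : SmoothFn U :=
  ⟨fun x => x.1 μ, (contDiff_apply ℝ ℝ μ).contDiffOn.congr fun _ hx => extFn_apply _ hx⟩

/-- The partial derivative `∂_μ : C^∞(U) → C^∞(U)`. -/
def pd {m : ℕ} {U : TopologicalSpace.Opens (Fin m → ℝ)} (μ : Fin m) :
    SmoothFn U →ₗ[ℝ] SmoothFn U where
  toFun f := ⟨fun x => fderiv ℝ (extFn f.1) x.1 (Pi.single μ 1),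
    ((f.2.fderiv_of_isOpen U.isOpen (by simp)).clm_apply
      (contDiffOn_const (c := (Pi.single μ 1 : Fin m → ℝ)))).congr
        fun _ hx => extFn_apply _ hx⟩
  map_add' f g := by
    ext x
    have hf := (f.2.contDiffAt (U.isOpen.mem_nhds x.2)).differentiableAt (by simp)
    have hg := (g.2.contDiffAt (U.isOpen.mem_nhds x.2)).differentiableAt (by simp)
    have e : extFn ((f + g : SmoothFn U) : U → ℝ) = extFn f.1 + extFn g.1 := by
      simp only [extFn]
      rw [← Function.extend_add, add_zero]; rfl
    simp only [e, fderiv_add hf hg]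
    rfl
  map_smul' r f := by
    ext x
    have hf := (f.2.contDiffAt (U.isOpen.mem_nhds x.2)).differentiableAt (by simp)
    have e : extFn ((r • f : SmoothFn U) : U → ℝ) = r • extFn f.1 := by
      simp only [extFn]
      rw [← Function.extend_smul, smul_zero]; rfl
    simp only [e, fderiv_const_smul hf]
    rfl

/-! ### Local Courant algebroids -/

/-- A Courant algebroid over the patch `U`, in a local frame `e_1, …, e_k` in which the fibre
metric is constant: components of the fibre metric, of the anchor and of the bracket, and the
local form of the axioms. -/
structure LocalCourantAlgebroid (m k : ℕ) (U : TopologicalSpace.Opens (Fin m → ℝ)) where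
  /-- fibre metric `η_{ab}` -/
  η : Matrix (Fin k) (Fin k) ℝ
  /-- anchor `ρ a μ = ρ_a^μ` -/
  ρ : Fin k → Fin m → SmoothFn U
  /-- structure functions `C_{abc}`, all indices lowered with `η` -/
  C : Fin k → Fin k → Fin k → SmoothFn U
  η_symm : η.IsSymm
  η_nondeg : IsUnit η.det
  C_antisymm₁₂ : ∀ a b c, C a b c = -C b a c
  C_antisymm₂₃ : ∀ a b c, C a b c = -C a c b
  /-- `η^{ab} ρ_a^μ ρ_b^ν = 0` -/
  anchor_isotropic : ∀ μ ν, ∑ a, ∑ b, η⁻¹ a b • (ρ a μ * ρ b ν) = 0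
  /-- `ρ_b^μ ∂_μ ρ_a^ν - ρ_a^μ ∂_μ ρ_b^ν + η^{ef} ρ_e^ν C_{fab} = 0` -/
  anchor_bracket : ∀ a b ν,
    ∑ μ, ρ b μ * pd μ (ρ a ν) - ∑ μ, ρ a μ * pd μ (ρ b ν)
      + ∑ e, ∑ f, η⁻¹ e f • (ρ e ν * C f a b) = 0
  /-- the local form of the Jacobi identity -/
  jacobi : ∀ a b c d,
    ∑ μ, ρ d μ * pd μ (C a b c) - ∑ μ, ρ a μ * pd μ (C b c d)
      + ∑ μ, ρ b μ * pd μ (C c d a) - ∑ μ, ρ c μ * pd μ (C d a b)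
      + ∑ e, ∑ f, η⁻¹ e f • (C e a b * C c d f)
      + ∑ e, ∑ f, η⁻¹ e f • (C e a c * C d b f)
      + ∑ e, ∑ f, η⁻¹ e f • (C e a d * C b c f) = 0

/-! ### Fields, ghosts, antifields -/

/-- The six species: the fields `X, A, B`, the ghosts `ε, ψ` and the ghost for ghost `ψ̃`. -/
inductive Species
  | X | A | B | eps | psi | psit
  deriving DecidableEq

instance : Fintype Species :=
  ⟨{.X, .A, .B, .eps, .psi, .psit}, fun s => by cases s <;> simp⟩

/-- Ghost number of a species. -/
def Species.gh : Species → ℤ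
  | .X => 0 | .A => 0 | .B => 0 | .eps => 1 | .psi => 1 | .psit => 2

/-- Form degree of a species. -/
def Species.deg : Species → ℤ
  | .X => 0 | .A => 1 | .B => 2 | .eps => 0 | .psi => 1 | .psit => 0

/-- The components `X^μ, A^a, B_μ, ε^a, ψ_μ, ψ̃_μ`. -/
inductive Fld (m k : ℕ)
  | X (μ : Fin m) | A (a : Fin k) | B (μ : Fin m)
  | eps (a : Fin k) | psi (μ : Fin m) | psit (μ : Fin m)
  deriving DecidableEq, Fintype

/-- The species of a component. -/
def Fld.species {m k : ℕ} : Fld m k → Species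
  | .X _ => .X | .A _ => .A | .B _ => .B | .eps _ => .eps | .psi _ => .psi | .psit _ => .psit

/-- The symbols: a field (or ghost) component `φ`, its antifield `φ†` (with the dual index
position), and their de Rham differentials `dφ`, `dφ†`. -/
inductive Gen (m k : ℕ)
  | field (φ : Fld m k) | anti (φ : Fld m k) | dfield (φ : Fld m k) | danti (φ : Fld m k)
  deriving DecidableEq, Fintype

/-- Form degree; `deg φ + deg φ† = 3`. -/
def Gen.deg {m k : ℕ} : Gen m k → ℤ
  | .field φ => φ.species.deg
  | .anti φ => 3 - φ.species.deg
  | .dfield φ => φ.species.deg + 1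
  | .danti φ => 3 - φ.species.deg + 1

/-- Ghost number; `gh φ + gh φ† = -1`. -/
def Gen.gh {m k : ℕ} : Gen m k → ℤ
  | .field φ => φ.species.gh
  | .anti φ => -1 - φ.species.gh
  | .dfield φ => φ.species.gh
  | .danti φ => -1 - φ.species.gh

/-! ### The bigraded algebra of local forms

Elements are polynomials in all symbols other than `X^μ`, with coefficients smooth functions of
`X`, subject to `α β = (-1)^{deg α deg β + gh α gh β} β α`. A basis over `C^∞(U)` is given
by the ordered monomials in which every symbol `g` with `g g = - g g` occurs at most once. -/

/-- The exponent vectors of the basis monomials. -/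
def ValidExp {m k : ℕ} (e : Gen m k → ℕ) : Prop :=
  (∀ g, Odd (g.deg + g.gh) → e g ≤ 1) ∧ ∀ μ, e (.field (.X μ)) = 0

/-- The basis monomials. -/
abbrev Mon (m k : ℕ) : Type := {e : Gen m k → ℕ // ValidExp e}

/-- Form degree of a monomial. -/
def Mon.deg {m k : ℕ} (e : Mon m k) : ℤ := ∑ g, (e.1 g : ℤ) * g.deg

/-- Ghost number of a monomial. -/
def Mon.gh {m k : ℕ} (e : Mon m k) : ℤ := ∑ g, (e.1 g : ℤ) * g.gh

/-- The position of a symbol in some fixed ordering of all symbols. -/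
def Gen.pos {m k : ℕ} (g : Gen m k) : ℕ := (Fintype.equivFin (Gen m k) g : ℕ)

/-- The exponent of the sign that appears when the product of the ordered monomials with
exponents `e` and `e'` is put in order: each pair of symbols that has to be exchanged
contributes `deg · deg + gh · gh`. -/
def signExp {m k : ℕ} (e e' : Gen m k → ℕ) : ℤ :=
  ∑ i, ∑ j : Gen m k, if j.pos < i.pos then
    (e i : ℤ) * (e' j : ℤ) * (i.deg * j.deg + i.gh * j.gh) else 0

/-- The algebra of local forms built from fields, ghosts, antifields and their differentials. -/
def LForm {m : ℕ} (k : ℕ) (U : TopologicalSpace.Opens (Fin m → ℝ)) : Type :=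
  Mon m k →₀ SmoothFn U

section Algebra

variable {m k : ℕ} {U : TopologicalSpace.Opens (Fin m → ℝ)}

instance : AddCommGroup (LForm k U) := inferInstanceAs (AddCommGroup (Mon m k →₀ SmoothFn U))
instance : Module (SmoothFn U) (LForm k U) :=
  inferInstanceAs (Module (SmoothFn U) (Mon m k →₀ SmoothFn U))
instance : Module ℝ (LForm k U) := inferInstanceAs (Module ℝ (Mon m k →₀ SmoothFn U))
instance : IsScalarTower ℝ (SmoothFn U) (LForm k U) :=
  inferInstanceAs (IsScalarTower ℝ (SmoothFn U) (Mon m k →₀ SmoothFn U))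

/-- The coefficients with respect to the basis monomials. -/
def coeffs : LForm k U ≃ₗ[SmoothFn U] (Mon m k →₀ SmoothFn U) := LinearEquiv.refl _ _

open Classical in
/-- `f` times the ordered monomial with exponents `e` (zero if `e` is not allowed). -/
def monOf (e : Gen m k → ℕ) (f : SmoothFn U) : LForm k U :=
  if h : ValidExp e then coeffs.symm (Finsupp.single ⟨e, h⟩ f) else 0

/-- The sign `(-1)^z` as a constant function. -/
def sgn (z : ℤ) : SmoothFn U := ((z.negOnePow : ℤ) : SmoothFn U)

/-- The bilinear product with a prescribed sign `(-1)^{q e e'}` for the product of the ordered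
monomials `e`, `e'`. -/
def prodWith (q : Mon m k → Mon m k → ℤ) :
    LForm k U →ₗ[SmoothFn U] LForm k U →ₗ[SmoothFn U] LForm k U :=
  (Finsupp.linearCombination (SmoothFn U) fun e : Mon m k =>
    (Finsupp.linearCombination (SmoothFn U) fun e' : Mon m k =>
      (monOf (e.1 + e'.1) (sgn (q e e')) : LForm k U)) ∘ₗ coeffs.toLinearMap) ∘ₗ
    coeffs.toLinearMap

theorem ValidExp.of_add_left {e e' : Gen m k → ℕ} (h : ValidExp (e + e')) : ValidExp e :=
  ⟨fun g hg => le_trans (Nat.le_add_right _ _) (h.1 g hg),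
    fun μ => (Nat.add_eq_zero_iff.1 (h.2 μ)).1⟩

theorem ValidExp.of_add_right {e e' : Gen m k → ℕ} (h : ValidExp (e + e')) : ValidExp e' :=
  ValidExp.of_add_left (e' := e) (add_comm e e' ▸ h)

theorem validExp_zero : ValidExp (0 : Gen m k → ℕ) := ⟨fun _ _ => Nat.zero_le _, fun _ => rfl⟩

theorem monOf_of_not {e : Gen m k → ℕ} (h : ¬ ValidExp e) (f : SmoothFn U) : monOf e f = 0 :=
  dif_neg h

theorem single_eq_monOf (e : Mon m k) (f : SmoothFn U) :
    coeffs.symm (Finsupp.single e f) = (monOf e.1 f : LForm k U) :=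
  (dif_pos e.2 : (monOf e.1 f : LForm k U) = _).symm

theorem smul_monOf (e : Gen m k → ℕ) (f g : SmoothFn U) :
    f • (monOf e g : LForm k U) = monOf e (f * g) := by
  unfold monOf
  split_ifs
  · rw [← map_smul, Finsupp.smul_single, smul_eq_mul]
  · exact smul_zero f

theorem LForm.induction {p : LForm k U → Prop} (α : LForm k U) (h0 : p 0)
    (hadd : ∀ β γ, p β → p γ → p (β + γ))
    (hmon : ∀ (e : Mon m k) f, p (monOf e.1 f)) : p α :=
  Finsupp.induction_linear (motive := p) α h0 hadd
    fun e f => by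
      have h := hmon e f
      rwa [← single_eq_monOf] at h

theorem prodWith_monOf (q : Mon m k → Mon m k → ℤ) (e e' : Mon m k) (f g : SmoothFn U) :
    prodWith q (monOf e.1 f) (monOf e'.1 g)
      = (monOf (e.1 + e'.1) (f * g * sgn (q e e')) : LForm k U) := by
  simp only [← single_eq_monOf e, ← single_eq_monOf e', prodWith, LinearMap.comp_apply,
    LinearEquiv.coe_coe, LinearEquiv.apply_symm_apply, Finsupp.linearCombination_single,
    LinearMap.smul_apply, smul_monOf, mul_assoc]

theorem signExp_add_left (e e' e'' : Gen m k → ℕ) :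
    signExp (e + e') e'' = signExp e e'' + signExp e' e'' := by
  simp only [signExp, ← Finset.sum_add_distrib]
  refine Finset.sum_congr rfl fun i _ => Finset.sum_congr rfl fun j _ => ?_
  split_ifs
  · simp only [Pi.add_apply]; push_cast; ring
  · simp

theorem signExp_add_right (e e' e'' : Gen m k → ℕ) :
    signExp e (e' + e'') = signExp e e' + signExp e e'' := by
  simp only [signExp, ← Finset.sum_add_distrib]
  refine Finset.sum_congr rfl fun i _ => Finset.sum_congr rfl fun j _ => ?_
  split_ifs
  · simp only [Pi.add_apply]; push_cast; ring
  · simp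

theorem sgn_add (y z : ℤ) : (sgn (y + z) : SmoothFn U) = sgn y * sgn z := by
  simp [sgn, Int.negOnePow_add]

/-- The product in the bigraded sign convention
`α β = (-1)^{deg α deg β + gh α gh β} β α`. -/
instance : Mul (LForm k U) := ⟨fun α β => prodWith (fun e e' => signExp e.1 e'.1) α β⟩
instance : One (LForm k U) := ⟨monOf 0 1⟩

theorem mul_def (α β : LForm k U) : α * β = prodWith (fun e e' => signExp e.1 e'.1) α β := rfl

theorem monOf_mul_monOf (e e' : Gen m k → ℕ) (f g : SmoothFn U) :
    (monOf e f * monOf e' g : LForm k U) = monOf (e + e') (f * g * sgn (signExp e e')) := by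
  by_cases h : ValidExp e
  · by_cases h' : ValidExp e'
    · exact prodWith_monOf _ ⟨e, h⟩ ⟨e', h'⟩ f g
    · rw [monOf_of_not h', monOf_of_not fun H => h' H.of_add_right, mul_def, map_zero]
  · rw [monOf_of_not h, monOf_of_not fun H => h H.of_add_left, mul_def, map_zero,
      LinearMap.zero_apply]

instance : Ring (LForm k U) :=
  { (inferInstance : AddCommGroup (LForm k U)) with
    mul := (· * ·)
    one := 1
    left_distrib := fun α β γ => map_add _ β γ
    right_distrib := fun α β γ => by simp only [mul_def, map_add, LinearMap.add_apply]
    zero_mul := fun α => by simp only [mul_def, map_zero, LinearMap.zero_apply]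
    mul_zero := fun α => by simp only [mul_def, map_zero]
    one_mul := fun α => by
      induction α using LForm.induction with
      | h0 => simp only [mul_def, map_zero]
      | hadd β γ hβ hγ =>
        simp only [mul_def, map_add] at hβ hγ ⊢
        rw [hβ, hγ]
      | hmon e f =>
        change monOf 0 1 * monOf e.1 f = _
        rw [monOf_mul_monOf]
        simp [signExp, sgn]
    mul_one := fun α => by
      induction α using LForm.induction with
      | h0 => simp only [mul_def, map_zero, LinearMap.zero_apply]
      | hadd β γ hβ hγ =>
        simp only [mul_def, map_add, LinearMap.add_apply] at hβ hγ ⊢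
        rw [hβ, hγ]
      | hmon e f =>
        change monOf e.1 f * monOf 0 1 = _
        rw [monOf_mul_monOf]
        simp [signExp, sgn]
    mul_assoc := fun α β γ => by
      induction α using LForm.induction with
      | h0 => simp only [mul_def, map_zero, LinearMap.zero_apply]
      | hadd α α' h h' =>
        simp only [mul_def, map_add, LinearMap.add_apply] at h h' ⊢
        rw [h, h']
      | hmon e f =>
        induction β using LForm.induction with
        | h0 => simp only [mul_def, map_zero, LinearMap.zero_apply]
        | hadd β β' h h' =>
          simp only [mul_def, map_add, LinearMap.add_apply] at h h' ⊢
          rw [h, h']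
        | hmon e' f' =>
          induction γ using LForm.induction with
          | h0 => simp only [mul_def, map_zero]
          | hadd γ γ' h h' =>
            simp only [mul_def, map_add] at h h' ⊢
            rw [h, h']
          | hmon e'' f'' =>
            simp only [monOf_mul_monOf, signExp_add_left, signExp_add_right, sgn_add, add_assoc]
            congr 1
            ring
    zsmul := fun n α => n • α
    nsmul := fun n α => n • α
    zsmul_zero' := fun α => zero_smul ℤ α
    nsmul_zero := fun α => zero_smul ℕ α
    nsmul_succ := fun n α => succ_nsmul α n
    zsmul_succ' := fun n α => by
      simp [add_smul]
    zsmul_neg' := fun n α => by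
      rw [Int.negSucc_eq, neg_smul]; rfl }

/-- The product `α ⊙ β = (-1)^{gh α deg β} α β`. It is graded commutative for the total degree:
`α ⊙ β = (-1)^{(deg α + gh α)(deg β + gh β)} β ⊙ α`; superfields are multiplied with it. -/
def superMul (a b : LForm k U) : LForm k U :=
  prodWith (fun e e' => signExp e.1 e'.1 + e.gh * e'.deg) a b

/-- A smooth function of `X` as a local form. -/
def fn (f : SmoothFn U) : LForm k U := monOf 0 f

/-- The symbols as elements of the algebra; `X^μ` is the coordinate function. -/
def gen : Gen m k → LForm k U
  | .field (.X μ) => fn (coord U μ)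
  | g => monOf (Pi.single g 1) 1

/-- The field, ghost or ghost for ghost `φ`. -/
abbrev fld (φ : Fld m k) : LForm k U := gen (.field φ)

/-- The antifield `φ†`. -/
abbrev anti (φ : Fld m k) : LForm k U := gen (.anti φ)

/-- Left multiplication. -/
def lmul (α : LForm k U) : LForm k U →ₗ[ℝ] LForm k U :=
  (prodWith (fun e e' => signExp e.1 e'.1) α).restrictScalars ℝ

/-- The left derivative `∂/∂g` with respect to a symbol: `∂_μ` on coefficients for `g = X^μ`;
otherwise `g` is moved to the left-most position and removed, so that
`∂/∂g (h α) = δ_{gh} α + (-1)^{deg g deg h + gh g gh h} h ∂/∂g α`. -/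
def lder : Gen m k → (LForm k U →ₗ[ℝ] LForm k U)
  | .field (.X μ) =>
    (coeffs.symm.toLinearMap.restrictScalars ℝ) ∘ₗ Finsupp.mapRange.linearMap (pd μ) ∘ₗ
      (coeffs.toLinearMap.restrictScalars ℝ)
  | g =>
    ((Finsupp.linearCombination (SmoothFn U) fun e : Mon m k =>
      (monOf (e.1 - Pi.single g 1) ((e.1 g : SmoothFn U) *
        sgn (signExp (Pi.single g 1) (e.1 - Pi.single g 1))) : LForm k U)) ∘ₗ
      coeffs.toLinearMap).restrictScalars ℝ

/-- The de Rham differential `d = ∑ dφ ∂/∂φ + ∑ dφ† ∂/∂φ†`. -/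
def d : LForm k U →ₗ[ℝ] LForm k U :=
  ∑ φ : Fld m k, (lmul (gen (.dfield φ)) ∘ₗ lder (.field φ)
    + lmul (gen (.danti φ)) ∘ₗ lder (.anti φ))

/-- Rescaling of every monomial `e` by a real number `w e`. -/
def rescale (w : Mon m k → ℝ) : LForm k U →ₗ[ℝ] LForm k U :=
  (coeffs.symm.toLinearMap.restrictScalars ℝ) ∘ₗ
    (Finsupp.lsum ℝ fun e : Mon m k => w e • Finsupp.lsingle (R := ℝ) (M := SmoothFn U) e) ∘ₗ
      (coeffs.toLinearMap.restrictScalars ℝ)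

open Classical in
/-- The sum of all terms whose monomial satisfies `p`. -/
def part (p : Mon m k → Prop) : LForm k U →ₗ[ℝ] LForm k U :=
  rescale fun e => if p e then 1 else 0

/-! ### Local functionals -/

/-- Local functionals on the closed world volume: local forms modulo total derivatives. -/
abbrev LocalFunctional (k : ℕ) (U : TopologicalSpace.Opens (Fin m → ℝ)) : Type :=
  LForm k U ⧸ LinearMap.range (d : LForm k U →ₗ[ℝ] LForm k U)

/-- The integral `∫_{T[1]Σ}` over a closed three-dimensional world volume `Σ`: it picks the part of
form degree three, and total derivatives integrate to zero. -/
def integral : LForm k U →ₗ[ℝ] LocalFunctional k U :=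
  (LinearMap.range (d : LForm k U →ₗ[ℝ] LForm k U)).mkQ ∘ₗ part fun e => e.deg = 3

end Algebra

namespace LocalCourantAlgebroid

variable {m k : ℕ} {U : TopologicalSpace.Opens (Fin m → ℝ)} (D : LocalCourantAlgebroid m k U)

/-- `η^{ab} ρ_b^μ` -/
def ρup (a : Fin k) (μ : Fin m) : SmoothFn U := ∑ b, D.η⁻¹ a b • D.ρ b μ

/-- `C^a_{bc} = η^{ad} C_{dbc}` -/
def Cup (a b c : Fin k) : SmoothFn U := ∑ e, D.η⁻¹ a e • D.C e b c

/-! ### The classical action and the field equations -/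

/-- The integrand of the classical action of the untwisted model,
`- B_μ dX^μ + ½ η_{ab} A^a dA^b + ρ_a^μ B_μ A^a + (1/3!) C_{abc} A^a A^b A^c`. -/
def classicalLagrangian : LForm k U :=
  - ∑ μ, fld (.B μ) * gen (.dfield (.X μ))
    + (1 / 2 : ℝ) • ∑ a, ∑ b, D.η a b • (fld (.A a) * gen (.dfield (.A b)))
    + ∑ a, ∑ μ, D.ρ a μ • (fld (.B μ) * fld (.A a))
    + (1 / 6 : ℝ) • ∑ a, ∑ b, ∑ c, D.C a b c • (fld (.A a) * fld (.A b) * fld (.A c))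

/-- `F^μ = dX^μ - ρ_a^μ A^a`, the field equation of `B_μ`. -/
def F (μ : Fin m) : LForm k U :=
  gen (.dfield (.X μ)) - ∑ a, D.ρ a μ • fld (.A a)

/-- `G^a = dA^a + η^{ab} ρ_b^μ B_μ + ½ C^a_{bc} A^b A^c`, the field equation of `A`. -/
def G (a : Fin k) : LForm k U :=
  gen (.dfield (.A a)) + ∑ μ, D.ρup a μ • fld (.B μ)
    + (1 / 2 : ℝ) • ∑ b, ∑ c, D.Cup a b c • (fld (.A b) * fld (.A c))

/-! ### The BRST transformation -/

/-- The BRST transformation of the fields, ghosts and ghosts for ghosts. -/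
def brst : Fld m k → LForm k U
  | .X μ => ∑ a, D.ρ a μ • fld (.eps a)
  | .A a => gen (.dfield (.eps a)) + ∑ μ, D.ρup a μ • fld (.psi μ)
      + ∑ b, ∑ c, D.Cup a b c • (fld (.A b) * fld (.eps c))
  | .B μ => - gen (.dfield (.psi μ))
      - ∑ a, ∑ ν, pd μ (D.ρ a ν) • (fld (.B ν) * fld (.eps a) - fld (.psi ν) * fld (.A a))
      - (1 / 2 : ℝ) • ∑ a, ∑ b, ∑ c,
          pd μ (D.C a b c) • (fld (.A a) * fld (.A b) * fld (.eps c))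
  | .eps a => - ∑ μ, D.ρup a μ • fld (.psit μ)
      - (1 / 2 : ℝ) • ∑ b, ∑ c, D.Cup a b c • (fld (.eps b) * fld (.eps c))
  | .psi μ => gen (.dfield (.psit μ))
      + ∑ a, ∑ ν, pd μ (D.ρ a ν) • (fld (.psit ν) * fld (.A a) + fld (.psi ν) * fld (.eps a))
      + (1 / 2 : ℝ) • ∑ a, ∑ b, ∑ c,
          pd μ (D.C a b c) • (fld (.A a) * fld (.eps b) * fld (.eps c))
  | .psit μ => - ∑ a, ∑ ν, pd μ (D.ρ a ν) • (fld (.psit ν) * fld (.eps a))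
      - (1 / 6 : ℝ) • ∑ a, ∑ b, ∑ c,
          pd μ (D.C a b c) • (fld (.eps a) * fld (.eps b) * fld (.eps c))

/-- The BRST operator `s₀`: the derivation of bidegree (form degree 0, ghost number 1) with
`s₀ φ` as above, `s₀ dφ = d s₀ φ`, and `s₀ φ† = s₀ dφ† = 0`. -/
def s₀ : LForm k U →ₗ[ℝ] LForm k U :=
  ∑ φ : Fld m k, (lmul (D.brst φ) ∘ₗ lder (.field φ)
    + lmul (d (D.brst φ)) ∘ₗ lder (.dfield φ))

/-! ### The operations `𝒪₍ₙ₎` -/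

/-- The operation `𝔣`. In an expression of degree at most one in the field equations, each field
equation is moved to the left-most position and replaced by the antifield that corresponds to it,
with the sign `(-1)^{deg + 1}`: `F^μ ↦ B†^μ` and `G^a ↦ - η^{ab} A†_b`; terms without a field
equation are unchanged. In the variables `F, G` instead of `dX, dA`, the left derivative
with respect to `F^μ` is `∂/∂(dX^μ)` and the one with respect to `G^a` is `∂/∂(dA^a)`. -/
def replaceEOM (α : LForm k U) : LForm k U :=
  α + ∑ μ, (anti (.B μ) - D.F μ) * lder (.dfield (.X μ)) α
    + ∑ a, (- (∑ b, D.η⁻¹ a b • anti (.A b)) - D.G a) * lder (.dfield (.A a)) α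

end LocalCourantAlgebroid

section Algebra

variable {m k : ℕ} {U : TopologicalSpace.Opens (Fin m → ℝ)}

/-- The number of ghosts and ghosts for ghosts, differentiated or not, in a monomial. -/
def ghostCount (e : Mon m k) : ℕ :=
  ∑ φ : Fld m k, if 0 < φ.species.gh then e.1 (.field φ) + e.1 (.dfield φ) else 0

/-- For `α` with a differentiated ghost in some terms, `d (ghostPrimitive α)` is the total
derivative that is split off when the derivative is moved away from the ghosts: for ghosts
`c₁, …, cₙ` without derivatives, `ghostPrimitive (d (c₁ ⋯ cₙ)) = c₁ ⋯ cₙ`. It is the derivation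
`∑ c ∂/∂(dc)` divided by the number of ghosts. -/
def ghostPrimitive (α : LForm k U) : LForm k U :=
  rescale (fun e => ((ghostCount e : ℝ))⁻¹)
    (∑ φ : Fld m k, if 0 < φ.species.gh then fld φ * lder (.dfield φ) α else 0)

/-- Integration by parts: the derivatives are moved away from the ghosts and the resulting total
derivative is dropped. -/
def integrateByParts (α : LForm k U) : LForm k U := α - d (ghostPrimitive α)

end Algebra

namespace LocalCourantAlgebroid

variable {m k : ℕ} {U : TopologicalSpace.Opens (Fin m → ℝ)} (D : LocalCourantAlgebroid m k U)

/-- `𝒪₍₁₎ φ = s₀ φ` -/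
def O₁ (φ : Fld m k) : LForm k U := D.s₀ (fld φ)

/-- `𝒪₍₂₎ φ = 𝔣 (s₀ (𝒪₍₁₎ φ))` -/
def O₂ (φ : Fld m k) : LForm k U := D.replaceEOM (D.s₀ (D.O₁ φ))

/-- `𝒪₍₃₎ φ = 𝔣 (s₀ (𝔣 (𝒪₍₂₎ φ)))`, where the field equations in `s₀ (𝔣 (𝒪₍₂₎ φ))` become visible
after an integration by parts. -/
def O₃ (φ : Fld m k) : LForm k U :=
  D.replaceEOM (integrateByParts (D.s₀ (D.replaceEOM (D.O₂ φ))))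

open Classical in
/-- The sum `∑ φ† O φ` over the components `φ` of a species. -/
def antifieldPairing (O : Fld m k → LForm k U) (s : Species) : LForm k U :=
  ∑ φ : Fld m k, if φ.species = s then anti φ * O φ else 0

/-- `φ† · 𝒪₍ₙ₎ φ` for a species `φ` and `n = 1, 2, 3`; for `n = 3` it is projected to ghost
number zero. -/
def pairing : ℕ → Species → LForm k U
  | 1, s => antifieldPairing D.O₁ s
  | 2, s => antifieldPairing D.O₂ s
  | 3, s => part (fun e => e.gh = 0) (antifieldPairing D.O₃ s)
  | _, _ => 0

/-- The number of antifields of a species in a monomial. -/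
def antifieldCount (s : Species) (e : Mon m k) : ℕ :=
  ∑ φ : Fld m k, if φ.species = s then e.1 (.anti φ) + e.1 (.danti φ) else 0

/-- `β_†!`: for each species the factorial of the number of antifields of that kind. -/
def antifieldFactorial (e : Mon m k) : ℕ := ∏ s : Species, (antifieldCount s e).factorial

open Classical in
/-- `βₙ`: the number of times that a term appears among the `φ† · 𝒪₍ₙ₎ φ`. -/
def multiplicity (n : ℕ) (e : Mon m k) : ℕ :=
  (Finset.univ.filter fun s : Species => coeffs (D.pairing n s) e ≠ 0).card

/-- `(-1)^{gh φ + n} / (β_†! βₙ) φ† · 𝒪₍ₙ₎ φ`, the two factors being those of each term. -/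
def weightedPairing (n : ℕ) (s : Species) : LForm k U :=
  rescale (fun e => ((s.gh + n).negOnePow : ℤ) /
    ((antifieldFactorial e : ℝ) * (D.multiplicity n e : ℝ))) (D.pairing n s)

/-! ### The master action of the superfield construction -/

/-- The nilpotent part `B†^μ + ψ†^μ + ψ̃†^μ` of the superfield of degree zero. -/
def superXNil (μ : Fin m) : LForm k U := anti (.B μ) + anti (.psi μ) + anti (.psit μ)

/-- The superfield of degree zero, `𝐗^μ = X^μ + B†^μ + ψ†^μ + ψ̃†^μ`. -/
def superX (μ : Fin m) : LForm k U := fld (.X μ) + superXNil μ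

/-- The superfield of degree one, `𝐀^a = ε^a + A^a + η^{ab} A†_b - η^{ab} ε†_b`. -/
def superA (a : Fin k) : LForm k U :=
  fld (.eps a) + fld (.A a) + ∑ b, D.η⁻¹ a b • anti (.A b) - ∑ b, D.η⁻¹ a b • anti (.eps b)

/-- The superfield of degree two, `𝐁_μ = ψ̃_μ + ψ_μ + B_μ - X†_μ`. -/
def superB (μ : Fin m) : LForm k U :=
  fld (.psit μ) + fld (.psi μ) + fld (.B μ) - anti (.X μ)

/-- The function `f(𝐗)` of the superfield, by Taylor expansion around `X`. Its terms of higher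
order have form degree at least four and vanish on the world volume. -/
def superFn (f : SmoothFn U) : LForm k U :=
  fn f + ∑ μ, superMul (fn (pd μ f)) (superXNil μ)
    + (1 / 2 : ℝ) • ∑ μ, ∑ ν,
        superMul (superMul (fn (pd μ (pd ν f))) (superXNil μ)) (superXNil ν)
    + (1 / 6 : ℝ) • ∑ μ, ∑ ν, ∑ l,
        superMul (superMul (superMul (fn (pd μ (pd ν (pd l f)))) (superXNil μ)) (superXNil ν))
          (superXNil l)

/-- The integrand of the AKSZ action, i.e. the classical integrand with all fields replaced by
superfields: `- 𝐁_μ d𝐗^μ + ½ η_{ab} 𝐀^a d𝐀^b + ρ_a^μ(𝐗) 𝐁_μ 𝐀^a + (1/3!) C_{abc}(𝐗) 𝐀^a 𝐀^b 𝐀^c`. -/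
def akszLagrangian : LForm k U :=
  - ∑ μ, superMul (superB μ) (d (superX μ))
    + (1 / 2 : ℝ) • ∑ a, ∑ b, D.η a b • superMul (D.superA a) (d (D.superA b))
    + ∑ a, ∑ μ, superMul (superMul (superFn (D.ρ a μ)) (superB μ)) (D.superA a)
    + (1 / 6 : ℝ) • ∑ a, ∑ b, ∑ c,
        superMul (superMul (superMul (superFn (D.C a b c)) (D.superA a)) (D.superA b))
          (D.superA c)

/-- The classical action `S_cl` for vanishing 4-form. -/
def classicalAction : LocalFunctional k U := integral D.classicalLagrangian

/-- The AKSZ-BV master action `S_BV,0`. -/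
def akszAction : LocalFunctional k U := integral D.akszLagrangian

end LocalCourantAlgebroid

end CourantSigma

end

noncomputable section
namespace CourantSigma

/-! ### Partial derivatives -/

section Functions

variable {m : ℕ} {U : TopologicalSpace.Opens (Fin m → ℝ)}

/-! The BRST transformations are the form-degree components of one homological vector field, and the
interaction part of the AKSZ action is the Taylor expansion in 𝐗 of one cubic function Θ = ρ 𝐁 𝐀 + ⅙
C 𝐀𝐀𝐀. The proof makes both facts explicit and compares the results.

Signs are tamed by passing to the product ⊙ (`Tot`, `τ`), for which only the parity of deg + gh
matters. There d and the BRST operator twisted by (-1)^deg (`σ`) are odd derivations, and in the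
square of Δ = d + σ the mixed terms cancel, so Δ² = s₀² on the fields (`Δ_Δ_fT`). For the
antifield-free superfields 𝐀 = ε + A and 𝐁 = ψ̃ + ψ + B the BRST rules collapse to ΔX = F + ρ𝐀, Δ𝐀 =
G - ρ𝐁 - ½C𝐀𝐀, Δ𝐁 = H - ∂ρ𝐁𝐀 - ⅙∂C𝐀𝐀𝐀 (`Δ_X`, `Δ_sA`, `Δ_sB`), with curvatures F, G, H of form
degree 1, 2, 3. When Δ is applied once more, every term without a curvature cancels by the Courant
algebroid axioms, and for 𝐁 by their first derivatives (`square_X`, `square_A`, `square_B`).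
Comparison of form degrees shows that s₀² vanishes on X, ε, ψ̃, is linear in F on A and ψ, and
linear in F and G on B.

The operation 𝔣 turns these into terms of antifield content A†B†, B†B† and ψ†B†. At third order only
B matters: s₀ of its second-order expression contains differentiated ghosts; after integration by
parts d hits the coefficient functions, dX = F + ρA appears, and F becomes one more B† (`τ_O₃_B`).
Everything else has ghost number one after pairing and is projected away. The A†B† term arises from
both A and B, so its multiplicity 2 produces two halves; B†B† and B†B†B† receive 1/2! and 1/3!.
These are the Taylor coefficients.

On the other side the interaction terms are expanded in the nilpotent part of 𝐗 and cut down to form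
degree three (`τ_interaction`, `gr_interaction`). The antifield expressions coincide with those
above. Only the kinetic terms differ, by d of `kineticPrimitive`, which integrates to zero
(`gr_akszLagrangian`, `akszAction_eq`). -/

theorem differentiableAt_extFn (f : SmoothFn U) (x : U) :
    DifferentiableAt ℝ (extFn f.1) x.1 :=
  (f.2.contDiffAt (U.isOpen.mem_nhds x.2)).differentiableAt (by simp)

theorem extFn_mul (f g : U → ℝ) : extFn (f * g) = extFn f * extFn g := by
  simp only [extFn]
  rw [← Function.extend_mul, mul_zero]

theorem pd_mul (μ : Fin m) (f g : SmoothFn U) : pd μ (f * g) = pd μ f * g + f * pd μ g := by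
  ext x
  have e : extFn ((f * g : SmoothFn U) : U → ℝ) = extFn f.1 * extFn g.1 := extFn_mul _ _
  change fderiv ℝ (extFn ((f * g : SmoothFn U) : U → ℝ)) x.1 (Pi.single μ 1) =
    fderiv ℝ (extFn f.1) x.1 (Pi.single μ 1) * g.1 x
      + f.1 x * fderiv ℝ (extFn g.1) x.1 (Pi.single μ 1)
  rw [e, fderiv_mul (differentiableAt_extFn f x) (differentiableAt_extFn g x)]
  simp only [add_apply, smul_apply, smul_eq_mul,
    extFn_apply _ x.2]
  ring

theorem pd_one (μ : Fin m) : pd μ (1 : SmoothFn U) = 0 := by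
  have h := pd_mul μ (1 : SmoothFn U) 1
  rw [mul_one, mul_one, one_mul] at h
  exact left_eq_add.1 h

theorem pd_coord (μ ν : Fin m) : pd μ (coord U ν) = if ν = μ then 1 else 0 := by
  ext x
  -- The extension by zero agrees with the coordinate only on the open set U, so derivatives are
  -- compared through germs.
  have e : extFn (coord U ν).1 =ᶠ[nhds x.1] fun y => y ν := by
    filter_upwards [U.isOpen.mem_nhds x.2] with y hy
    exact extFn_apply _ hy
  change fderiv ℝ (extFn (coord U ν).1) x.1 (Pi.single μ 1) = _
  rw [e.fderiv_eq, show (fun y : Fin m → ℝ => y ν) =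
    ⇑(ContinuousLinearMap.proj (R := ℝ) (φ := fun _ : Fin m => ℝ) ν) from rfl,
    ContinuousLinearMap.fderiv]
  by_cases h : ν = μ
  · subst h; simp
  · simp [h]

theorem pd_comm (μ ν : Fin m) (f : SmoothFn U) : pd μ (pd ν f) = pd ν (pd μ f) := by
  have key : ∀ μ ν : Fin m, ∀ x : U, (pd μ (pd ν f)).1 x =
      fderiv ℝ (fderiv ℝ (extFn f.1)) x.1 (Pi.single μ 1) (Pi.single ν 1) := by
    intro μ ν x
    -- Again only an equality of germs: outside U the two functions are unrelated.
    have e : extFn (pd ν f).1 =ᶠ[nhds x.1] fun y => fderiv ℝ (extFn f.1) y (Pi.single ν 1) := by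
      filter_upwards [U.isOpen.mem_nhds x.2] with y hy
      exact extFn_apply _ hy
    change fderiv ℝ (extFn (pd ν f).1) x.1 (Pi.single μ 1) = _
    have hd : DifferentiableAt ℝ (fderiv ℝ (extFn f.1)) x.1 :=
      ((f.2.contDiffAt (U.isOpen.mem_nhds x.2)).fderiv_right (m := 1)
        (by norm_cast)).differentiableAt (by simp)
    rw [e.fderiv_eq, fderiv_clm_apply hd (differentiableAt_const _)]
    simp
  ext x
  rw [key, key]
  have hs : IsSymmSndFDerivAt ℝ (extFn f.1) x.1 :=
    (f.2.contDiffAt (U.isOpen.mem_nhds x.2)).isSymmSndFDerivAt (by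
      rw [minSmoothness_of_isRCLikeNormedField]; norm_cast)
  exact hs _ _

end Functions

/-! ### Weights -/

section Weights

variable {m k : ℕ} {U : TopologicalSpace.Opens (Fin m → ℝ)} {M : Type*} [AddCommMonoid M]

/-- The weight of an exponent vector for given weights of the symbols. -/
def wt (w : Gen m k → M) (e : Gen m k → ℕ) : M := ∑ g, e g • w g

theorem wt_add (w : Gen m k → M) (e e' : Gen m k → ℕ) : wt w (e + e') = wt w e + wt w e' := by
  simp only [wt, Pi.add_apply, add_smul, Finset.sum_add_distrib]

theorem wt_single (w : Gen m k → M) (g : Gen m k) : wt w (Pi.single g 1) = w g := by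
  rw [wt, Finset.sum_eq_single g]
  · simp
  · intro h _ hg; simp [hg]
  · simp

/-- The local forms that are homogeneous of weight `n`. -/
def HasWt (w : Gen m k → M) (n : M) : Submodule (SmoothFn U) (LForm k U) where
  carrier := {α | ∀ e, coeffs α e ≠ 0 → wt w e.1 = n}
  zero_mem' := fun e h => absurd (by simp) h
  add_mem' {α β} hα hβ e h := by
    by_cases h1 : coeffs α e = 0
    · exact hβ e fun h2 => h (by simp [h1, h2])
    · exact hα e h1
  smul_mem' f α hα e h := hα e fun h1 => h (by simp [h1])

theorem coeffs_monOf (e : Mon m k) (f : SmoothFn U) :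
    coeffs (monOf e.1 f : LForm k U) = Finsupp.single e f := by
  rw [← single_eq_monOf, LinearEquiv.apply_symm_apply]

theorem monOf_zero (e : Gen m k → ℕ) : (monOf e 0 : LForm k U) = 0 := by
  simpa using (smul_monOf (k := k) e (0 : SmoothFn U) 0).symm

theorem monOf_mem_hasWt {w : Gen m k → M} {n : M} {e : Gen m k → ℕ} (h : wt w e = n)
    (f : SmoothFn U) : (monOf e f : LForm k U) ∈ HasWt w n := by
  by_cases hv : ValidExp e
  · intro e' h'
    rw [coeffs_monOf ⟨e, hv⟩] at h'
    have : e' = ⟨e, hv⟩ := by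
      by_contra hne
      exact h' (Finsupp.single_eq_of_ne hne)
    rw [this]; exact h
  · rw [monOf_of_not hv]; exact zero_mem _

theorem sum_monOf (α : LForm k U) : ∑ e ∈ (coeffs α).support, monOf e.1 (coeffs α e) = α := by
  apply coeffs.injective
  simp only [map_sum, coeffs_monOf]
  exact (coeffs α).sum_single

@[elab_as_elim]
-- The monomials in the support of a homogeneous form are homogeneous of the same weight, so summing
-- them one by one never leaves `HasWt w n`. This lets graded identities be checked on monomials.
theorem HasWt.induction {w : Gen m k → M} {n : M}
    {p : (α : LForm k U) → α ∈ HasWt w n → Prop} {α : LForm k U}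
    (hα : α ∈ HasWt w n) (h0 : p 0 (zero_mem _))
    (hadd : ∀ β γ hβ hγ, p β hβ → p γ hγ → p (β + γ) (add_mem hβ hγ))
    (hmon : ∀ (e : Mon m k) f (he : wt w e.1 = n), p (monOf e.1 f) (monOf_mem_hasWt he f)) :
    p α hα := by
  have : ∃ h, p (∑ e ∈ (coeffs α).support, monOf e.1 (coeffs α e)) h := by
    refine Finset.sum_induction _ (fun β => ∃ h, p β h) ?_ ⟨_, h0⟩ fun e he =>
      ⟨_, hmon e _ (hα e (Finsupp.mem_support_iff.1 he))⟩
    rintro β γ ⟨hβ, h⟩ ⟨hγ, h'⟩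
    exact ⟨_, hadd β γ hβ hγ h h'⟩
  obtain ⟨h, h'⟩ := this
  simpa only [sum_monOf] using h'

theorem linearMap_mem_hasWt {M' : Type*} [AddCommMonoid M'] {w : Gen m k → M} {n : M}
    {w' : Gen m k → M'} {n' : M'} (T : LForm k U →ₗ[ℝ] LForm k U)
    (h : ∀ (e : Mon m k) f, wt w e.1 = n → T (monOf e.1 f) ∈ HasWt w' n')
    {α : LForm k U} (hα : α ∈ HasWt w n) : T α ∈ HasWt w' n' := by
  induction hα using HasWt.induction with
  | h0 => rw [map_zero]; exact zero_mem _
  | hadd β γ _ _ hβ hγ => rw [map_add]; exact add_mem hβ hγ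
  | hmon e f he => exact h e f he

theorem real_smul_mem {w : Gen m k → M} {n : M} (r : ℝ) {α : LForm k U} (hα : α ∈ HasWt w n) :
    r • α ∈ HasWt w n := by
  rw [← algebraMap_smul (SmoothFn U) r α]
  exact Submodule.smul_mem _ _ hα

/-- Exponents add under any product of this shape and signs do not affect weights. The arbitrary
sign rule `q` covers the bigraded product and ⊙ at once. -/
theorem prodWith_mem {w : Gen m k → M} {n n' : M} (q : Mon m k → Mon m k → ℤ) {α β : LForm k U}
    (hα : α ∈ HasWt w n) (hβ : β ∈ HasWt w n') : prodWith q α β ∈ HasWt w (n + n') := by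
  induction hα using HasWt.induction with
  | h0 => rw [map_zero]; exact zero_mem _
  | hadd α α' _ _ h h' => rw [map_add, LinearMap.add_apply]; exact add_mem h h'
  | hmon e f he =>
    induction hβ using HasWt.induction with
    | h0 => rw [map_zero]; exact zero_mem _
    | hadd β β' _ _ h h' => rw [map_add]; exact add_mem h h'
    | hmon e' f' he' =>
      rw [prodWith_monOf]
      exact monOf_mem_hasWt (by rw [wt_add, he, he']) _

theorem mul_mem_hasWt {w : Gen m k → M} {n n' : M} {α β : LForm k U}
    (hα : α ∈ HasWt w n) (hβ : β ∈ HasWt w n') : α * β ∈ HasWt w (n + n') :=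
  prodWith_mem _ hα hβ

theorem fn_mem_hasWt (w : Gen m k → M) (f : SmoothFn U) : (fn f : LForm k U) ∈ HasWt w 0 :=
  monOf_mem_hasWt (by simp [wt]) f

/-- The condition on X is needed because X^μ is a coefficient function with exponent vector zero,
hence of weight zero for every `w`. -/
theorem gen_mem_hasWt (w : Gen m k → M) (hw : ∀ μ, w (.field (.X μ)) = 0) (g : Gen m k) :
    (gen g : LForm k U) ∈ HasWt w (w g) := by
  have : ∀ g : Gen m k, (monOf (Pi.single g 1) 1 : LForm k U) ∈ HasWt w (w g) :=
    fun g => monOf_mem_hasWt (wt_single w g) 1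
  rcases g with φ | φ | φ | φ
  · cases φ
    case X μ => rw [hw]; exact fn_mem_hasWt w _
    all_goals exact this _
  all_goals exact this _

/-- The pair (form degree, ghost number). -/
def bideg (g : Gen m k) : ℤ × ℤ := (g.deg, g.gh)

theorem wt_bideg (e : Mon m k) : wt bideg e.1 = (e.deg, e.gh) := by
  ext <;> simp [wt, bideg, Mon.deg, Mon.gh, Prod.fst_sum, Prod.snd_sum]

/-! ### Signs -/

theorem sgn_congr {y z : ℤ} (h : Even (y - z)) : (sgn y : SmoothFn U) = sgn z := by
  have : y.negOnePow = z.negOnePow := (Int.negOnePow_eq_iff y z).2 h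
  rw [sgn, this, sgn]

theorem sgn_zero : (sgn 0 : SmoothFn U) = 1 := by simp [sgn]

theorem sgn_mul_self (z : ℤ) : (sgn z * sgn z : SmoothFn U) = 1 := by
  rw [← sgn_add, ← sgn_zero]; exact sgn_congr ⟨z, by ring⟩

theorem sgn_of_even {z : ℤ} (h : Even z) : (sgn z : SmoothFn U) = 1 := by
  rw [← sgn_zero]; exact sgn_congr (by simpa using h)

theorem sgn_of_odd {z : ℤ} (h : Odd z) : (sgn z : SmoothFn U) = -1 := by
  simp [sgn, Int.negOnePow_odd z h]

/-- The exponent of the sign for the exchange of forms of bidegrees `p` and `q`. -/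
def par (p q : ℤ × ℤ) : ℤ := p.1 * q.1 + p.2 * q.2

/-- A pair of distinct symbols is out of order in exactly one of the two products, so the two sums
together give the full double sum without its diagonal. -/
theorem signExp_add_signExp (e e' : Gen m k → ℕ) :
    signExp e e' + signExp e' e = par (wt bideg e) (wt bideg e')
      - ∑ g : Gen m k, (e g : ℤ) * e' g * (g.deg * g.deg + g.gh * g.gh) := by
  have h1 : par (wt bideg e) (wt bideg e') = ∑ i : Gen m k, ∑ j : Gen m k,
      (e i : ℤ) * e' j * (i.deg * j.deg + i.gh * j.gh) := by
    simp only [par, wt, bideg, Prod.fst_sum, Prod.snd_sum, Prod.smul_fst, Prod.smul_snd,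
      Finset.sum_mul_sum, ← Finset.sum_add_distrib]
    refine Finset.sum_congr rfl fun i _ => Finset.sum_congr rfl fun j _ => ?_
    simp only [nsmul_eq_mul]; ring
  have h2 : signExp e' e = ∑ i : Gen m k, ∑ j : Gen m k, if i.pos < j.pos then
      (e i : ℤ) * e' j * (i.deg * j.deg + i.gh * j.gh) else 0 := by
    rw [signExp, Finset.sum_comm]
    refine Finset.sum_congr rfl fun i _ => Finset.sum_congr rfl fun j _ => ?_
    split_ifs
    · ring
    · rfl
  have h3 : ∑ g : Gen m k, (e g : ℤ) * e' g * (g.deg * g.deg + g.gh * g.gh)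
      = ∑ i : Gen m k, ∑ j : Gen m k, if i = j then
      (e i : ℤ) * e' j * (i.deg * j.deg + i.gh * j.gh) else 0 := by
    refine Finset.sum_congr rfl fun i _ => ?_
    simp
  rw [h1, h2, h3, signExp]
  simp only [← Finset.sum_add_distrib, ← Finset.sum_sub_distrib]
  refine Finset.sum_congr rfl fun i _ => Finset.sum_congr rfl fun j _ => ?_
  have hinj : i.pos = j.pos ↔ i = j := by
    simp [Gen.pos, Fin.val_inj]
  by_cases hij : i = j
  · subst hij; simp
  · have : i.pos ≠ j.pos := fun h => hij (hinj.1 h)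
    rcases lt_or_gt_of_ne this with h | h
    · simp [hij, h, h.not_gt]
    · simp [hij, h, h.not_gt]

theorem even_sq_add_sq {p q : ℤ} (h : Even (p + q)) : Even (p * p + q * q) := by
  have := h.mul_left (p + q)
  have h2 : p * p + q * q = (p + q) * (p + q) - 2 * (p * q) := by ring
  rw [h2]; exact this.sub (even_two_mul _)

/-- Modulo 2 the diagonal term of a symbol is a multiple of deg² + gh² ≡ deg + gh. It is even for
commuting symbols, and for anticommuting ones it is absent by hypothesis. -/
theorem even_signExp_sub (e e' : Gen m k → ℕ) (h : ∀ g, Odd (g.deg + g.gh) → e g = 0 ∨ e' g = 0) :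
    Even (signExp e e' + signExp e' e - par (wt bideg e) (wt bideg e')) := by
  rw [signExp_add_signExp, sub_sub_cancel_left, even_neg]
  refine Finset.even_sum _ fun g _ => ?_
  rcases Int.even_or_odd (g.deg + g.gh) with hg | hg
  · exact (even_sq_add_sq hg).mul_left _
  · rcases h g hg with h | h <;> simp [h]

theorem ValidExp.eq_zero_or {e e' : Gen m k → ℕ} (h : ValidExp (e + e')) (g : Gen m k)
    (hg : Odd (g.deg + g.gh)) : e g = 0 ∨ e' g = 0 := by
  have := h.1 g hg
  simp only [Pi.add_apply] at this
  omega

theorem mul_comm_of_mem {p q : ℤ × ℤ} {α β : LForm k U} (hα : α ∈ HasWt bideg p)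
    (hβ : β ∈ HasWt bideg q) : α * β = (sgn (par p q) : SmoothFn U) • (β * α) := by
  induction hα using HasWt.induction with
  | h0 => simp
  | hadd α α' _ _ h h' => rw [add_mul, mul_add, smul_add, h, h']
  | hmon e f he =>
    induction hβ using HasWt.induction with
    | h0 => simp
    | hadd β β' _ _ h h' => rw [mul_add, add_mul, smul_add, h, h']
    | hmon e' f' he' =>
      rw [monOf_mul_monOf, monOf_mul_monOf, smul_monOf, add_comm e'.1 e.1]
      by_cases hv : ValidExp (e.1 + e'.1)
      · have h := even_signExp_sub e.1 e'.1 fun g hg => hv.eq_zero_or g hg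
        have : (sgn (signExp e.1 e'.1) : SmoothFn U) = sgn (par p q) * sgn (signExp e'.1 e.1) := by
          rw [← sgn_add]
          refine sgn_congr ?_
          rw [he, he'] at h
          have h2 : signExp e.1 e'.1 - (par p q + signExp e'.1 e.1)
            = (signExp e.1 e'.1 + signExp e'.1 e.1 - par p q) - 2 * signExp e'.1 e.1 := by ring
          rw [h2]; exact h.sub (even_two_mul _)
        rw [this]; congr 1; ring
      -- A repeated anticommuting symbol kills the product in either order.
      · rw [monOf_of_not hv, monOf_of_not hv]

instance : Algebra (SmoothFn U) (LForm k U) :=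
  Algebra.ofModule (fun f α β => by simp only [mul_def, map_smul, LinearMap.smul_apply])
    (fun f α β => by simp only [mul_def, map_smul])

end Weights

/-! ### Left derivatives and the graded Leibniz rule -/

section Derivations

variable {m k : ℕ} {U : TopologicalSpace.Opens (Fin m → ℝ)}

theorem monOf_add (e : Gen m k → ℕ) (f g : SmoothFn U) :
    (monOf e (f + g) : LForm k U) = monOf e f + monOf e g := by
  have h := add_smul f g (monOf e 1 : LForm k U)
  simpa only [smul_monOf, mul_one] using h

theorem neg_eq_sgn_mul {z : ℤ} (h : Odd z) (f : SmoothFn U) : -f = sgn z * f := by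
  rw [sgn_of_odd h]; ring

theorem lder_X_monOf (μ : Fin m) (e : Mon m k) (f : SmoothFn U) :
    lder (.field (.X μ)) (monOf e.1 f : LForm k U) = monOf e.1 (pd μ f) := by
  rw [← single_eq_monOf, ← single_eq_monOf]
  simp [lder]

theorem lder_monOf {g : Gen m k} (hg : ∀ μ, g ≠ .field (.X μ)) (e : Mon m k) (f : SmoothFn U) :
    lder g (monOf e.1 f : LForm k U) = monOf (e.1 - Pi.single g 1)
      (f * ((e.1 g : SmoothFn U) * sgn (signExp (Pi.single g 1) (e.1 - Pi.single g 1)))) := by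
  have key : (Finsupp.linearCombination (SmoothFn U) fun e : Mon m k =>
      (monOf (e.1 - Pi.single g 1) ((e.1 g : SmoothFn U) *
        sgn (signExp (Pi.single g 1) (e.1 - Pi.single g 1))) : LForm k U))
      (coeffs (monOf e.1 f : LForm k U)) = monOf (e.1 - Pi.single g 1)
      (f * ((e.1 g : SmoothFn U) * sgn (signExp (Pi.single g 1) (e.1 - Pi.single g 1)))) := by
    rw [coeffs_monOf, Finsupp.linearCombination_single, smul_monOf]
  rcases g with φ | φ | φ | φ
  · cases φ
    case X μ => exact absurd rfl (hg μ)
    all_goals exact key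
  all_goals exact key

theorem exists_eq_single_add {e : Gen m k → ℕ} {g : Gen m k} (h : e g ≠ 0) :
    ∃ c : Gen m k → ℕ, e = Pi.single g 1 + c := by
  refine ⟨e - Pi.single g 1, ?_⟩
  funext i
  by_cases hi : i = g
  · subst hi; simp; omega
  · simp [hi]

theorem ValidExp.single_add {c : Gen m k → ℕ} {g : Gen m k} (hc : ValidExp c)
    (hg : ∀ μ, g ≠ .field (.X μ)) (h : Odd (g.deg + g.gh) → c g = 0) :
    ValidExp (Pi.single g 1 + c) := by
  refine ⟨fun i hi => ?_, fun μ => ?_⟩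
  · by_cases hig : i = g
    · subst hig; simp [h hi]
    · simpa [hig] using hc.1 i hi
  · simp [Ne.symm (hg μ), hc.2 μ]

/-- Writing the exponent as g plus a rest removes the truncated subtraction from the definition; the
factor `c g + 1` is the exponent of g. -/
theorem lder_single_add {g : Gen m k} (hg : ∀ μ, g ≠ .field (.X μ)) {c : Gen m k → ℕ}
    (h : ValidExp (Pi.single g 1 + c)) (f : SmoothFn U) :
    lder g (monOf (Pi.single g 1 + c) f : LForm k U) = monOf c
      (f * (((c g : SmoothFn U) + 1) * sgn (signExp (Pi.single g 1) c))) := by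
  have := lder_monOf hg ⟨_, h⟩ f
  simp only [add_tsub_cancel_left] at this
  rw [this]
  simp [add_comm]

theorem lder_eq_zero_of_apply {g : Gen m k} (hg : ∀ μ, g ≠ .field (.X μ)) {e : Gen m k → ℕ}
    (h : e g = 0) (f : SmoothFn U) : lder g (monOf e f : LForm k U) = 0 := by
  by_cases hv : ValidExp e
  · have := lder_monOf hg ⟨e, hv⟩ f
    rw [this]; simp [h, monOf_zero]
  · rw [monOf_of_not hv, map_zero]

/-- The cases are whether g occurs in the left factor, in the right factor, in both or in neither.
Each reduces to additivity of `signExp` and the exchange rule. Since `monOf` is zero on inadmissible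
exponents, the vanishing products have to be treated alongside. -/
theorem lder_mul_aux {g : Gen m k} (hg : ∀ μ, g ≠ .field (.X μ)) {p : ℤ × ℤ} (e e' : Mon m k)
    (f f' : SmoothFn U) (he : wt bideg e.1 = p) :
    lder g (monOf e.1 f * monOf e'.1 f' : LForm k U) = lder g (monOf e.1 f) * monOf e'.1 f'
      + (sgn (par (bideg g) p) : SmoothFn U) • (monOf e.1 f * lder g (monOf e'.1 f')) := by
  obtain ⟨e, ev⟩ := e
  obtain ⟨e', ev'⟩ := e'
  subst he
  dsimp only
  have hδ : wt bideg (Pi.single g 1 : Gen m k → ℕ) = bideg g := wt_single _ _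
  have h2 : ∀ (g : Gen m k), Odd (g.deg + g.gh) → Odd (g.deg * g.deg + g.gh * g.gh) := by
    intro g hg
    have h2 : g.deg * g.deg + g.gh * g.gh
      = (g.deg + g.gh) * (g.deg + g.gh) - 2 * (g.deg * g.gh) := by ring
    rw [h2]; exact (hg.mul hg).sub_even (even_two_mul _)
  rw [monOf_mul_monOf]
  by_cases h0 : e g = 0
  · rw [lder_eq_zero_of_apply hg h0, zero_mul, zero_add]
    by_cases h0' : e' g = 0
    · rw [lder_eq_zero_of_apply hg h0', lder_eq_zero_of_apply hg (by simp [h0, h0'])]; simp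
    · obtain ⟨c, rfl⟩ := exists_eq_single_add h0'
      rw [lder_single_add hg ev', monOf_mul_monOf, smul_monOf,
        show e + (Pi.single g 1 + c) = Pi.single g 1 + (e + c) by abel]
      by_cases hv : ValidExp (Pi.single g 1 + (e + c))
      · rw [lder_single_add hg hv]
        have hs := even_signExp_sub (Pi.single g 1) e fun i hi => by
          by_cases hig : i = g
          · right; rw [hig, h0]
          · left; simp [hig]
        have : (sgn (signExp e (Pi.single g 1 + c)) * sgn (signExp (Pi.single g 1) (e + c)) :
            SmoothFn U) = sgn (par (bideg g) (wt bideg e)) * sgn (signExp (Pi.single g 1) c)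
              * sgn (signExp e c) := by
          simp only [← sgn_add]
          refine sgn_congr ?_
          rw [signExp_add_right, signExp_add_right]
          rw [hδ] at hs
          convert hs using 1; ring
        congr 1
        simp only [Pi.add_apply, h0, zero_add]
        linear_combination (f * f' * ((c g : SmoothFn U) + 1)) * this
      -- An odd g has exponent zero in `e + c`, so putting it back would preserve admissibility;
      -- hence both sides vanish together.
      · have : ¬ ValidExp (e + c) := fun h => hv <| h.single_add hg fun hodd => by
          have := ev'.1 g hodd
          simp only [Pi.add_apply, Pi.single_eq_same] at this ⊢
          omega
        rw [monOf_of_not hv, monOf_of_not this, map_zero]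
  · obtain ⟨c, rfl⟩ := exists_eq_single_add h0
    rw [lder_single_add hg ev, monOf_mul_monOf]
    by_cases h0' : e' g = 0
    · rw [lder_eq_zero_of_apply hg h0', mul_zero, smul_zero, add_zero,
        show Pi.single g 1 + c + e' = Pi.single g 1 + (c + e') by abel]
      by_cases hv : ValidExp (Pi.single g 1 + (c + e'))
      · rw [lder_single_add hg hv]
        have : (sgn (signExp (Pi.single g 1 + c) e') * sgn (signExp (Pi.single g 1) (c + e')) :
            SmoothFn U) = sgn (signExp (Pi.single g 1) c) * sgn (signExp c e') := by
          simp only [← sgn_add]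
          refine sgn_congr ?_
          rw [signExp_add_left, signExp_add_right]
          exact ⟨signExp (Pi.single g 1) e', by ring⟩
        congr 1
        simp only [Pi.add_apply, h0', add_zero]
        linear_combination (f * f' * ((c g : SmoothFn U) + 1)) * this
      · have : ¬ ValidExp (c + e') := fun h => hv <| h.single_add hg fun hodd => by
          have := ev.1 g hodd
          simp only [Pi.add_apply, Pi.single_eq_same] at this ⊢
          omega
        rw [monOf_of_not hv, monOf_of_not this, map_zero]
    · obtain ⟨c', rfl⟩ := exists_eq_single_add h0'
      rw [lder_single_add hg ev', monOf_mul_monOf, smul_monOf,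
        show c + (Pi.single g 1 + c') = Pi.single g 1 + c + c' by abel, ← monOf_add,
        show Pi.single g 1 + c + (Pi.single g 1 + c')
          = Pi.single g 1 + (Pi.single g 1 + c + c') by abel]
      -- An odd g cannot occur twice: the product is zero and the two Leibniz terms must cancel. The
      -- relative minus sign is the sign deg² + gh² of exchanging g with itself.
      by_cases hodd : Odd (g.deg + g.gh)
      · have hv : ¬ ValidExp (Pi.single g 1 + (Pi.single g 1 + c + c')) := fun h => by
          have := h.1 g hodd
          simp only [Pi.add_apply, Pi.single_eq_same] at this
          omega
        have hc : c g = 0 := by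
          have := ev.1 g hodd
          simp only [Pi.add_apply, Pi.single_eq_same] at this
          omega
        have hc' : c' g = 0 := by
          have := ev'.1 g hodd
          simp only [Pi.add_apply, Pi.single_eq_same] at this
          omega
        have hs := even_signExp_sub (Pi.single g 1) c fun i hi => by
          by_cases hig : i = g
          · right; rw [hig, hc]
          · left; simp [hig]
        rw [hδ] at hs
        have : (sgn (par (bideg g) (wt bideg (Pi.single g 1 + c))) * sgn (signExp (Pi.single g 1) c')
            * sgn (signExp (Pi.single g 1 + c) c') : SmoothFn U)
              = - (sgn (signExp (Pi.single g 1) c) * sgn (signExp c (Pi.single g 1 + c'))) := by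
          rw [neg_eq_sgn_mul (h2 g hodd)]
          simp only [← sgn_add]
          refine sgn_congr ?_
          rw [wt_add, hδ, signExp_add_left, signExp_add_right]
          have e1 : par (bideg g) (bideg g + wt bideg c)
            = g.deg * g.deg + g.gh * g.gh + par (bideg g) (wt bideg c) := by
            simp only [par, bideg, Prod.fst_add, Prod.snd_add]; ring
          rw [e1]
          obtain ⟨r, hr⟩ := hs
          exact ⟨signExp (Pi.single g 1) c' - r, by linear_combination -hr⟩
        rw [monOf_of_not hv, map_zero, hc, hc']
        convert (monOf_zero _).symm using 2
        simp only [Nat.cast_zero, zero_add, one_mul]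
        linear_combination (f * f') * this
      -- For even g both terms land on the same monomial with the same sign, and the two exponents
      -- of g add up.
      · have heven : Even (g.deg + g.gh) := Int.not_odd_iff_even.1 hodd
        by_cases hv : ValidExp (Pi.single g 1 + (Pi.single g 1 + c + c'))
        · rw [lder_single_add hg hv]
          have s1 : (sgn (signExp (Pi.single g 1 + c) (Pi.single g 1 + c'))
              * sgn (signExp (Pi.single g 1) (Pi.single g 1 + c + c')) : SmoothFn U)
              = sgn (signExp (Pi.single g 1) c) * sgn (signExp c (Pi.single g 1 + c')) := by
            simp only [← sgn_add]
            refine sgn_congr ?_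
            simp only [signExp_add_left, signExp_add_right]
            exact ⟨signExp (Pi.single g 1) (Pi.single g 1) + signExp (Pi.single g 1) c', by ring⟩
          have hs := even_signExp_sub (Pi.single g 1) (Pi.single g 1 + c) fun i hi => by
            by_cases hig : i = g
            · exact absurd (hig ▸ hi) hodd
            · left; simp [hig]
          rw [hδ] at hs
          have s2 : (sgn (signExp (Pi.single g 1 + c) (Pi.single g 1 + c'))
              * sgn (signExp (Pi.single g 1) (Pi.single g 1 + c + c')) : SmoothFn U)
              = sgn (par (bideg g) (wt bideg (Pi.single g 1 + c)))
                * sgn (signExp (Pi.single g 1) c')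
                * sgn (signExp (Pi.single g 1 + c) c') := by
            simp only [← sgn_add]
            refine sgn_congr ?_
            convert hs using 1
            simp only [signExp_add_left, signExp_add_right]
            ring
          congr 1
          simp only [Pi.add_apply, Pi.single_eq_same]
          push_cast
          linear_combination (f * f' * ((c g : SmoothFn U) + 1)) * s1
            + (f * f' * ((c' g : SmoothFn U) + 1)) * s2
        · have : ¬ ValidExp (Pi.single g 1 + c + c') := fun h =>
            hv <| h.single_add hg fun h => absurd h hodd
          rw [monOf_of_not hv, monOf_of_not this, map_zero]

theorem lder_X_monOf' (μ : Fin m) (e : Gen m k → ℕ) (f : SmoothFn U) :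
    lder (.field (.X μ)) (monOf e f : LForm k U) = monOf e (pd μ f) := by
  by_cases hv : ValidExp e
  · exact lder_X_monOf μ ⟨e, hv⟩ f
  · rw [monOf_of_not hv, monOf_of_not hv, map_zero]

theorem pd_mul_sgn (μ : Fin m) (f : SmoothFn U) (z : ℤ) : pd μ (f * sgn z) = pd μ f * sgn z := by
  rcases Int.even_or_odd z with h | h
  · simp [sgn_of_even h]
  · rw [sgn_of_odd h]
    have h1 : ∀ f : SmoothFn U, f * -1 = -f := fun f => by ring
    rw [h1, h1]
    exact map_neg _ f

/-- The graded Leibniz rule for the left derivatives. -/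
theorem lder_mul (g : Gen m k) {p : ℤ × ℤ} {α : LForm k U} (hα : α ∈ HasWt bideg p)
    (β : LForm k U) : lder g (α * β) = lder g α * β
      + (sgn (par (bideg g) p) : SmoothFn U) • (α * lder g β) := by
  induction hα using HasWt.induction with
  | h0 => simp
  | hadd α α' _ _ h h' => simp only [add_mul, map_add, h, h', smul_add]; abel
  | hmon e f he =>
    induction β using LForm.induction with
    | h0 => simp
    | hadd β β' h h' => simp only [mul_add, map_add, h, h', smul_add]; abel
    | hmon e' f' =>
      by_cases hg : ∀ μ, g ≠ .field (.X μ)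
      · exact lder_mul_aux hg e e' f f' he
      · push Not at hg
        obtain ⟨μ, rfl⟩ := hg
        have : par (bideg (.field (.X μ) : Gen m k)) p = 0 := by
          simp [par, bideg, Gen.deg, Gen.gh, Fld.species, Species.deg, Species.gh]
        rw [this, sgn_zero, one_smul, monOf_mul_monOf, lder_X_monOf', lder_X_monOf', lder_X_monOf',
          monOf_mul_monOf, monOf_mul_monOf, ← monOf_add, pd_mul_sgn, pd_mul, add_mul]

/-! ### Graded derivations -/

/-- Graded derivations of bidegree `a`. -/
def IsDer (a : ℤ × ℤ) (T : LForm k U →ₗ[ℝ] LForm k U) : Prop :=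
  ∀ p, ∀ α ∈ HasWt bideg p, ∀ β,
    T (α * β) = T α * β + (sgn (par a p) : SmoothFn U) • (α * T β)

theorem IsDer.add {a : ℤ × ℤ} {T T' : LForm k U →ₗ[ℝ] LForm k U} (h : IsDer a T)
    (h' : IsDer a T') : IsDer a (T + T') := fun p α hα β => by
  simp only [LinearMap.add_apply, h p α hα, h' p α hα, add_mul, mul_add, smul_add]; abel

theorem IsDer.sum {a : ℤ × ℤ} {ι : Type*} (s : Finset ι) {T : ι → LForm k U →ₗ[ℝ] LForm k U}
    (h : ∀ i, IsDer a (T i)) : IsDer a (∑ i ∈ s, T i) :=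
  Finset.sum_induction _ (IsDer a) (fun _ _ => IsDer.add)
    (fun p α _ β => by simp) fun i _ => h i

theorem lmul_apply (α β : LForm k U) : lmul α β = α * β := rfl

/-- Moving y, of bidegree `bideg g + a`, past the left factor doubles the sign already produced by
the derivative along g, so only the sign of the bidegree `a` remains. The operators d, s₀ and the
ghost contraction are sums of such terms. -/
theorem isDer_lmul_lder {a : ℤ × ℤ} {g : Gen m k} {y : LForm k U}
    (hy : y ∈ HasWt bideg (bideg g + a)) : IsDer a (lmul y ∘ₗ lder g) := fun p α hα β => by
  simp only [LinearMap.comp_apply, lmul_apply, lder_mul g hα, mul_add, mul_smul_comm]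
  rw [← mul_assoc, ← mul_assoc y α, mul_comm_of_mem hy hα, smul_mul_assoc, smul_smul, mul_assoc α,
    ← sgn_add]
  congr 2
  refine sgn_congr ?_
  simp only [par, Prod.fst_add, Prod.snd_add]
  exact ⟨par (bideg g) p, by simp only [par]; ring⟩

theorem lder_mem_hasWt {M : Type*} [AddCancelCommMonoid M] {w : Gen m k → M}
    (hw : ∀ μ, w (.field (.X μ)) = 0) (g : Gen m k) {n : M} {α : LForm k U}
    (hα : α ∈ HasWt w (w g + n)) : lder g α ∈ HasWt w n := by
  refine linearMap_mem_hasWt _ (fun e f he => ?_) hα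
  by_cases hg : ∀ μ, g ≠ .field (.X μ)
  · by_cases h0 : e.1 g = 0
    · rw [lder_eq_zero_of_apply hg h0]; exact zero_mem _
    · obtain ⟨e, ev⟩ := e
      obtain ⟨c, rfl⟩ := exists_eq_single_add h0
      rw [lder_single_add hg ev]
      rw [wt_add, wt_single] at he
      exact monOf_mem_hasWt (add_left_cancel he) _
  · push Not at hg
    obtain ⟨μ, rfl⟩ := hg
    rw [lder_X_monOf]
    rw [hw, zero_add] at he
    exact monOf_mem_hasWt he _

/-- A left derivative vanishes on forms that do not contain the symbol. -/
theorem lder_eq_zero {w : Gen m k → ℕ} {g : Gen m k} (hg : ∀ μ, g ≠ .field (.X μ)) (hw : w g ≠ 0)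
    {α : LForm k U} (hα : α ∈ HasWt w 0) : lder g α = 0 := by
  induction hα using HasWt.induction with
  | h0 => rw [map_zero]
  | hadd α α' _ _ h h' => rw [map_add, h, h', add_zero]
  | hmon e f he =>
    refine lder_eq_zero_of_apply hg ?_ f
    have := (Finset.sum_eq_zero_iff.1 he) g (Finset.mem_univ g)
    simpa [hw] using this

theorem validExp_single {g : Gen m k} (hg : ∀ μ, g ≠ .field (.X μ)) :
    ValidExp (Pi.single g 1 : Gen m k → ℕ) := by
  simpa using (validExp_zero (m := m) (k := k)).single_add hg fun _ => rfl

theorem gen_eq_monOf {g : Gen m k} (hg : ∀ μ, g ≠ .field (.X μ)) :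
    (gen g : LForm k U) = monOf (Pi.single g 1) 1 := by
  rcases g with φ | φ | φ | φ
  · cases φ
    case X μ => exact absurd rfl (hg μ)
    all_goals rfl
  all_goals rfl

theorem lder_gen_self {g : Gen m k} (hg : ∀ μ, g ≠ .field (.X μ)) :
    lder g (gen g : LForm k U) = 1 := by
  have := lder_single_add (U := U) hg (c := 0) (by simpa using validExp_single hg) 1
  rw [gen_eq_monOf hg]
  rw [add_zero] at this
  rw [this]
  simp [signExp, sgn_zero]
  rfl

theorem lder_gen_of_ne {g h : Gen m k} (hgh : h ≠ g) : lder g (gen h : LForm k U) = 0 := by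
  by_cases hg : ∀ μ, g ≠ .field (.X μ)
  · by_cases hh : ∀ μ, h ≠ .field (.X μ)
    · rw [gen_eq_monOf hh]
      exact lder_eq_zero_of_apply hg (by simp [hgh.symm]) _
    · push Not at hh
      obtain ⟨μ, rfl⟩ := hh
      exact lder_eq_zero_of_apply (e := 0) hg rfl _
  · push Not at hg
    obtain ⟨μ, rfl⟩ := hg
    by_cases hh : ∀ μ, h ≠ .field (.X μ)
    · rw [gen_eq_monOf hh, lder_X_monOf', pd_one, monOf_zero]
    · push Not at hh
      obtain ⟨ν, rfl⟩ := hh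
      have : ν ≠ μ := fun h => hgh (by rw [h])
      change lder _ (monOf 0 (coord U ν)) = _
      rw [lder_X_monOf', pd_coord, if_neg this, monOf_zero]

theorem lder_field_fld (φ χ : Fld m k) :
    lder (.field φ) (fld χ : LForm k U) = if φ = χ then 1 else 0 := by
  split_ifs with h
  · subst h
    by_cases hg : ∀ μ, Gen.field φ ≠ (.field (.X μ) : Gen m k)
    · exact lder_gen_self hg
    · push Not at hg
      obtain ⟨μ, hμ⟩ := hg
      obtain rfl := Gen.field.inj hμ
      change lder _ (monOf 0 (coord U μ)) = _
      rw [lder_X_monOf', pd_coord, if_pos rfl]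
      rfl
  · exact lder_gen_of_ne fun h' => h (Gen.field.inj h').symm

theorem lder_fn {g : Gen m k} (hg : ∀ μ, g ≠ .field (.X μ)) (f : SmoothFn U) :
    lder g (fn f : LForm k U) = 0 := lder_eq_zero_of_apply hg rfl f

theorem lder_X_fn (μ : Fin m) (f : SmoothFn U) :
    lder (.field (.X μ)) (fn f : LForm k U) = fn (pd μ f) := lder_X_monOf' μ 0 f

end Derivations

/-! ### The de Rham differential and the BRST operator as graded derivations -/

section Differentials

variable {m k : ℕ} {U : TopologicalSpace.Opens (Fin m → ℝ)}

theorem Fld.sum_eq {M : Type*} [AddCommMonoid M] (h : Fld m k → M) :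
    ∑ φ, h φ = ∑ μ, h (.X μ) + ∑ a, h (.A a) + ∑ μ, h (.B μ) + ∑ a, h (.eps a) + ∑ μ, h (.psi μ)
      + ∑ μ, h (.psit μ) := by
  let e : (Fin m ⊕ Fin k ⊕ Fin m ⊕ Fin k ⊕ Fin m ⊕ Fin m) ≃ Fld m k :=
    { toFun := Sum.elim .X (Sum.elim .A (Sum.elim .B (Sum.elim .eps (Sum.elim .psi .psit))))
      invFun := fun φ => match φ with
        | .X μ => .inl μ
        | .A a => .inr (.inl a)
        | .B μ => .inr (.inr (.inl μ))
        | .eps a => .inr (.inr (.inr (.inl a)))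
        | .psi μ => .inr (.inr (.inr (.inr (.inl μ))))
        | .psit μ => .inr (.inr (.inr (.inr (.inr μ))))
      left_inv := by rintro (_ | _ | _ | _ | _ | _) <;> rfl
      right_inv := by rintro (_ | _ | _ | _ | _ | _) <;> rfl }
  rw [← e.sum_comp]
  simp only [Fintype.sum_sum_type, ← add_assoc]
  rfl

theorem lmul_lder_mem_hasWt {M : Type*} [AddCommGroup M] {w : Gen m k → M}
    (hw : ∀ μ, w (.field (.X μ)) = 0) {g : Gen m k} {a n : M} {y α : LForm k U}
    (hy : y ∈ HasWt w (w g + a)) (hα : α ∈ HasWt w n) : (lmul y ∘ₗ lder g) α ∈ HasWt w (n + a) := by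
  have h := lder_mem_hasWt hw g (n := n - w g) (α := α) (by simpa using hα)
  have h2 := mul_mem_hasWt hy h
  rwa [show w g + a + (n - w g) = n + a by abel] at h2

theorem d_mem_hasWt {M : Type*} [AddCommGroup M] {w : Gen m k → M}
    (hw : ∀ μ, w (.field (.X μ)) = 0) {a : M} (h1 : ∀ φ, w (.dfield φ) = w (.field φ) + a)
    (h2 : ∀ φ, w (.danti φ) = w (.anti φ) + a) {n : M} {α : LForm k U} (hα : α ∈ HasWt w n) :
    d α ∈ HasWt w (n + a) := by
  rw [d, LinearMap.sum_apply]
  refine Submodule.sum_mem _ fun φ _ => ?_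
  rw [LinearMap.add_apply]
  exact add_mem (lmul_lder_mem_hasWt hw (h1 φ ▸ gen_mem_hasWt w hw _) hα)
    (lmul_lder_mem_hasWt hw (h2 φ ▸ gen_mem_hasWt w hw _) hα)

theorem bideg_X (μ : Fin m) : bideg (.field (.X μ) : Gen m k) = 0 := rfl

theorem bideg_dfield (φ : Fld m k) : bideg (.dfield φ) = bideg (.field φ) + (1, 0) := by
  simp [bideg, Gen.deg, Gen.gh]

theorem bideg_danti (φ : Fld m k) : bideg (.danti φ) = bideg (.anti φ) + (1, 0) := by
  simp [bideg, Gen.deg, Gen.gh]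

theorem d_mem_bideg {p : ℤ × ℤ} {α : LForm k U} (hα : α ∈ HasWt bideg p) :
    d α ∈ HasWt bideg (p + (1, 0)) :=
  d_mem_hasWt bideg_X bideg_dfield bideg_danti hα

theorem gen_mem_bideg (g : Gen m k) : (gen g : LForm k U) ∈ HasWt bideg (bideg g) :=
  gen_mem_hasWt _ bideg_X g

theorem isDer_d : IsDer (1, 0) (d : LForm k U →ₗ[ℝ] LForm k U) :=
  IsDer.sum _ fun φ => (isDer_lmul_lder (bideg_dfield φ ▸ gen_mem_bideg _)).add
    (isDer_lmul_lder (bideg_danti φ ▸ gen_mem_bideg _))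

theorem d_fld (φ : Fld m k) : d (fld φ : LForm k U) = gen (.dfield φ) := by
  rw [d, LinearMap.sum_apply, Finset.sum_eq_single φ]
  · simp [lmul_apply, lder_field_fld, lder_gen_of_ne]
  · intro χ _ h
    simp [lmul_apply, lder_field_fld, lder_gen_of_ne, h]
  · simp

theorem d_anti (φ : Fld m k) : d (anti φ : LForm k U) = gen (.danti φ) := by
  rw [d, LinearMap.sum_apply, Finset.sum_eq_single φ]
  · simp [lmul_apply, lder_gen_self, lder_gen_of_ne]
  · intro χ _ h
    simp [lmul_apply, lder_gen_of_ne, h.symm]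
  · simp

theorem d_dfield (φ : Fld m k) : d (gen (.dfield φ) : LForm k U) = 0 := by
  rw [d, LinearMap.sum_apply]
  exact Finset.sum_eq_zero fun χ _ => by simp [lmul_apply, lder_gen_of_ne]

theorem mul_fn (f : SmoothFn U) (α : LForm k U) : α * fn f = f • α := by
  have : (fn f : LForm k U) = f • 1 := by
    change monOf 0 f = f • monOf 0 1
    rw [smul_monOf, mul_one]
  rw [this, mul_smul_comm, mul_one]

theorem d_fn (f : SmoothFn U) :
    d (fn f : LForm k U) = ∑ μ, pd μ f • gen (.dfield (.X μ)) := by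
  rw [d, LinearMap.sum_apply, Fld.sum_eq]
  simp [lmul_apply, lder_fn, lder_X_fn, mul_fn]

end Differentials

namespace LocalCourantAlgebroid

variable {m k : ℕ} {U : TopologicalSpace.Opens (Fin m → ℝ)} (D : LocalCourantAlgebroid m k U)

theorem brst_mem_bideg (φ : Fld m k) : D.brst φ ∈ HasWt bideg (bideg (.field φ) + (0, 1)) := by
  have key1 : ∀ {g : Gen m k} {p : ℤ × ℤ}, bideg g = p →
      (gen g : LForm k U) ∈ HasWt bideg p := fun h => h ▸ gen_mem_bideg _
  have key : ∀ {g h : Gen m k} {p : ℤ × ℤ}, bideg g + bideg h = p →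
      (gen g * gen h : LForm k U) ∈ HasWt bideg p :=
    fun h => h ▸ mul_mem_hasWt (gen_mem_bideg _) (gen_mem_bideg _)
  have key3 : ∀ {g h i : Gen m k} {p : ℤ × ℤ}, bideg g + bideg h + bideg i = p →
      (gen g * gen h * gen i : LForm k U) ∈ HasWt bideg p :=
    fun h => h ▸ mul_mem_hasWt (mul_mem_hasWt (gen_mem_bideg _) (gen_mem_bideg _)) (gen_mem_bideg _)
  cases φ <;> simp only [brst]
  -- Bidegree is checked summand by summand; what remains is the bidegree of each product of at most
  -- three symbols.
  all_goals
    repeat' first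
      | with_reducible apply add_mem
      | with_reducible apply sub_mem
      | with_reducible apply neg_mem
      | (with_reducible refine Submodule.sum_mem _ fun _ _ => ?_)
      | with_reducible apply real_smul_mem
      | with_reducible apply Submodule.smul_mem
      | with_reducible apply key3
      | with_reducible apply key
      | with_reducible apply key1
  all_goals simp [bideg, Gen.deg, Gen.gh, Fld.species, Species.deg, Species.gh]

theorem isDer_s₀ : IsDer (0, 1) D.s₀ := by
  refine IsDer.sum _ fun φ => (isDer_lmul_lder (D.brst_mem_bideg φ)).add (isDer_lmul_lder ?_)
  have := d_mem_bideg (D.brst_mem_bideg φ)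
  rwa [bideg_dfield, add_right_comm]

theorem s₀_mem_bideg {p : ℤ × ℤ} {α : LForm k U} (hα : α ∈ HasWt bideg p) :
    D.s₀ α ∈ HasWt bideg (p + (0, 1)) := by
  rw [s₀, LinearMap.sum_apply]
  refine Submodule.sum_mem _ fun φ _ => ?_
  rw [LinearMap.add_apply]
  refine add_mem (lmul_lder_mem_hasWt bideg_X (D.brst_mem_bideg φ) hα)
    (lmul_lder_mem_hasWt bideg_X ?_ hα)
  have := d_mem_bideg (D.brst_mem_bideg φ)
  rwa [bideg_dfield, add_right_comm]

theorem s₀_fld (φ : Fld m k) : D.s₀ (fld φ) = D.brst φ := by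
  rw [s₀, LinearMap.sum_apply, Finset.sum_eq_single φ]
  · simp [lmul_apply, lder_field_fld, lder_gen_of_ne]
  · intro χ _ h
    simp [lmul_apply, lder_field_fld, lder_gen_of_ne, h]
  · simp

theorem s₀_dfield (φ : Fld m k) : D.s₀ (gen (.dfield φ)) = d (D.brst φ) := by
  rw [s₀, LinearMap.sum_apply, Finset.sum_eq_single φ]
  · simp [lmul_apply, lder_gen_self, lder_gen_of_ne]
  · intro χ _ h
    simp [lmul_apply, lder_gen_of_ne, h.symm]
  · simp

theorem s₀_anti (φ : Fld m k) : D.s₀ (anti φ) = 0 := by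
  rw [s₀, LinearMap.sum_apply]
  exact Finset.sum_eq_zero fun χ _ => by simp [lmul_apply, lder_gen_of_ne]

theorem s₀_fn (f : SmoothFn U) : D.s₀ (fn f) = ∑ μ, pd μ f • D.brst (.X μ) := by
  rw [s₀, LinearMap.sum_apply, Fld.sum_eq]
  simp [lmul_apply, lder_fn, lder_X_fn, mul_fn]

end LocalCourantAlgebroid

/-! ### The total grading -/

/-- Local forms with the product `⊙`, which is graded commutative in the total degree. -/
def Tot {m : ℕ} (k : ℕ) (U : TopologicalSpace.Opens (Fin m → ℝ)) : Type := LForm k U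

section Total

variable {m k : ℕ} {U : TopologicalSpace.Opens (Fin m → ℝ)}

instance : AddCommGroup (Tot k U) := inferInstanceAs (AddCommGroup (LForm k U))
instance : Module (SmoothFn U) (Tot k U) := inferInstanceAs (Module (SmoothFn U) (LForm k U))
instance : Module ℝ (Tot k U) := inferInstanceAs (Module ℝ (LForm k U))
instance : IsScalarTower ℝ (SmoothFn U) (Tot k U) :=
  inferInstanceAs (IsScalarTower ℝ (SmoothFn U) (LForm k U))

/-- The identification of local forms with elements of the totally graded algebra. -/
def τ : LForm k U ≃ₗ[SmoothFn U] Tot k U := LinearEquiv.refl _ _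

theorem τ_real_smul (r : ℝ) (α : LForm k U) : τ (r • α) = r • τ α := rfl

theorem τ_symm_real_smul (r : ℝ) (x : Tot k U) : τ.symm (r • x) = r • τ.symm x := rfl

instance : Mul (Tot k U) := ⟨fun x y => τ (superMul (τ.symm x) (τ.symm y))⟩
instance : One (Tot k U) := ⟨τ 1⟩

theorem τ_superMul (α β : LForm k U) : τ (superMul α β) = τ α * τ β := rfl

theorem Tot.mul_def (x y : Tot k U) : x * y = τ (prodWith
  (fun e e' => signExp e.1 e'.1 + e.gh * e'.deg) (τ.symm x) (τ.symm y)) := rfl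

theorem Tot.mul_add' (x y z : Tot k U) : x * (y + z) = x * y + x * z := by
  simp only [Tot.mul_def, map_add]

theorem Tot.add_mul' (x y z : Tot k U) : (x + y) * z = x * z + y * z := by
  simp only [Tot.mul_def, map_add, LinearMap.add_apply]

theorem Tot.mul_zero' (x : Tot k U) : x * 0 = 0 := by
  simp only [Tot.mul_def, map_zero]

theorem Tot.zero_mul' (x : Tot k U) : 0 * x = 0 := by
  simp only [Tot.mul_def, map_zero, LinearMap.zero_apply]

theorem Tot.induction {p : Tot k U → Prop} (x : Tot k U) (h0 : p 0)
    (hadd : ∀ y z, p y → p z → p (y + z)) (hmon : ∀ (e : Mon m k) f, p (τ (monOf e.1 f))) : p x :=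
  LForm.induction (p := fun α => p (τ α)) (τ.symm x) h0 hadd hmon

/-- The extra sign is expressed through `wt bideg`, which is defined for inadmissible exponents too;
no case distinction is then needed later. -/
theorem τ_monOf_mul (e e' : Gen m k → ℕ) (f g : SmoothFn U) :
    (τ (monOf e f) * τ (monOf e' g) : Tot k U) = τ (monOf (e + e')
      (f * g * sgn (signExp e e' + (wt bideg e).2 * (wt bideg e').1))) := by
  by_cases h : ValidExp e
  · by_cases h' : ValidExp e'
    · rw [Tot.mul_def, LinearEquiv.symm_apply_apply, LinearEquiv.symm_apply_apply,
        prodWith_monOf _ ⟨e, h⟩ ⟨e', h'⟩ f g]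
      have h1 := wt_bideg ⟨e, h⟩
      have h2 := wt_bideg ⟨e', h'⟩
      simp only at h1 h2
      rw [h1, h2]
    · rw [monOf_of_not h', monOf_of_not fun H => h' H.of_add_right, map_zero, Tot.mul_zero']
  · rw [monOf_of_not h, monOf_of_not fun H => h H.of_add_left, map_zero, Tot.zero_mul']

/-- The extra sign exponent gh · deg is additive in each argument, hence a 2-cocycle, so
associativity survives the twist. -/
instance : Ring (Tot k U) :=
  { (inferInstance : AddCommGroup (Tot k U)) with
    mul := (· * ·)
    one := 1
    left_distrib := Tot.mul_add'
    right_distrib := Tot.add_mul'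
    zero_mul := Tot.zero_mul'
    mul_zero := Tot.mul_zero'
    one_mul := fun x => by
      induction x using Tot.induction with
      | h0 => exact Tot.mul_zero' _
      | hadd y z hy hz => rw [Tot.mul_add', hy, hz]
      | hmon e f =>
        change τ (monOf 0 1) * τ (monOf e.1 f) = _
        rw [τ_monOf_mul]
        simp [signExp, sgn, wt]
    mul_one := fun x => by
      induction x using Tot.induction with
      | h0 => exact Tot.zero_mul' _
      | hadd y z hy hz => rw [Tot.add_mul', hy, hz]
      | hmon e f =>
        change τ (monOf e.1 f) * τ (monOf 0 1) = _
        rw [τ_monOf_mul]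
        simp [signExp, sgn, wt]
    mul_assoc := fun x y z => by
      induction x using Tot.induction with
      | h0 => simp only [Tot.zero_mul']
      | hadd x x' h h' => simp only [Tot.add_mul', h, h']
      | hmon e f =>
        induction y using Tot.induction with
        | h0 => simp only [Tot.zero_mul', Tot.mul_zero']
        | hadd y y' h h' => simp only [Tot.add_mul', Tot.mul_add', h, h']
        | hmon e' f' =>
          induction z using Tot.induction with
          | h0 => simp only [Tot.mul_zero']
          | hadd z z' h h' => simp only [Tot.mul_add', h, h']
          | hmon e'' f'' =>
            simp only [τ_monOf_mul, signExp_add_left, signExp_add_right, wt_add, add_assoc,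
              Prod.fst_add, Prod.snd_add, mul_add, add_mul, sgn_add]
            congr 2
            ring
    zsmul := fun n α => n • α
    nsmul := fun n α => n • α
    zsmul_zero' := fun α => zero_smul ℤ α
    nsmul_zero := fun α => zero_smul ℕ α
    nsmul_succ := fun n α => succ_nsmul α n
    zsmul_succ' := fun n α => by
      simp [add_smul]
    zsmul_neg' := fun n α => by
      rw [Int.negSucc_eq, neg_smul]; rfl }

instance : Algebra (SmoothFn U) (Tot k U) :=
  Algebra.ofModule
    (fun f x y => by simp only [Tot.mul_def, map_smul, LinearMap.smul_apply])
    (fun f x y => by simp only [Tot.mul_def, map_smul])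

instance : IsScalarTower ℝ (Tot k U) (Tot k U) :=
  ⟨fun r x y => by
    rw [smul_eq_mul, smul_eq_mul, ← algebraMap_smul (SmoothFn U) r x,
      ← algebraMap_smul (SmoothFn U) r (x * y), smul_mul_assoc]⟩

instance : SMulCommClass ℝ (Tot k U) (Tot k U) :=
  ⟨fun r x y => by
    rw [smul_eq_mul, smul_eq_mul, ← algebraMap_smul (SmoothFn U) r y,
      ← algebraMap_smul (SmoothFn U) r (x * y), mul_smul_comm]⟩

/-- The elements of the totally graded algebra that are homogeneous of weight `n`. -/
def TWt {M : Type*} [AddCommMonoid M] (w : Gen m k → M) (n : M) :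
    Submodule (SmoothFn U) (Tot k U) :=
  (HasWt w n).comap (τ (k := k) (U := U)).symm.toLinearMap

theorem τ_mem {M : Type*} [AddCommMonoid M] {w : Gen m k → M} {n : M} {α : LForm k U} :
    τ α ∈ TWt w n ↔ α ∈ HasWt w n := by
  rw [TWt, Submodule.mem_comap, LinearEquiv.coe_coe, LinearEquiv.symm_apply_apply]

theorem τ_symm_mem {M : Type*} [AddCommMonoid M] {w : Gen m k → M} {n : M} {x : Tot k U} :
    τ.symm x ∈ HasWt w n ↔ x ∈ TWt w n := by
  rw [TWt, Submodule.mem_comap, LinearEquiv.coe_coe]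

theorem mul_mem_tWt {M : Type*} [AddCommMonoid M] {w : Gen m k → M} {n n' : M} {x y : Tot k U}
    (hx : x ∈ TWt w n) (hy : y ∈ TWt w n') : x * y ∈ TWt w (n + n') := by
  rw [Tot.mul_def, τ_mem]
  exact prodWith_mem _ (τ_symm_mem.2 hx) (τ_symm_mem.2 hy)

theorem real_smul_mem_tWt {M : Type*} [AddCommMonoid M] {w : Gen m k → M} {n : M} (r : ℝ)
    {x : Tot k U} (hx : x ∈ TWt w n) : r • x ∈ TWt w n := by
  rw [← τ_symm_mem, τ_symm_real_smul]
  exact real_smul_mem r (τ_symm_mem.2 hx)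

@[elab_as_elim]
theorem TWt.induction {M : Type*} [AddCommMonoid M] {w : Gen m k → M} {n : M}
    {p : (x : Tot k U) → x ∈ TWt w n → Prop} {x : Tot k U}
    (hx : x ∈ TWt w n) (h0 : p 0 (zero_mem _))
    (hadd : ∀ y z hy hz, p y hy → p z hz → p (y + z) (add_mem hy hz))
    (hmon : ∀ (e : Mon m k) f (he : wt w e.1 = n),
      p (τ (monOf e.1 f)) (τ_mem.2 (monOf_mem_hasWt he f))) :
    p x hx :=
  HasWt.induction (p := fun α h => p (τ α) (τ_mem.2 h)) (τ_symm_mem.2 hx) h0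
    (fun _ _ hβ hγ => hadd _ _ (τ_mem.2 hβ) (τ_mem.2 hγ)) hmon

/-- The dictionary between the two products on bihomogeneous forms; the sign is its own inverse,
which gives the converse `τ_mul`. -/
theorem τ_mul_τ {p q : ℤ × ℤ} {α β : LForm k U} (hα : α ∈ HasWt bideg p)
    (hβ : β ∈ HasWt bideg q) : τ α * τ β = (sgn (p.2 * q.1) : SmoothFn U) • τ (α * β) := by
  induction hα using HasWt.induction with
  | h0 => simp
  | hadd α α' _ _ h h' => simp only [add_mul, map_add, h, h', smul_add]
  | hmon e f he =>
    induction hβ using HasWt.induction with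
    | h0 => simp
    | hadd β β' _ _ h h' => simp only [mul_add, map_add, h, h', smul_add]
    | hmon e' f' he' =>
      rw [monOf_mul_monOf, τ_monOf_mul, he, he', sgn_add, ← map_smul, smul_monOf]
      congr 2
      ring

theorem τ_mul {p q : ℤ × ℤ} {α β : LForm k U} (hα : α ∈ HasWt bideg p)
    (hβ : β ∈ HasWt bideg q) : τ (α * β) = (sgn (p.2 * q.1) : SmoothFn U) • (τ α * τ β) := by
  rw [τ_mul_τ hα hβ, smul_smul, sgn_mul_self, one_smul]

/-- The twists on the two sides contribute gh·deg' and gh'·deg; added to deg·deg' + gh·gh' they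
complete the product of the total degrees. -/
theorem tot_mul_comm {p q : ℤ × ℤ} {x y : Tot k U} (hx : x ∈ TWt bideg p)
    (hy : y ∈ TWt bideg q) :
    x * y = (sgn ((p.1 + p.2) * (q.1 + q.2)) : SmoothFn U) • (y * x) := by
  have h := mul_comm_of_mem (τ_symm_mem.2 hx) (τ_symm_mem.2 hy)
  have h1 := τ_mul_τ (τ_symm_mem.2 hx) (τ_symm_mem.2 hy)
  have h2 := τ_mul (τ_symm_mem.2 hy) (τ_symm_mem.2 hx)
  rw [h, map_smul, h2, smul_smul, smul_smul, ← sgn_add, ← sgn_add] at h1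
  simp only [LinearEquiv.apply_symm_apply] at h1
  rw [h1]
  congr 1
  refine sgn_congr ⟨0, ?_⟩
  simp only [par]; ring

/-- The total parity of the symbols. -/
def parity (g : Gen m k) : ZMod 2 := ((g.deg + g.gh : ℤ) : ZMod 2)

/-- Even and odd elements with respect to the total degree. -/
abbrev TPar (n : ZMod 2) : Submodule (SmoothFn U) (Tot k U) := TWt parity n

theorem wt_parity (e : Gen m k → ℕ) :
    wt parity e = (((wt bideg e).1 + (wt bideg e).2 : ℤ) : ZMod 2) := by
  simp only [wt, parity, bideg, Prod.fst_sum, Prod.snd_sum, Prod.smul_fst, Prod.smul_snd]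
  push_cast
  rw [← Finset.sum_add_distrib]
  simp

theorem tWt_bideg_le_tPar {p : ℤ × ℤ} {x : Tot k U} (hx : x ∈ TWt bideg p) :
    x ∈ TPar ((p.1 + p.2 : ℤ) : ZMod 2) := fun e he => by
  rw [wt_parity, hx e he]

theorem even_of_wt_parity {e : Gen m k → ℕ} (h : wt parity e = 0) :
    Even ((wt bideg e).1 + (wt bideg e).2) := by
  rwa [wt_parity, ZMod.intCast_eq_zero_iff_even] at h

theorem odd_of_wt_parity {e : Gen m k → ℕ} (h : wt parity e = 1) :
    Odd ((wt bideg e).1 + (wt bideg e).2) := by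
  rwa [wt_parity, ZMod.intCast_eq_one_iff_odd] at h

theorem monOf_mem_bideg (e : Gen m k → ℕ) (f : SmoothFn U) :
    (monOf e f : LForm k U) ∈ HasWt bideg (wt bideg e) := monOf_mem_hasWt rfl f

/-- The second factor need not be homogeneous, so even superfields can be moved past arbitrary
expressions. -/
theorem even_mul_comm {x : Tot k U} (hx : x ∈ TPar 0) (y : Tot k U) : x * y = y * x := by
  induction hx using TWt.induction with
  | h0 => simp
  | hadd x x' _ _ h h' => rw [add_mul, mul_add, h, h']
  | hmon e f he =>
    induction y using Tot.induction with
    | h0 => simp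
    | hadd x x' h h' => rw [add_mul, mul_add, h, h']
    | hmon e' f' =>
      rw [tot_mul_comm (τ_mem.2 (monOf_mem_bideg e.1 f)) (τ_mem.2 (monOf_mem_bideg e'.1 f')),
        sgn_of_even ((even_of_wt_parity he).mul_right _), one_smul]

theorem odd_mul_comm {x y : Tot k U} (hx : x ∈ TPar 1) (hy : y ∈ TPar 1) :
    x * y = -(y * x) := by
  induction hx using TWt.induction with
  | h0 => simp
  | hadd x x' _ _ h h' => rw [add_mul, mul_add, h, h', neg_add]
  | hmon e f he =>
    induction hy using TWt.induction with
    | h0 => simp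
    | hadd x x' _ _ h h' => rw [add_mul, mul_add, h, h', neg_add]
    | hmon e' f' he' =>
      rw [tot_mul_comm (τ_mem.2 (monOf_mem_bideg e.1 f)) (τ_mem.2 (monOf_mem_bideg e'.1 f')),
        sgn_of_odd ((odd_of_wt_parity he).mul (odd_of_wt_parity he'))]
      exact neg_one_smul (SmoothFn U) _

/-- Odd derivations of the totally graded algebra. -/
structure IsOddDer (T : Tot k U →ₗ[ℝ] Tot k U) : Prop where
  even_mul : ∀ x ∈ (TPar 0 : Submodule (SmoothFn U) (Tot k U)), ∀ y, T (x * y) = T x * y + x * T y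
  odd_mul : ∀ x ∈ (TPar 1 : Submodule (SmoothFn U) (Tot k U)), ∀ y, T (x * y) = T x * y - x * T y

theorem IsOddDer.add {T T' : Tot k U →ₗ[ℝ] Tot k U} (h : IsOddDer T) (h' : IsOddDer T') :
    IsOddDer (T + T') where
  even_mul x hx y := by
    simp only [LinearMap.add_apply, h.even_mul x hx, h'.even_mul x hx, add_mul, mul_add]; abel
  odd_mul x hx y := by
    simp only [LinearMap.add_apply, h.odd_mul x hx, h'.odd_mul x hx, add_mul, mul_add]; abel

theorem isOddDer_of_bideg {T : Tot k U →ₗ[ℝ] Tot k U}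
    (h : ∀ (p q : ℤ × ℤ) (α β : LForm k U), α ∈ HasWt bideg p → β ∈ HasWt bideg q →
      T (τ α * τ β) = T (τ α) * τ β + (sgn (p.1 + p.2) : SmoothFn U) • (τ α * T (τ β))) :
    IsOddDer T where
  even_mul x hx y := by
    induction hx using TWt.induction with
    | h0 => simp
    | hadd x x' _ _ h h' => simp only [add_mul, map_add, h, h']; abel
    | hmon e f he =>
      induction y using Tot.induction with
      | h0 => simp
      | hadd x x' h h' => simp only [mul_add, map_add, h, h']; abel
      | hmon e' f' =>
        rw [h _ _ _ _ (monOf_mem_bideg e.1 f) (monOf_mem_bideg e'.1 f'),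
          sgn_of_even (even_of_wt_parity he), one_smul]
  odd_mul x hx y := by
    induction hx using TWt.induction with
    | h0 => simp
    | hadd x x' _ _ h h' => simp only [add_mul, map_add, h, h']; abel
    | hmon e f he =>
      induction y using Tot.induction with
      | h0 => simp
      | hadd x x' h h' => simp only [mul_add, map_add, h, h']; abel
      | hmon e' f' =>
        rw [h _ _ _ _ (monOf_mem_bideg e.1 f) (monOf_mem_bideg e'.1 f'),
          sgn_of_odd (odd_of_wt_parity he), sub_eq_add_neg]
        congr 1
        exact neg_one_smul (SmoothFn U) _

/-- All numerical weights (form-degree projections, ghost counts, the factors of β) enter through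
`rescale`. On a form whose support sees a constant weight they become honest scalars. -/
theorem rescale_eq_smul {w : Mon m k → ℝ} {c : ℝ} {α : LForm k U}
    (h : ∀ e, coeffs α e ≠ 0 → w e = c) : rescale w α = c • α := by
  conv_lhs => rw [← sum_monOf α]
  conv_rhs => rw [← sum_monOf α]
  rw [map_sum, Finset.smul_sum]
  refine Finset.sum_congr rfl fun e he => ?_
  rw [← h e (Finsupp.mem_support_iff.1 he), ← single_eq_monOf]
  simp only [rescale, LinearMap.comp_apply, LinearMap.restrictScalars_apply, LinearEquiv.coe_coe,
    LinearEquiv.apply_symm_apply, Finsupp.lsum_single, LinearMap.smul_apply,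
    Finsupp.lsingle_apply]
  exact LinearMap.map_smul_of_tower coeffs.symm.toLinearMap (w e) _

/-- As real scalars, signs can be pulled through d and s₀, which are only ℝ-linear. -/
theorem sgn_smul (z : ℤ) (α : LForm k U) :
    (sgn z : SmoothFn U) • α = ((z.negOnePow : ℤ) : ℝ) • α := by
  rw [← algebraMap_smul (SmoothFn U) ((z.negOnePow : ℤ) : ℝ) α, sgn]
  refine congrArg (· • α) ?_
  exact (map_intCast (algebraMap ℝ (SmoothFn U)) _).symm

/-- The de Rham differential on the totally graded algebra. -/
def dT : Tot k U →ₗ[ℝ] Tot k U :=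
  (τ.toLinearMap.restrictScalars ℝ) ∘ₗ d ∘ₗ (τ.symm.toLinearMap.restrictScalars ℝ)

theorem dT_τ (α : LForm k U) : dT (τ α) = τ (d α) := rfl

/-- Raising the form degree of the right factor changes the sign in ⊙ by (-1)^gh of the left factor.
This turns the Leibniz sign (-1)^deg of d into (-1)^(deg + gh). -/
theorem isOddDer_dT : IsOddDer (dT : Tot k U →ₗ[ℝ] Tot k U) :=
  isOddDer_of_bideg fun p q α β hα hβ => by
    rw [τ_mul_τ hα hβ, ← map_smul, sgn_smul, dT_τ, map_smul, isDer_d p α hα, dT_τ, dT_τ,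
      τ_mul_τ (d_mem_bideg hα) hβ, τ_mul_τ hα (d_mem_bideg hβ), ← sgn_smul, smul_add, smul_smul,
      map_add, map_smul, map_smul, smul_smul, ← sgn_add, ← sgn_add]
    simp only [Prod.fst_add, Prod.snd_add, add_zero]
    congr 2
    refine sgn_congr ⟨- p.2, ?_⟩
    simp only [par]; ring

theorem dT_mem {p : ℤ × ℤ} {x : Tot k U} (hx : x ∈ TWt bideg p) :
    dT x ∈ TWt bideg (p + (1, 0)) := by
  rw [← τ.apply_symm_apply x, dT_τ, τ_mem]
  exact d_mem_bideg (τ_symm_mem.2 hx)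

end Total

namespace LocalCourantAlgebroid

variable {m k : ℕ} {U : TopologicalSpace.Opens (Fin m → ℝ)} (D : LocalCourantAlgebroid m k U)

/-- The BRST operator on the totally graded algebra, with the sign `(-1)^deg` that makes it
anticommute with `d`. -/
def σ : Tot k U →ₗ[ℝ] Tot k U :=
  (τ.toLinearMap.restrictScalars ℝ) ∘ₗ D.s₀ ∘ₗ rescale (fun e => ((e.deg.negOnePow : ℤ) : ℝ)) ∘ₗ
    (τ.symm.toLinearMap.restrictScalars ℝ)

theorem σ_τ {p : ℤ × ℤ} {α : LForm k U} (hα : α ∈ HasWt bideg p) :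
    D.σ (τ α) = (sgn p.1 : SmoothFn U) • τ (D.s₀ α) := by
  have : rescale (fun e => ((e.deg.negOnePow : ℤ) : ℝ)) α = ((p.1.negOnePow : ℤ) : ℝ) • α :=
    rescale_eq_smul fun e he => by
      have := hα e he
      rw [wt_bideg] at this
      rw [← this]
  rw [← map_smul, sgn_smul, ← map_smul, ← this]
  rfl

/-- The twist (-1)^deg does two things: it absorbs the change of the ⊙-sign caused by the raised
ghost number of the left factor, and it turns the Leibniz sign (-1)^gh of s₀ into (-1)^(deg + gh).
-/
theorem isOddDer_σ : IsOddDer D.σ :=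
  isOddDer_of_bideg fun p q α β hα hβ => by
    rw [τ_mul_τ hα hβ, ← map_smul, D.σ_τ (Submodule.smul_mem _ _ (mul_mem_hasWt hα hβ)),
      sgn_smul, map_smul, D.isDer_s₀ p α hα, D.σ_τ hα, D.σ_τ hβ, ← sgn_smul, smul_mul_assoc,
      mul_smul_comm,
      τ_mul_τ (D.s₀_mem_bideg hα) hβ, τ_mul_τ hα (D.s₀_mem_bideg hβ), smul_add, smul_smul,
      map_add, map_smul, map_smul, smul_add, smul_smul, smul_smul, smul_smul, smul_smul, ← sgn_add,
      ← sgn_add, ← sgn_add, ← sgn_add, ← sgn_add]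
    have h1 : (sgn ((p + q).1 + p.2 * q.1) : SmoothFn U)
        = sgn (p.1 + (p + (0, 1)).2 * q.1) := by
      refine sgn_congr ⟨0, ?_⟩
      simp only [Prod.fst_add, Prod.snd_add]; ring
    have h2 : (sgn ((p + q).1 + (p.2 * q.1 + par (0, 1) p)) : SmoothFn U)
        = sgn (p.1 + p.2 + q.1 + p.2 * (q + (0, 1)).1) := by
      refine sgn_congr ⟨0, ?_⟩
      simp only [Prod.fst_add, par]; ring
    rw [smul_smul, ← sgn_add, h1, h2]

/-- The sum of the de Rham differential and of the BRST operator. -/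
def Δ : Tot k U →ₗ[ℝ] Tot k U := dT + D.σ

theorem isOddDer_Δ : IsOddDer D.Δ := isOddDer_dT.add D.isOddDer_σ

end LocalCourantAlgebroid

set_option linter.unusedSectionVars false

/-! ### Contractions -/

section Contraction

variable {𝒪 R : Type*} [CommRing 𝒪] [Ring R] [Algebra 𝒪 R]
variable {ι κ υ : Type*} [Fintype ι] [Fintype κ] [Fintype υ]

/-- The contraction `∑ᵢ uᵢ Φᵢ`. -/
def ct (u Φ : ι → R) : R := ∑ i, u i * Φ i

theorem ct_add_left (u v Φ : ι → R) : ct (fun i => u i + v i) Φ = ct u Φ + ct v Φ := by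
  simp only [ct, add_mul, Finset.sum_add_distrib]

theorem ct_sub_left (u v Φ : ι → R) : ct (fun i => u i - v i) Φ = ct u Φ - ct v Φ := by
  simp only [ct, sub_mul, Finset.sum_sub_distrib]

theorem ct_neg_left (u Φ : ι → R) : ct (fun i => -u i) Φ = -ct u Φ := by
  simp only [ct, neg_mul, Finset.sum_neg_distrib]

theorem ct_zero_left (Φ : ι → R) : ct (fun _ => 0) Φ = 0 := by
  simp only [ct, zero_mul, Finset.sum_const_zero]

theorem ct_smul_left {S : Type*} [Monoid S] [DistribMulAction S R] [IsScalarTower S R R] (r : S)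
    (u Φ : ι → R) : ct (fun i => r • u i) Φ = r • ct u Φ := by
  simp only [ct, smul_mul_assoc, Finset.smul_sum]

theorem ct_add_right (u Φ Ψ : ι → R) : ct u (fun i => Φ i + Ψ i) = ct u Φ + ct u Ψ := by
  simp only [ct, mul_add, Finset.sum_add_distrib]

theorem ct_sub_right (u Φ Ψ : ι → R) : ct u (fun i => Φ i - Ψ i) = ct u Φ - ct u Ψ := by
  simp only [ct, mul_sub, Finset.sum_sub_distrib]

theorem ct_neg_right (u Φ : ι → R) : ct u (fun i => -Φ i) = -ct u Φ := by
  simp only [ct, mul_neg, Finset.sum_neg_distrib]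

theorem ct_zero_right (u : ι → R) : ct u (fun _ => 0) = 0 := by
  simp only [ct, mul_zero, Finset.sum_const_zero]

theorem ct_smul_right {S : Type*} [Monoid S] [DistribMulAction S R] [SMulCommClass S R R] (r : S)
    (u Φ : ι → R) : ct u (fun i => r • Φ i) = r • ct u Φ := by
  simp only [ct, mul_smul_comm, Finset.smul_sum]

theorem sum_ct {υ : Type*} (s : Finset υ) (u : ι → R) (Φ : υ → ι → R) :
    ∑ j ∈ s, ct u (Φ j) = ct u fun i => ∑ j ∈ s, Φ j i := by
  simp only [ct, Finset.mul_sum]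
  exact Finset.sum_comm

theorem ct_ct (u : κ → R) (Ψ : ι → κ → R) (Φ : ι → R) :
    ct (fun i => ct u (Ψ i)) Φ = ct u fun j => ct (fun i => Ψ i j) Φ := by
  simp only [ct, Finset.sum_mul, Finset.mul_sum, mul_assoc]
  exact Finset.sum_comm

theorem ct_smul_one (s : ι → 𝒪) (Φ : ι → R) :
    ct (fun i => s i • (1 : R)) Φ = ∑ i, s i • Φ i := by
  simp only [ct, smul_mul_assoc, one_mul]

theorem sum_smul_ct (s : ι → 𝒪) (u : κ → R) (Φ : ι → κ → R) :
    ∑ i, s i • ct u (Φ i) = ct u fun j => ∑ i, s i • Φ i j := by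
  simp only [ct, Finset.mul_sum, Finset.smul_sum, mul_smul_comm]
  exact Finset.sum_comm

/-- Reordering of variables in a polynomial is reduced to exchanging nested contractions; with
`ct_anticomm` this replaces all manipulations of index sums. -/
theorem ct_comm {u : ι → R} {v : κ → R} (h : ∀ i j, u i * v j = v j * u i) (Φ : ι → κ → R) :
    (ct u fun i => ct v fun j => Φ i j) = ct v fun j => ct u fun i => Φ i j := by
  simp only [ct, Finset.mul_sum, ← mul_assoc, h]
  exact Finset.sum_comm

theorem ct_anticomm {u : ι → R} {v : κ → R} (h : ∀ i j, u i * v j = -(v j * u i))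
    (Φ : ι → κ → R) :
    (ct u fun i => ct v fun j => Φ i j) = -ct v fun j => ct u fun i => Φ i j := by
  simp only [ct, Finset.mul_sum, ← mul_assoc, h, neg_mul, Finset.sum_neg_distrib]
  rw [Finset.sum_comm]

end Contraction

/-! ### The square of the homological vector field -/

section Square

variable {𝒪 R : Type*} [CommRing 𝒪] [Ring R] [Algebra 𝒪 R]
  [Module ℝ R] [IsScalarTower ℝ R R] [SMulCommClass ℝ R R]
  {m k : ℕ} {A : Fin k → R} {B : Fin m → R}

/-- Total contraction of a three index tensor with anticommuting variables. -/
def cube (A : Fin k → R) (t : Fin k → Fin k → Fin k → 𝒪) : R :=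
  ct A fun a => ct A fun b => ct A fun c => t a b c • 1

/-- Total contraction of a four index tensor with anticommuting variables. -/
def quart (A : Fin k → R) (t : Fin k → Fin k → Fin k → Fin k → 𝒪) : R :=
  ct A fun a => cube A (t a)

theorem cube_swap₁₂ (hA : ∀ a b, A a * A b = -(A b * A a)) (t : Fin k → Fin k → Fin k → 𝒪) :
    cube A (fun a b c => t b a c) = -cube A t := ct_anticomm hA _

theorem cube_swap₂₃ (hA : ∀ a b, A a * A b = -(A b * A a)) (t : Fin k → Fin k → Fin k → 𝒪) :
    cube A (fun a b c => t a c b) = -cube A t := by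
  simp only [cube]
  rw [← ct_neg_right]
  exact congrArg _ (funext fun a => ct_anticomm hA _)

theorem cube_rot (hA : ∀ a b, A a * A b = -(A b * A a)) (t : Fin k → Fin k → Fin k → 𝒪) :
    cube A (fun a b c => t b c a) = cube A t := by
  rw [cube_swap₁₂ hA (fun a b c => t a c b), cube_swap₂₃ hA, neg_neg]

theorem quart_swap₁₂ (hA : ∀ a b, A a * A b = -(A b * A a))
    (t : Fin k → Fin k → Fin k → Fin k → 𝒪) :
    quart A (fun a b c d => t b a c d) = -quart A t := ct_anticomm hA _

theorem quart_rot (hA : ∀ a b, A a * A b = -(A b * A a))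
    (t : Fin k → Fin k → Fin k → Fin k → 𝒪) :
    quart A (fun a b c d => t a c d b) = quart A t :=
  congrArg (ct A) (funext fun a => cube_rot hA (t a))

/-- A four-cycle is odd. Hence the four derivative terms of the Jacobi identity, which carry
alternating signs, coincide after contraction. -/
theorem quart_cycle (hA : ∀ a b, A a * A b = -(A b * A a))
    (t : Fin k → Fin k → Fin k → Fin k → 𝒪) :
    quart A (fun a b c d => t b c d a) = -quart A t := by
  rw [quart_swap₁₂ hA (fun a b c d => t a c d b), quart_rot hA]

theorem cube_add (t t' : Fin k → Fin k → Fin k → 𝒪) :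
    cube A (fun a b c => t a b c + t' a b c) = cube A t + cube A t' := by
  simp only [cube, add_smul, ct_add_right]

theorem cube_sub (t t' : Fin k → Fin k → Fin k → 𝒪) :
    cube A (fun a b c => t a b c - t' a b c) = cube A t - cube A t' := by
  simp only [cube, sub_smul, ct_sub_right]

theorem cube_zero : cube A (fun _ _ _ => (0 : 𝒪)) = 0 := by
  simp only [cube, zero_smul, ct_zero_right]

theorem quart_add (t t' : Fin k → Fin k → Fin k → Fin k → 𝒪) :
    quart A (fun a b c d => t a b c d + t' a b c d) = quart A t + quart A t' := by
  simp only [quart, cube_add, ct_add_right]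

theorem quart_sub (t t' : Fin k → Fin k → Fin k → Fin k → 𝒪) :
    quart A (fun a b c d => t a b c d - t' a b c d) = quart A t - quart A t' := by
  simp only [quart, cube_sub, ct_sub_right]

theorem quart_zero : quart A (fun _ _ _ _ => (0 : 𝒪)) = 0 := by
  simp only [quart, cube_zero, ct_zero_right]

variable {dX F : Fin m → R} {dA G : Fin k → R} {dB H : Fin m → R} {T : R →ₗ[ℝ] R}
  {δ : Fin m → 𝒪 → 𝒪} {ρ ρu : Fin k → Fin m → 𝒪} {C Cu : Fin k → Fin k → Fin k → 𝒪}

theorem map_ct_odd (hTA : ∀ a x, T (A a * x) = dA a * x - A a * T x) (Φ : Fin k → R) :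
    T (ct A Φ) = ct dA Φ - ct A fun a => T (Φ a) := by
  simp only [ct, map_sum, hTA, Finset.sum_sub_distrib]

theorem map_ct_even (hTB : ∀ μ x, T (B μ * x) = dB μ * x + B μ * T x) (Φ : Fin m → R) :
    T (ct B Φ) = ct dB Φ + ct B fun a => T (Φ a) := by
  simp only [ct, map_sum, hTB, Finset.sum_add_distrib]

/-- The second application of an odd derivation to `𝐀`, when the first one is given by the
homological vector field of a Courant algebroid up to curvatures. -/
theorem square_A
    (hA : ∀ a b, A a * A b = -(A b * A a)) (hBA : ∀ μ a, B μ * A a = A a * B μ)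
    (hFA : ∀ μ a, F μ * A a = -(A a * F μ)) (hFB : ∀ μ ν, F μ * B ν = B ν * F μ)
    (hGA : ∀ a b, G a * A b = A b * G a)
    (hTA : ∀ a x, T (A a * x) = dA a * x - A a * T x)
    (hTB : ∀ μ x, T (B μ * x) = dB μ * x + B μ * T x)
    (hTf : ∀ f : 𝒪, T (f • 1) = ct dX fun μ => δ μ f • 1)
    (hX : ∀ μ, dX μ = F μ + ct A fun a => ρ a μ • 1)
    (hdA : ∀ a, dA a = G a - (ct B fun μ => ρu a μ • 1)
      - (1 / 2 : ℝ) • ct A fun b => ct A fun c => Cu a b c • 1)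
    (hdB : ∀ μ, dB μ = H μ - (ct B fun ν => ct A fun a => δ μ (ρ a ν) • 1)
      - (1 / 6 : ℝ) • cube A fun a b c => δ μ (C a b c))
    (hCu : ∀ a b c, Cu a b c = -Cu a c b)
    (h1 : ∀ a b ν, ∑ l, ρ b l * δ l (ρu a ν) - ∑ l, ρu a l * δ l (ρ b ν)
      - ∑ e, ρu e ν * Cu a e b = 0)
    (h2 : ∀ a b c d, ∑ l, ρ d l * δ l (Cu a b c) - ∑ l, ρu a l * δ l (C b c d)
      + ∑ l, ρ b l * δ l (Cu a c d) - ∑ l, ρ c l * δ l (Cu a b d)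
      - ∑ e, Cu e c d * Cu a e b - ∑ e, Cu e d b * Cu a e c - ∑ e, Cu e b c * Cu a e d = 0)
    (a : Fin k) :
    T (dA a) = T (G a) - (ct F fun l => (ct B fun μ => δ l (ρu a μ) • 1)
        + (1 / 2 : ℝ) • ct A fun b => ct A fun c => δ l (Cu a b c) • 1)
      - (ct H fun μ => ρu a μ • 1) - (ct G fun b => ct A fun c => Cu a b c • 1) := by
  obtain rfl : dX = _ := funext hX
  obtain rfl : dA = _ := funext hdA
  obtain rfl : dB = _ := funext hdB
  simp only [map_sub, map_smul, map_ct_even hTB, map_ct_odd hTA, hTf]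
  simp only [cube, ct_add_left, ct_sub_left, ct_smul_left, ct_add_right, ct_sub_right,
    ct_smul_right (S := ℝ), ct_ct, ct_smul_one, sum_smul_ct, smul_smul, ← Finset.sum_smul]
  -- The identities `e1` to `e3` bring the curvatures F and G to the front; the remaining terms are
  -- of type 𝐁𝐀 or 𝐀𝐀𝐀 and must cancel.
  have e1 : (ct B fun i => ct F fun l => δ l (ρu a i) • (1 : R))
      = ct F fun l => ct B fun i => δ l (ρu a i) • 1 :=
    ct_comm (fun i j => (hFB j i).symm) _
  have e2 : (ct A fun b => ct A fun c => ct F fun l => δ l (Cu a b c) • (1 : R))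
      = ct F fun l => ct A fun b => ct A fun c => δ l (Cu a b c) • 1 := by
    have hAF : ∀ a l, A a * F l = -(F l * A a) := fun a l => by rw [hFA, neg_neg]
    simp only [ct_anticomm hAF, ct_neg_right, neg_neg]
  have e3 : (ct A fun b => ct G fun c => Cu a b c • (1 : R))
      = -ct G fun b => ct A fun c => Cu a b c • 1 := by
    rw [ct_comm (fun i j => (hGA j i).symm), ← ct_neg_right]
    simp only [← ct_neg_right, ← neg_smul]
    simp only [← hCu]
  have e4 : (ct A fun b => ct B fun μ => (∑ e, ρu e μ * Cu a b e) • (1 : R))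
      = -ct B fun μ => ct A fun b => (∑ e, ρu e μ * Cu a e b) • 1 := by
    rw [ct_comm (fun i j => (hBA j i).symm)]
    simp only [← ct_neg_right, ← neg_smul, ← Finset.sum_neg_distrib, ← mul_neg, ← hCu]
  -- Terms of type 𝐁𝐀: the compatibility of anchor and bracket.
  have e5 : (ct B fun μ => ct A fun b => (∑ l, ρ b l * δ l (ρu a μ)) • (1 : R))
      - (ct B fun μ => ct A fun b => (∑ l, δ l (ρ b μ) * ρu a l) • 1)
      - (ct B fun μ => ct A fun b => (∑ e, ρu e μ * Cu a e b) • 1) = 0 := by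
    simp only [← ct_sub_right, ← sub_smul, mul_comm (δ _ _) (ρu _ _), h1, zero_smul, ct_zero_right]
  set t : Fin k → Fin k → Fin k → 𝒪 := fun b c d => ∑ l, ρ d l * δ l (Cu a b c) with ht
  set s : Fin k → Fin k → Fin k → 𝒪 := fun b c d => ∑ e, Cu e c d * Cu a e b with hs
  -- Terms of type 𝐀𝐀𝐀: contracted with anticommuting variables, the three derivative terms of the
  -- Jacobi identity and its three quadratic terms become equal, whence the factors 3.
  have e6 : (3 : ℝ) • cube A t - cube A (fun b c d => ∑ l, δ l (C b c d) * ρu a l)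
      - (3 : ℝ) • cube A s = 0 := by
    have h := congrArg (cube A) (funext fun b => funext fun c => funext fun d => h2 a b c d)
    simp only [mul_comm (ρu _ _) (δ _ _), cube_sub, cube_add, cube_zero] at h
    have r1 := cube_rot hA t
    have r2 := cube_swap₂₃ hA t
    have r3 := cube_rot hA s
    have r4 := (cube_rot hA fun a b c => s b c a).trans r3
    simp only [ht, hs] at r1 r2 r3 r4 h ⊢
    rw [r1, r2, r3, r4] at h
    rw [← h]
    module
  have e7 : cube A (fun b c d => ∑ e, Cu e b c * Cu a e d) = cube A s := by
    exact (cube_rot hA fun a b c => s b c a).trans (cube_rot hA s)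
  have e8 : cube A (fun b c d => ∑ e, Cu e c d * Cu a b e) = -cube A s := by
    simp only [cube, hs, ← ct_neg_right, ← neg_smul, ← Finset.sum_neg_distrib, ← mul_neg, ← hCu]
  simp only [cube] at e6 e7 e8
  rw [e1, e2, e3, e4, e7, e8]
  rw [sub_sub, sub_eq_zero] at e5 e6
  have e6' := congrArg ((1 / 3 : ℝ) • ·) e6
  simp only [smul_smul, smul_add] at e6'
  norm_num only [one_smul] at e6'
  rw [e5, e6']
  module

/-- The components of the vector field along 𝐁 are first derivatives of the structure functions, so
the cancellation uses first derivatives of the axioms: isotropy for terms 𝐁𝐁, compatibility of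
anchor and bracket for 𝐁𝐀𝐀, and Jacobi for 𝐀𝐀𝐀𝐀. Terms with a curvature are moved to the front and
kept. -/
theorem square_B
    (hA : ∀ a b, A a * A b = -(A b * A a)) (hBA : ∀ μ a, B μ * A a = A a * B μ)
    (hBB : ∀ μ ν, B μ * B ν = B ν * B μ)
    (hFA : ∀ μ a, F μ * A a = -(A a * F μ)) (hFB : ∀ μ ν, F μ * B ν = B ν * F μ)
    (hGA : ∀ a b, G a * A b = A b * G a) (hGB : ∀ a μ, G a * B μ = B μ * G a)
    (hTA : ∀ a x, T (A a * x) = dA a * x - A a * T x)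
    (hTB : ∀ μ x, T (B μ * x) = dB μ * x + B μ * T x)
    (hTf : ∀ f : 𝒪, T (f • 1) = ct dX fun μ => δ μ f • 1)
    (hX : ∀ μ, dX μ = F μ + ct A fun a => ρ a μ • 1)
    (hdA : ∀ a, dA a = G a - (ct B fun μ => ρu a μ • 1)
      - (1 / 2 : ℝ) • ct A fun b => ct A fun c => Cu a b c • 1)
    (hdB : ∀ μ, dB μ = H μ - (ct B fun ν => ct A fun a => δ μ (ρ a ν) • 1)
      - (1 / 6 : ℝ) • cube A fun a b c => δ μ (C a b c))
    (hC12 : ∀ μ a b c, δ μ (C a b c) = -δ μ (C b a c))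
    (hC23 : ∀ μ a b c, δ μ (C a b c) = -δ μ (C a c b))
    (h1 : ∀ μ ν l, ∑ a, ρu a l * δ μ (ρ a ν) + ∑ a, ρu a ν * δ μ (ρ a l) = 0)
    (h2 : ∀ μ a b ν, ∑ l, (δ μ (ρ b l) * δ l (ρ a ν) + ρ b l * δ l (δ μ (ρ a ν)))
      - ∑ l, (δ μ (ρ a l) * δ l (ρ b ν) + ρ a l * δ l (δ μ (ρ b ν)))
      + ∑ f, Cu f a b * δ μ (ρ f ν) + ∑ f, ρu f ν * δ μ (C f a b) = 0)
    (h3 : ∀ μ a b c d, ∑ l, (δ μ (ρ d l) * δ l (C a b c) + ρ d l * δ l (δ μ (C a b c)))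
      - ∑ l, (δ μ (ρ a l) * δ l (C b c d) + ρ a l * δ l (δ μ (C b c d)))
      + ∑ l, (δ μ (ρ b l) * δ l (C c d a) + ρ b l * δ l (δ μ (C c d a)))
      - ∑ l, (δ μ (ρ c l) * δ l (C d a b) + ρ c l * δ l (δ μ (C d a b)))
      + ∑ e, (Cu e a b * δ μ (C e c d) + Cu e c d * δ μ (C e a b))
      + ∑ e, (Cu e a c * δ μ (C e d b) + Cu e d b * δ μ (C e a c))
      + ∑ e, (Cu e a d * δ μ (C e b c) + Cu e b c * δ μ (C e a d)) = 0)
    (μ : Fin m) :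
    T (dB μ) = T (H μ) - (ct F fun l => (ct B fun ν => ct A fun a => δ l (δ μ (ρ a ν)) • 1)
        + (1 / 6 : ℝ) • cube A fun a b c => δ l (δ μ (C a b c)))
      - (ct H fun ν => ct A fun a => δ μ (ρ a ν) • 1)
      - (ct G fun a => (ct B fun ν => δ μ (ρ a ν) • 1)
        + (1 / 2 : ℝ) • ct A fun b => ct A fun c => δ μ (C a b c) • 1) := by
  obtain rfl : dX = _ := funext hX
  obtain rfl : dA = _ := funext hdA
  obtain rfl : dB = _ := funext hdB
  have hcyc : ∀ a b c, δ μ (C a b c) = δ μ (C c a b) := fun a b c => by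
    rw [hC23, hC12, neg_neg]
  have hAF : ∀ a l, A a * F l = -(F l * A a) := fun a l => by rw [hFA, neg_neg]
  simp only [map_sub, map_smul, map_ct_even hTB, cube, map_ct_odd hTA, hTf]
  simp only [ct_add_left, ct_sub_left, ct_smul_left, ct_add_right, ct_sub_right,
    ct_smul_right (S := ℝ), ct_ct, ct_smul_one, sum_smul_ct, smul_smul, ← Finset.sum_smul]
  have f1 : (ct B fun ν => ct A fun a => ct F fun l => δ l (δ μ (ρ a ν)) • (1 : R))
      = -ct F fun l => ct B fun ν => ct A fun a => δ l (δ μ (ρ a ν)) • 1 := by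
    simp only [ct_anticomm hAF, ct_neg_right, ct_comm fun i j => (hFB j i).symm]
  have f2 : (ct A fun a => ct A fun b => ct A fun c => ct F fun l => δ l (δ μ (C a b c)) • (1 : R))
      = -ct F fun l => ct A fun a => ct A fun b => ct A fun c => δ l (δ μ (C a b c)) • 1 := by
    simp only [ct_anticomm hAF, ct_neg_right, neg_neg]
  have g1 : (ct B fun ν => ct G fun a => δ μ (ρ a ν) • (1 : R))
      = ct G fun a => ct B fun ν => δ μ (ρ a ν) • 1 := ct_comm (fun i j => (hGB j i).symm) _
  have g2 : (ct A fun a => ct G fun b => ct A fun c => δ μ (C a b c) • (1 : R))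
      = -ct G fun a => ct A fun b => ct A fun c => δ μ (C a b c) • 1 := by
    rw [ct_comm fun i j => (hGA j i).symm]
    simp only [← ct_neg_right, ← neg_smul, ← hC12]
  have g3 : (ct A fun a => ct A fun b => ct G fun c => δ μ (C a b c) • (1 : R))
      = ct G fun a => ct A fun b => ct A fun c => δ μ (C a b c) • 1 := by
    simp only [ct_comm fun i j => (hGA j i).symm]
    simp only [hcyc]
  -- The variables 𝐁 commute, so only the symmetric part of the coefficient contributes, and that is
  -- the derivative of the isotropy condition.
  have b1 : (ct B fun ν => ct B fun l => (∑ a, ρu a l * δ μ (ρ a ν)) • (1 : R)) = 0 := by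
    have h : (ct B fun ν => ct B fun l => (∑ a, ρu a l * δ μ (ρ a ν)) • (1 : R))
        + (ct B fun ν => ct B fun l => (∑ a, ρu a ν * δ μ (ρ a l)) • (1 : R)) = 0 := by
      simp only [← ct_add_right, ← add_smul, h1, zero_smul, ct_zero_right]
    rw [ct_comm hBB fun ν l => (∑ a, ρu a ν * δ μ (ρ a l)) • (1 : R), ← two_smul ℝ] at h
    simpa using h
  set Y1 := ct B fun ν => ct A fun a => ct A fun b =>
    (∑ l, δ l (ρ a ν) * δ μ (ρ b l)) • (1 : R) with hY1
  set Y2 := ct B fun ν => ct A fun a => ct A fun b =>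
    (∑ l, ρ b l * δ l (δ μ (ρ a ν))) • (1 : R) with hY2
  set Y3 := ct B fun ν => ct A fun a => ct A fun b =>
    (∑ f, Cu f a b * δ μ (ρ f ν)) • (1 : R) with hY3
  set Y4 := ct B fun ν => ct A fun a => ct A fun b =>
    (∑ f, ρu f ν * δ μ (C f a b)) • (1 : R) with hY4
  have b2 : (ct A fun a => ct B fun ν => ct A fun b =>
      (∑ f, ρu f ν * δ μ (C a f b)) • (1 : R)) = -Y4 := by
    rw [ct_comm fun i j => (hBA j i).symm]
    simp only [hY4, ← ct_neg_right, ← neg_smul, ← Finset.sum_neg_distrib, ← mul_neg, ← hC12]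
  have b3 : (ct A fun a => ct A fun b => ct B fun ν =>
      (∑ f, ρu f ν * δ μ (C a b f)) • (1 : R)) = Y4 := by
    simp only [ct_comm fun i j => (hBA j i).symm]
    simp only [hY4, hcyc]
  -- Antisymmetrisation in the two variables 𝐀 identifies the two anchor sums up to sign, which
  -- doubles `Y1` and `Y2`.
  have b4 : (2 : ℝ) • Y1 + (2 : ℝ) • Y2 + Y3 + Y4 = 0 := by
    have h : ∀ ν, (ct A fun a => ct A fun b => (∑ l, (δ μ (ρ b l) * δ l (ρ a ν)
        + ρ b l * δ l (δ μ (ρ a ν)))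
      - ∑ l, (δ μ (ρ a l) * δ l (ρ b ν) + ρ a l * δ l (δ μ (ρ b ν)))
      + ∑ f, Cu f a b * δ μ (ρ f ν) + ∑ f, ρu f ν * δ μ (C f a b)) • (1 : R)) = 0 := fun ν => by
      simp only [h2, zero_smul, ct_zero_right]
    have h' := congrArg (ct B) (funext h)
    simp only [add_smul, sub_smul, Finset.sum_add_distrib, ct_add_right, ct_sub_right,
      ct_zero_right] at h'
    have k1 : (ct B fun ν => ct A fun a => ct A fun b =>
        (∑ l, δ μ (ρ b l) * δ l (ρ a ν)) • (1 : R)) = Y1 := by simp only [hY1, mul_comm]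
    have k2 : (ct B fun ν => ct A fun a => ct A fun b =>
        (∑ l, δ μ (ρ a l) * δ l (ρ b ν)) • (1 : R)) = -Y1 := by
      rw [hY1, ← ct_neg_right]
      refine congrArg _ (funext fun ν => ?_)
      rw [ct_anticomm hA]
      simp only [mul_comm]
    have k3 : (ct B fun ν => ct A fun a => ct A fun b =>
        (∑ l, ρ a l * δ l (δ μ (ρ b ν))) • (1 : R)) = -Y2 := by
      rw [hY2, ← ct_neg_right]
      exact congrArg _ (funext fun ν => ct_anticomm hA _)
    rw [k1, k2, k3] at h'
    rw [← h']
    module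
  set P : Fin k → Fin k → Fin k → Fin k → 𝒪 := fun a b c d =>
    ∑ l, (δ μ (ρ d l) * δ l (C a b c) + ρ d l * δ l (δ μ (C a b c))) with hP
  set S : Fin k → Fin k → Fin k → Fin k → 𝒪 := fun a b c d =>
    ∑ e, Cu e a b * δ μ (C e c d) with hS
  have c1 := quart_cycle hA P
  have c2 := (quart_cycle hA fun a b c d => P b c d a).trans (congrArg _ c1)
  have c3 := (quart_cycle hA fun a b c d => P c d a b).trans (congrArg _ c2)
  have d1 := quart_rot hA S
  have d2 := (quart_rot hA fun a b c d => S a c d b).trans d1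
  have d3 := (quart_cycle hA fun a b c d => S b c d a).trans (congrArg _ (quart_cycle hA S))
  rw [neg_neg] at d3
  have d4 := (quart_rot hA fun a b c d => S c d a b).trans d3
  have d5 := (quart_rot hA fun a b c d => S d b a c).trans d4
  -- After contraction all four derivative terms agree, and so do the six products arising from the
  -- three quadratic terms by the Leibniz rule.
  have q1 : (4 : ℝ) • quart A P + (6 : ℝ) • quart A S = 0 := by
    have h := congrArg (quart A) (funext fun a => funext fun b => funext fun c => funext fun d =>
      h3 μ a b c d)
    simp only [Finset.sum_add_distrib (f := fun e => Cu e _ _ * δ μ (C e _ _)), quart_add,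
      quart_sub, quart_zero] at h
    simp only [hP, hS] at c1 c2 c3 d1 d2 d3 d4 d5 h ⊢
    rw [c1, c2, c3, d1, d2, d3, d4, d5] at h
    rw [← h]
    module
  have q2 : quart A P = (quart A fun a b c d => ∑ l, δ l (C a b c) * δ μ (ρ d l))
      + quart A fun a b c d => ∑ l, ρ d l * δ l (δ μ (C a b c)) := by
    rw [← quart_add]
    simp only [hP, Finset.sum_add_distrib, mul_comm (δ μ (ρ _ _))]
  have q3 : (quart A fun a b c d => ∑ e, Cu e b c * δ μ (C a e d)) = -quart A S := by
    rw [← d5]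
    simp only [hS, quart, cube, ← ct_neg_right, ← neg_smul, ← Finset.sum_neg_distrib, ← mul_neg,
      ← hC12]
  have q4 : (quart A fun a b c d => ∑ e, Cu e c d * δ μ (C a b e)) = quart A S := by
    rw [← d3]
    simp only [hS, hcyc]
  rw [q2] at q1
  simp only [hS, quart, cube] at q1 q3 q4
  rw [f1, f2, g1, g2, g3, b1, b2, b3, q3, q4]
  have b4' : Y1 = -Y2 - (1 / 2 : ℝ) • Y3 - (1 / 2 : ℝ) • Y4 := by
    have := congrArg ((1 / 2 : ℝ) • ·) b4
    simp only [smul_zero] at this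
    rw [← sub_eq_zero, ← this]
    module
  rw [add_comm, ← eq_neg_iff_add_eq_zero, ← smul_neg] at q1
  have q1' := congrArg ((1 / 6 : ℝ) • ·) q1
  simp only [smul_smul, smul_add, smul_neg] at q1'
  norm_num only [one_smul] at q1'
  rw [b4', q1']
  module

/-- The term linear in 𝐁 is the isotropy of the anchor, and the terms 𝐀𝐀 cancel because the anchor
is compatible with the bracket. -/
theorem square_X
    (hA : ∀ a b, A a * A b = -(A b * A a)) (hFA : ∀ μ a, F μ * A a = -(A a * F μ))
    (hTA : ∀ a x, T (A a * x) = dA a * x - A a * T x)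
    (hTf : ∀ f : 𝒪, T (f • 1) = ct dX fun μ => δ μ f • 1)
    (hX : ∀ μ, dX μ = F μ + ct A fun a => ρ a μ • 1)
    (hdA : ∀ a, dA a = G a - (ct B fun μ => ρu a μ • 1)
      - (1 / 2 : ℝ) • ct A fun b => ct A fun c => Cu a b c • 1)
    (h1 : ∀ μ ν, ∑ a, ρu a μ * ρ a ν = 0)
    (h2 : ∀ a b ν, ∑ l, ρ b l * δ l (ρ a ν) - ∑ l, ρ a l * δ l (ρ b ν)
      + ∑ f, Cu f a b * ρ f ν = 0) (μ : Fin m) :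
    T (dX μ) = T (F μ) + (ct G fun a => ρ a μ • 1)
      + ct F fun l => ct A fun a => δ l (ρ a μ) • 1 := by
  obtain rfl : dX = _ := funext hX
  obtain rfl : dA = _ := funext hdA
  have hAF : ∀ a l, A a * F l = -(F l * A a) := fun a l => by rw [hFA, neg_neg]
  simp only [map_add, map_ct_odd hTA, hTf]
  simp only [ct_add_left, ct_sub_left, ct_smul_left, ct_add_right,
    ct_ct, ct_smul_one, smul_smul, ← Finset.sum_smul]
  have e1 : (ct A fun a => ct F fun l => δ l (ρ a μ) • (1 : R))
      = -ct F fun l => ct A fun a => δ l (ρ a μ) • 1 := ct_anticomm hAF _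
  have e2 : (ct A fun a => ct A fun b => (∑ l, ρ b l * δ l (ρ a μ)) • (1 : R))
      - (ct A fun a => ct A fun b => (∑ l, ρ a l * δ l (ρ b μ)) • (1 : R))
      + (ct A fun a => ct A fun b => (∑ f, Cu f a b * ρ f μ) • (1 : R)) = 0 := by
    simp only [← ct_sub_right, ← ct_add_right, ← sub_smul, ← add_smul, h2, zero_smul,
      ct_zero_right]
  rw [ct_anticomm hA fun a b => (∑ l, ρ a l * δ l (ρ b μ)) • (1 : R), sub_neg_eq_add,
    ← two_smul ℝ, ← eq_neg_iff_add_eq_zero] at e2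
  have e3 := congrArg ((1 / 2 : ℝ) • ·) e2
  simp only [smul_smul] at e3
  norm_num only [one_smul] at e3
  rw [e1, e3]
  simp only [h1, zero_smul, ct_zero_right]
  module

end Square

/-! ### Tensor identities of a Courant algebroid -/

section Tensors

variable {𝒪 : Type*} [CommRing 𝒪] [Algebra ℝ 𝒪] {m k : ℕ}

/-- Raising of an index with a symmetric matrix. -/
def raise (N : Matrix (Fin k) (Fin k) ℝ) (x : Fin k → 𝒪) (a : Fin k) : 𝒪 := ∑ b, N a b • x b

variable {N : Matrix (Fin k) (Fin k) ℝ}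

theorem raise_add (x y : Fin k → 𝒪) (a : Fin k) :
    raise N (fun b => x b + y b) a = raise N x a + raise N y a := by
  simp only [raise, smul_add, Finset.sum_add_distrib]

theorem raise_sub (x y : Fin k → 𝒪) (a : Fin k) :
    raise N (fun b => x b - y b) a = raise N x a - raise N y a := by
  simp only [raise, smul_sub, Finset.sum_sub_distrib]

theorem raise_zero (a : Fin k) : raise N (fun _ => (0 : 𝒪)) a = 0 := by
  simp only [raise, smul_zero, Finset.sum_const_zero]

theorem raise_sum {ι : Type*} (s : Finset ι) (x : ι → Fin k → 𝒪) (a : Fin k) :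
    raise N (fun b => ∑ i ∈ s, x i b) a = ∑ i ∈ s, raise N (x i) a := by
  simp only [raise, Finset.smul_sum]
  exact Finset.sum_comm

theorem raise_const_mul (c : 𝒪) (x : Fin k → 𝒪) (a : Fin k) :
    raise N (fun b => c * x b) a = c * raise N x a := by
  simp only [raise, Finset.mul_sum, mul_smul_comm]

theorem raise_mul_const (c : 𝒪) (x : Fin k → 𝒪) (a : Fin k) :
    raise N (fun b => x b * c) a = raise N x a * c := by
  simp only [raise, Finset.sum_mul, smul_mul_assoc]

/-- The metric is constant in the chosen frame, so derivatives commute with raising indices. -/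
theorem map_raise (T : 𝒪 →ₗ[ℝ] 𝒪) (x : Fin k → 𝒪) (a : Fin k) :
    T (raise N x a) = raise N (fun b => T (x b)) a := by
  simp only [raise, map_sum, map_smul]

theorem sum_mul_raise (hN : ∀ a b, N a b = N b a) (x y : Fin k → 𝒪) :
    ∑ a, x a * raise N y a = ∑ a, raise N x a * y a := by
  simp only [raise, Finset.mul_sum, Finset.sum_mul]
  rw [Finset.sum_comm]
  refine Finset.sum_congr rfl fun b _ => Finset.sum_congr rfl fun a _ => ?_
  rw [hN a b, mul_smul_comm, smul_mul_assoc]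

variable {δ : Fin m → 𝒪 →ₗ[ℝ] 𝒪} {ρ : Fin k → Fin m → 𝒪} {C : Fin k → Fin k → Fin k → 𝒪}

theorem raised_isotropy
    (h : ∀ μ ν, ∑ a, ∑ b, N a b • (ρ a μ * ρ b ν) = 0) (μ ν : Fin m) :
    ∑ a, ρ a μ * raise N (fun b => ρ b ν) a = 0 := by
  rw [← h μ ν]
  simp only [raise, Finset.mul_sum, mul_smul_comm]

theorem raised_bracket (hN : ∀ a b, N a b = N b a)
    (h : ∀ a b ν, ∑ l, ρ b l * δ l (ρ a ν) - ∑ l, ρ a l * δ l (ρ b ν)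
      + ∑ e, ∑ f, N e f • (ρ e ν * C f a b) = 0) (a b : Fin k) (ν : Fin m) :
    ∑ l, ρ b l * δ l (ρ a ν) - ∑ l, ρ a l * δ l (ρ b ν)
      + ∑ f, raise N (fun e => ρ e ν) f * C f a b = 0 := by
  rw [← h a b ν, ← sum_mul_raise hN]
  simp only [raise, Finset.mul_sum, mul_smul_comm]

theorem raised_jacobi (hC12 : ∀ a b c, C a b c = -C b a c) (hC23 : ∀ a b c, C a b c = -C a c b)
    (h : ∀ a b c d,
    ∑ l, ρ d l * δ l (C a b c) - ∑ l, ρ a l * δ l (C b c d)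
      + ∑ l, ρ b l * δ l (C c d a) - ∑ l, ρ c l * δ l (C d a b)
      + ∑ e, ∑ f, N e f • (C e a b * C c d f)
      + ∑ e, ∑ f, N e f • (C e a c * C d b f)
      + ∑ e, ∑ f, N e f • (C e a d * C b c f) = 0) (a b c d : Fin k) :
    ∑ l, ρ d l * δ l (C a b c) - ∑ l, ρ a l * δ l (C b c d)
      + ∑ l, ρ b l * δ l (C c d a) - ∑ l, ρ c l * δ l (C d a b)
      + ∑ e, C e a b * raise N (fun f => C f c d) e
      + ∑ e, C e a c * raise N (fun f => C f d b) e
      + ∑ e, C e a d * raise N (fun f => C f b c) e = 0 := by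
  have hcyc : ∀ a b c, C c a b = C a b c := fun a b c => by rw [hC12, hC23, neg_neg]
  rw [← h a b c d]
  simp only [raise, Finset.mul_sum, mul_smul_comm, hcyc]

/-- The compatibility of anchor and bracket with its free index `a` raised; antisymmetry of C moves
that index into first position beforehand. -/
theorem square_A_bracket (hN : ∀ a b, N a b = N b a)
    (hC12 : ∀ a b c, C a b c = -C b a c)
    (h : ∀ a b ν, ∑ l, ρ b l * δ l (ρ a ν) - ∑ l, ρ a l * δ l (ρ b ν)
      + ∑ e, ∑ f, N e f • (ρ e ν * C f a b) = 0) (a b : Fin k) (ν : Fin m) :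
    ∑ l, ρ b l * δ l (raise N (fun e => ρ e ν) a) - ∑ l, raise N (fun e => ρ e l) a * δ l (ρ b ν)
      - ∑ e, raise N (fun e => ρ e ν) e * raise N (fun f => C f e b) a = 0 := by
  have key : ∀ a', ∑ l, ρ b l * δ l (ρ a' ν) - ∑ l, ρ a' l * δ l (ρ b ν)
      - ∑ f, raise N (fun e => ρ e ν) f * C a' f b = 0 := fun a' => by
    rw [← raised_bracket hN h a' b ν]
    simp only [hC12 a' _ b, mul_neg, Finset.sum_neg_distrib, sub_neg_eq_add]
  have h1 := congrArg (fun x => raise N x a) (funext key)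
  simp only [raise_sub, raise_sum, raise_const_mul, raise_mul_const, raise_zero] at h1
  simpa only [map_raise] using h1

/-- The Jacobi identity with its first index raised, after cyclic symmetry has placed this index
first in each C that carries it. -/
theorem square_A_jacobi (hC12 : ∀ a b c, C a b c = -C b a c)
    (hC23 : ∀ a b c, C a b c = -C a c b)
    (h : ∀ a b c d,
    ∑ l, ρ d l * δ l (C a b c) - ∑ l, ρ a l * δ l (C b c d)
      + ∑ l, ρ b l * δ l (C c d a) - ∑ l, ρ c l * δ l (C d a b)
      + ∑ e, ∑ f, N e f • (C e a b * C c d f)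
      + ∑ e, ∑ f, N e f • (C e a c * C d b f)
      + ∑ e, ∑ f, N e f • (C e a d * C b c f) = 0) (a b c d : Fin k) :
    ∑ l, ρ d l * δ l (raise N (fun e => C e b c) a) - ∑ l, raise N (fun e => ρ e l) a * δ l (C b c d)
      + ∑ l, ρ b l * δ l (raise N (fun e => C e c d) a)
      - ∑ l, ρ c l * δ l (raise N (fun e => C e b d) a)
      - ∑ e, raise N (fun f => C f c d) e * raise N (fun f => C f e b) a
      - ∑ e, raise N (fun f => C f d b) e * raise N (fun f => C f e c) a
      - ∑ e, raise N (fun f => C f b c) e * raise N (fun f => C f e d) a = 0 := by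
  have hcyc : ∀ a b c, C c a b = C a b c := fun a b c => by rw [hC12, hC23, neg_neg]
  have key : ∀ a', ∑ l, ρ d l * δ l (C a' b c) - ∑ l, ρ a' l * δ l (C b c d)
      + ∑ l, ρ b l * δ l (C a' c d) - ∑ l, ρ c l * δ l (C a' b d)
      - ∑ e, raise N (fun f => C f c d) e * C a' e b
      - ∑ e, raise N (fun f => C f d b) e * C a' e c
      - ∑ e, raise N (fun f => C f b c) e * C a' e d = 0 := fun a' => by
    have t : ∀ (x : Fin k) (y : Fin k → 𝒪), ∑ e, y e * C a' e x = -∑ e, C e a' x * y e :=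
      fun x y => by
        rw [← Finset.sum_neg_distrib]
        exact Finset.sum_congr rfl fun e _ => by rw [hC12 a' e x]; ring
    rw [← raised_jacobi hC12 hC23 h a' b c d, t, t, t, hcyc c d a', ← hcyc a' b d]
    simp only [sub_neg_eq_add]
  have h1 := congrArg (fun x => raise N x a) (funext key)
  simp only [raise_sub, raise_add, raise_sum, raise_const_mul, raise_mul_const, raise_zero] at h1
  simpa only [map_raise] using h1

/-- Differentiating the isotropy condition gives two terms; symmetry of the metric puts both
derivatives on the lowered factor. -/
theorem square_B_isotropy (hN : ∀ a b, N a b = N b a)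
    (hδ : ∀ μ f g, δ μ (f * g) = δ μ f * g + f * δ μ g)
    (h : ∀ μ ν, ∑ a, ∑ b, N a b • (ρ a μ * ρ b ν) = 0) (μ ν l : Fin m) :
    ∑ a, raise N (fun b => ρ b l) a * δ μ (ρ a ν)
      + ∑ a, raise N (fun b => ρ b ν) a * δ μ (ρ a l) = 0 := by
  have h1 := congrArg (δ μ) (raised_isotropy h ν l)
  simp only [map_sum, hδ, map_zero, map_raise, Finset.sum_add_distrib] at h1
  rw [← h1, ← sum_mul_raise hN (fun a => ρ a ν)]
  simp only [mul_comm (δ μ _)]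

/-- The derivative of the compatibility of anchor and bracket; commuting partial derivatives bring
the second-order terms into the form required by `square_B`. -/
theorem square_B_bracket (hN : ∀ a b, N a b = N b a)
    (hδ : ∀ μ f g, δ μ (f * g) = δ μ f * g + f * δ μ g)
    (hδ' : ∀ μ ν f, δ μ (δ ν f) = δ ν (δ μ f))
    (h : ∀ a b ν, ∑ l, ρ b l * δ l (ρ a ν) - ∑ l, ρ a l * δ l (ρ b ν)
      + ∑ e, ∑ f, N e f • (ρ e ν * C f a b) = 0) (μ : Fin m) (a b : Fin k) (ν : Fin m) :
    ∑ l, (δ μ (ρ b l) * δ l (ρ a ν) + ρ b l * δ l (δ μ (ρ a ν)))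
      - ∑ l, (δ μ (ρ a l) * δ l (ρ b ν) + ρ a l * δ l (δ μ (ρ b ν)))
      + ∑ f, raise N (fun e => C e a b) f * δ μ (ρ f ν)
      + ∑ f, raise N (fun e => ρ e ν) f * δ μ (C f a b) = 0 := by
  have h1 := congrArg (δ μ) (raised_bracket hN h a b ν)
  simp only [map_sum, map_sub, map_add, hδ, map_zero, map_raise, hδ' μ] at h1
  rw [← h1, Finset.sum_add_distrib (f := fun f => raise N _ f * C f a b),
    ← sum_mul_raise hN (fun e => δ μ (ρ e ν)), ← add_assoc]
  simp only [mul_comm (δ μ (ρ _ ν))]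

theorem square_B_jacobi (hN : ∀ a b, N a b = N b a)
    (hδ : ∀ μ f g, δ μ (f * g) = δ μ f * g + f * δ μ g)
    (hδ' : ∀ μ ν f, δ μ (δ ν f) = δ ν (δ μ f))
    (hC12 : ∀ a b c, C a b c = -C b a c)
    (hC23 : ∀ a b c, C a b c = -C a c b)
    (h : ∀ a b c d,
    ∑ l, ρ d l * δ l (C a b c) - ∑ l, ρ a l * δ l (C b c d)
      + ∑ l, ρ b l * δ l (C c d a) - ∑ l, ρ c l * δ l (C d a b)
      + ∑ e, ∑ f, N e f • (C e a b * C c d f)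
      + ∑ e, ∑ f, N e f • (C e a c * C d b f)
      + ∑ e, ∑ f, N e f • (C e a d * C b c f) = 0) (μ : Fin m) (a b c d : Fin k) :
    ∑ l, (δ μ (ρ d l) * δ l (C a b c) + ρ d l * δ l (δ μ (C a b c)))
      - ∑ l, (δ μ (ρ a l) * δ l (C b c d) + ρ a l * δ l (δ μ (C b c d)))
      + ∑ l, (δ μ (ρ b l) * δ l (C c d a) + ρ b l * δ l (δ μ (C c d a)))
      - ∑ l, (δ μ (ρ c l) * δ l (C d a b) + ρ c l * δ l (δ μ (C d a b)))
      + ∑ e, (raise N (fun f => C f a b) e * δ μ (C e c d)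
        + raise N (fun f => C f c d) e * δ μ (C e a b))
      + ∑ e, (raise N (fun f => C f a c) e * δ μ (C e d b)
        + raise N (fun f => C f d b) e * δ μ (C e a c))
      + ∑ e, (raise N (fun f => C f a d) e * δ μ (C e b c)
        + raise N (fun f => C f b c) e * δ μ (C e a d)) = 0 := by
  have h1 := congrArg (δ μ) (raised_jacobi hC12 hC23 h a b c d)
  -- The Leibniz rule for the metric pairing of two tensors, with the raised index on the
  -- undifferentiated factor.
  have t : ∀ x y : Fin k → 𝒪, ∑ e, (raise N x e * δ μ (y e) + raise N y e * δ μ (x e))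
      = ∑ e, (δ μ (x e) * raise N y e + x e * raise N (fun b => δ μ (y b)) e) := fun x y => by
    simp only [Finset.sum_add_distrib, ← sum_mul_raise hN (fun a => x a), mul_comm (raise N y _)]
    rw [sum_mul_raise hN, add_comm]
  simp only [map_sum, map_sub, map_add, hδ, map_zero, map_raise, hδ' μ] at h1
  rw [t (fun f => C f a b) (fun f => C f c d), t (fun f => C f a c) (fun f => C f d b),
    t (fun f => C f a d) (fun f => C f b c)]
  exact h1

end Tensors

section Shortcuts
variable {m k : ℕ} {U : TopologicalSpace.Opens (Fin m → ℝ)}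
instance : CommRing (SmoothFn U) := inferInstance
instance : Semiring (SmoothFn U) := inferInstance
instance : Monoid (SmoothFn U) := inferInstance
instance : AddCommGroup (SmoothFn U) := inferInstance
instance : Module ℝ (SmoothFn U) := inferInstance
instance : Semiring (Tot k U) := inferInstance
instance : AddCommMonoid (Tot k U) := inferInstance
instance : AddMonoid (Tot k U) := inferInstance
instance : Semiring (LForm k U) := inferInstance
instance : AddCommMonoid (LForm k U) := inferInstance
instance : AddMonoid (LForm k U) := inferInstance
instance : Add (Tot k U) := inferInstance
instance : Neg (Tot k U) := inferInstance
instance : Sub (Tot k U) := inferInstance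
instance : Add (LForm k U) := inferInstance
instance : Neg (LForm k U) := inferInstance
instance : Sub (LForm k U) := inferInstance
instance : DistribMulAction ℝ (Tot k U) := inferInstance
instance : SMul ℝ (Tot k U) := inferInstance
instance : SMul ℝ (LForm k U) := inferInstance
instance : SMul (SmoothFn U) (Tot k U) := inferInstance
instance : SMul (SmoothFn U) (LForm k U) := inferInstance
instance : DistribMulAction (SmoothFn U) (Tot k U) := inferInstance
instance : IsScalarTower (SmoothFn U) (Tot k U) (Tot k U) := inferInstance
instance : SMulCommClass (SmoothFn U) (Tot k U) (Tot k U) := inferInstance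
end Shortcuts

/-! ### Contraction of alternating tensors -/

section Antisymmetric

variable {𝒪 R : Type*} [CommRing 𝒪] [Ring R] [Algebra 𝒪 R] {k : ℕ}

/-- Contraction of a three index tensor. -/
def tri (t : Fin k → Fin k → Fin k → 𝒪) (u v w : Fin k → R) : R :=
  ct u fun a => ct v fun b => ct w fun c => t a b c • 1

/-- Total antisymmetry. -/
structure IsAlt (t : Fin k → Fin k → Fin k → 𝒪) : Prop where
  swap₁₂ : ∀ a b c, t a b c = -t b a c
  swap₂₃ : ∀ a b c, t a b c = -t a c b

variable {t : Fin k → Fin k → Fin k → 𝒪}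

theorem cube_eq_tri (A : Fin k → R) (t : Fin k → Fin k → Fin k → 𝒪) :
    cube A t = tri t A A A := rfl

/-- The sign of the tensor cancels the sign of the anticommuting variables. The mixed terms in the
expansion of a cube can therefore be merged, which turns ⅙ into ½. -/
theorem IsAlt.tri_swap₁₂ (ht : IsAlt t) {u v : Fin k → R} (h : ∀ i j, u i * v j = -(v j * u i))
    (w : Fin k → R) : tri t u v w = tri t v u w := by
  simp only [tri]
  rw [ct_anticomm h]
  simp only [← ct_neg_right, ← neg_smul, ← ht.swap₁₂]

theorem IsAlt.tri_swap₂₃ (ht : IsAlt t) (u : Fin k → R) {v w : Fin k → R}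
    (h : ∀ i j, v i * w j = -(w j * v i)) : tri t u v w = tri t u w v := by
  simp only [tri, ct_anticomm h]
  simp only [← ct_neg_right, ← neg_smul, ← ht.swap₂₃]

theorem tri_add₁ (u u' v w : Fin k → R) :
    tri t (fun i => u i + u' i) v w = tri t u v w + tri t u' v w := ct_add_left _ _ _

theorem tri_add₂ (u v v' w : Fin k → R) :
    tri t u (fun i => v i + v' i) w = tri t u v w + tri t u v' w := by
  simp only [tri, ct_add_left, ct_add_right]

theorem tri_add₃ (u v w w' : Fin k → R) :
    tri t u v (fun i => w i + w' i) = tri t u v w + tri t u v w' := by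
  simp only [tri, ct_add_left, ct_add_right]

end Antisymmetric

/-! ### Symbols and BRST transformations in the total grading -/

section Symbols

variable {m k : ℕ} {U : TopologicalSpace.Opens (Fin m → ℝ)}

/-- The fields as elements of the totally graded algebra. -/
def fT (φ : Fld m k) : Tot k U := τ (fld φ)

/-- The differentials of the fields in the totally graded algebra. -/
def dfT (φ : Fld m k) : Tot k U := τ (gen (.dfield φ))

/-- The antifields in the totally graded algebra. -/
def aT (φ : Fld m k) : Tot k U := τ (anti φ)

/-- The differentials of the antifields in the totally graded algebra. -/
def daT (φ : Fld m k) : Tot k U := τ (gen (.danti φ))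

theorem τ_gen_mem (g : Gen m k) : τ (gen g : LForm k U) ∈ TWt bideg (bideg g) :=
  τ_mem.2 (gen_mem_bideg g)

theorem fT_mem (φ : Fld m k) : (fT φ : Tot k U) ∈ TWt bideg (φ.species.deg, φ.species.gh) :=
  τ_gen_mem (.field φ)

theorem dfT_mem (φ : Fld m k) :
    (dfT φ : Tot k U) ∈ TWt bideg (φ.species.deg + 1, φ.species.gh) := τ_gen_mem (.dfield φ)

theorem aT_mem (φ : Fld m k) :
    (aT φ : Tot k U) ∈ TWt bideg (3 - φ.species.deg, -1 - φ.species.gh) := τ_gen_mem (.anti φ)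

theorem daT_mem (φ : Fld m k) :
    (daT φ : Tot k U) ∈ TWt bideg (3 - φ.species.deg + 1, -1 - φ.species.gh) := τ_gen_mem (.danti φ)

theorem eps_mem (a : Fin k) : (fT (.eps a) : Tot k U) ∈ TWt bideg (0, 1) := fT_mem (.eps a)

theorem A_mem (a : Fin k) : (fT (.A a) : Tot k U) ∈ TWt bideg (1, 0) := fT_mem (.A a)

theorem B_mem (μ : Fin m) : (fT (.B μ) : Tot k U) ∈ TWt bideg (2, 0) := fT_mem (.B μ)

theorem psi_mem (μ : Fin m) : (fT (.psi μ) : Tot k U) ∈ TWt bideg (1, 1) := fT_mem (.psi μ)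

theorem psit_mem (μ : Fin m) : (fT (.psit μ) : Tot k U) ∈ TWt bideg (0, 2) := fT_mem (.psit μ)

theorem antiA_mem (a : Fin k) : (aT (.A a) : Tot k U) ∈ TWt bideg (2, -1) := aT_mem (.A a)

theorem antiB_mem (μ : Fin m) : (aT (.B μ) : Tot k U) ∈ TWt bideg (1, -1) := aT_mem (.B μ)

theorem antiPsi_mem (μ : Fin m) : (aT (.psi μ) : Tot k U) ∈ TWt bideg (2, -2) := aT_mem (.psi μ)

theorem antiPsit_mem (μ : Fin m) : (aT (.psit μ) : Tot k U) ∈ TWt bideg (3, -3) := aT_mem (.psit μ)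

theorem antiEps_mem (a : Fin k) : (aT (.eps a) : Tot k U) ∈ TWt bideg (3, -2) := aT_mem (.eps a)

theorem antiX_mem (μ : Fin m) : (aT (.X μ) : Tot k U) ∈ TWt bideg (3, -1) := aT_mem (.X μ)

theorem τ_gen_mul (g h : Gen m k) :
    τ (gen g * gen h : LForm k U) = (sgn (g.gh * h.deg) : SmoothFn U) • (τ (gen g) * τ (gen h)) := by
  have h := τ_mul (gen_mem_bideg (U := U) g) (gen_mem_bideg (U := U) h)
  simpa only [bideg] using h

theorem τ_gen_mul_mul (g h i : Gen m k) :
    τ (gen g * gen h * gen i : LForm k U) = (sgn (g.gh * h.deg + (g.gh + h.gh) * i.deg) :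
      SmoothFn U) • (τ (gen g) * τ (gen h) * τ (gen i)) := by
  rw [τ_mul (mul_mem_hasWt (gen_mem_bideg g) (gen_mem_bideg h)) (gen_mem_bideg i), τ_gen_mul,
    smul_mul_assoc, smul_smul, ← sgn_add]
  congr 2
  exact add_comm _ _

theorem ct_smul_one_eq {ι : Type*} [Fintype ι] (u : ι → Tot k U) (s : ι → SmoothFn U) :
    (ct u fun i => s i • 1) = ∑ i, s i • u i := by
  simp only [ct, mul_smul_comm, mul_one]

theorem ct_ct_smul_one_eq {ι κ : Type*} [Fintype ι] [Fintype κ] (u : ι → Tot k U)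
    (v : κ → Tot k U) (s : ι → κ → SmoothFn U) :
    (ct u fun i => ct v fun j => s i j • 1) = ∑ i, ∑ j, s i j • (u i * v j) := by
  simp only [ct, mul_smul_comm, mul_one, Finset.mul_sum]

theorem ct_ct_ct_smul_one_eq {ι κ υ : Type*} [Fintype ι] [Fintype κ] [Fintype υ]
    (u : ι → Tot k U) (v : κ → Tot k U) (w : υ → Tot k U) (s : ι → κ → υ → SmoothFn U) :
    (ct u fun i => ct v fun j => ct w fun l => s i j l • 1)
      = ∑ i, ∑ j, ∑ l, s i j l • (u i * v j * w l) := by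
  simp only [ct, mul_smul_comm, mul_one, Finset.mul_sum, mul_assoc]

theorem dT_fT (φ : Fld m k) : dT (fT φ : Tot k U) = dfT φ := congrArg τ (d_fld φ)

theorem dT_dfT (φ : Fld m k) : dT (dfT φ : Tot k U) = 0 := congrArg τ (d_dfield φ)

theorem dT_aT (φ : Fld m k) : dT (aT φ : Tot k U) = daT φ := congrArg τ (d_anti φ)

theorem smul_one_eq (f : SmoothFn U) : f • (1 : Tot k U) = τ (fn f) := by
  change f • τ 1 = _
  rw [← map_smul, ← mul_fn, one_mul]

end Symbols

namespace LocalCourantAlgebroid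

variable {m k : ℕ} {U : TopologicalSpace.Opens (Fin m → ℝ)} (D : LocalCourantAlgebroid m k U)

local notation "εT" => fun a => fT (Fld.eps a)
local notation "AT" => fun a => fT (Fld.A a)
local notation "BT" => fun a => fT (Fld.B a)
local notation "ψT" => fun a => fT (Fld.psi a)
local notation "ψtT" => fun a => fT (Fld.psit a)

theorem τ_brst_X (μ : Fin m) : τ (D.brst (.X μ)) = ct εT fun a => D.ρ a μ • 1 := by
  rw [ct_smul_one_eq, brst, map_sum]
  simp only [map_smul]; rfl

theorem τ_brst_A (a : Fin k) : τ (D.brst (.A a)) = dfT (.eps a) + (ct ψT fun μ => D.ρup a μ • 1)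
    + ct AT fun b => ct εT fun c => D.Cup a b c • 1 := by
  rw [ct_smul_one_eq, ct_ct_smul_one_eq, brst]
  simp only [map_add, map_sum, map_smul, τ_gen_mul]
  simp only [Gen.gh, Gen.deg, Fld.species, Species.gh, Species.deg, mul_zero, sgn_zero, one_smul]
  rfl

theorem τ_brst_eps (a : Fin k) : τ (D.brst (.eps a)) = -(ct ψtT fun μ => D.ρup a μ • 1)
    - (1 / 2 : ℝ) • ct εT fun b => ct εT fun c => D.Cup a b c • 1 := by
  rw [ct_smul_one_eq, ct_ct_smul_one_eq, brst]
  simp only [map_sub, map_neg, τ_real_smul, map_sum, map_smul, τ_gen_mul]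
  simp only [Gen.gh, Gen.deg, Fld.species, Species.gh, Species.deg, mul_zero, sgn_zero, one_smul]
  rfl

theorem sgn_one : (sgn 1 : SmoothFn U) = -1 := sgn_of_odd odd_one

theorem τ_brst_B (μ : Fin m) : τ (D.brst (.B μ)) = -dfT (.psi μ)
    - (ct BT fun ν => ct εT fun a => pd μ (D.ρ a ν) • 1)
    - (ct ψT fun ν => ct AT fun a => pd μ (D.ρ a ν) • 1)
    - (1 / 2 : ℝ) • ct AT fun a => ct AT fun b => ct εT fun c => pd μ (D.C a b c) • 1 := by
  rw [ct_ct_smul_one_eq, ct_ct_smul_one_eq, ct_ct_ct_smul_one_eq, brst]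
  -- Since gh ψ · deg A = 1, this is the one product in the BRST transformations that changes sign
  -- under ⊙.
  have h1 : ∀ ν a, τ (fld (.psi ν) * fld (.A a) : LForm k U)
      = -(τ (fld (.psi ν)) * τ (fld (.A a))) := fun ν a => by
    rw [τ_gen_mul]
    simp only [Gen.gh, Gen.deg, Fld.species, Species.gh, Species.deg, mul_one, sgn_one]
    exact neg_one_smul (SmoothFn U) _
  simp only [map_sub, map_neg, τ_real_smul, map_sum, map_smul, h1, τ_gen_mul, τ_gen_mul_mul]
  simp only [Gen.gh, Gen.deg, Fld.species, Species.gh, Species.deg, mul_zero, zero_mul, add_zero,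
    sgn_zero, one_smul, sub_neg_eq_add, smul_add, Finset.sum_add_distrib]
  rw [Finset.sum_comm, ← sub_sub]
  congr 2
  rw [Finset.sum_comm]
  rfl

theorem τ_brst_psi (μ : Fin m) : τ (D.brst (.psi μ)) = dfT (.psit μ)
    + (ct ψtT fun ν => ct AT fun a => pd μ (D.ρ a ν) • 1)
    + (ct ψT fun ν => ct εT fun a => pd μ (D.ρ a ν) • 1)
    + (1 / 2 : ℝ) • ct AT fun a => ct εT fun b => ct εT fun c => pd μ (D.C a b c) • 1 := by
  rw [ct_ct_smul_one_eq, ct_ct_smul_one_eq, ct_ct_ct_smul_one_eq, brst]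
  simp only [map_add, τ_real_smul, map_sum, map_smul, τ_gen_mul, τ_gen_mul_mul]
  have h2 : (sgn (2 * 1) : SmoothFn U) = 1 := sgn_of_even (by decide)
  simp only [Gen.gh, Gen.deg, Fld.species, Species.gh, Species.deg, mul_zero, add_zero,
    sgn_zero, one_smul, h2, smul_add, Finset.sum_add_distrib]
  rw [Finset.sum_comm, ← add_assoc]
  congr 2
  rw [Finset.sum_comm]
  rfl

theorem τ_brst_psit (μ : Fin m) : τ (D.brst (.psit μ))
    = -(ct ψtT fun ν => ct εT fun a => pd μ (D.ρ a ν) • 1)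
    - (1 / 6 : ℝ) • cube εT fun a b c => pd μ (D.C a b c) := by
  rw [cube, ct_ct_smul_one_eq, ct_ct_ct_smul_one_eq, brst]
  simp only [map_sub, map_neg, τ_real_smul, map_sum, map_smul, τ_gen_mul, τ_gen_mul_mul]
  simp only [Gen.gh, Gen.deg, Fld.species, Species.gh, Species.deg, mul_zero, add_zero,
    sgn_zero, one_smul]
  rw [Finset.sum_comm]
  rfl

theorem τ_F (μ : Fin m) : τ (D.F μ) = dfT (.X μ) - ct AT fun a => D.ρ a μ • 1 := by
  rw [ct_smul_one_eq, F, map_sub, map_sum]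
  simp only [map_smul]; rfl

theorem τ_G (a : Fin k) : τ (D.G a) = dfT (.A a) + (ct BT fun μ => D.ρup a μ • 1)
    + (1 / 2 : ℝ) • ct AT fun b => ct AT fun c => D.Cup a b c • 1 := by
  rw [ct_smul_one_eq, ct_ct_smul_one_eq, G]
  simp only [map_add, τ_real_smul, map_sum, map_smul, τ_gen_mul]
  simp only [Gen.gh, Gen.deg, Fld.species, Species.gh, Species.deg, zero_mul, sgn_zero, one_smul]
  rfl

/-- The component of form degree three of the curvature of `𝐁`. -/
def H (μ : Fin m) : Tot k U := dfT (.B μ) + (ct BT fun ν => ct AT fun a => pd μ (D.ρ a ν) • 1)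
  + (1 / 6 : ℝ) • cube AT fun a b c => pd μ (D.C a b c)

end LocalCourantAlgebroid

/-! ### Superfields without antifields and their curvatures -/

section Superfields

variable {m k : ℕ} {U : TopologicalSpace.Opens (Fin m → ℝ)}

/-- The superfield `𝐀` without antifields. -/
def sA (a : Fin k) : Tot k U := fT (.eps a) + fT (.A a)

/-- The superfield `𝐁` without antifields. -/
def sB (μ : Fin m) : Tot k U := fT (.psit μ) + fT (.psi μ) + fT (.B μ)

theorem tPar_of_bideg {p : ℤ × ℤ} {x : Tot k U} (hx : x ∈ TWt bideg p) {n : ZMod 2}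
    (h : ((p.1 + p.2 : ℤ) : ZMod 2) = n) : x ∈ TPar n := h ▸ tWt_bideg_le_tPar hx

theorem sA_eq : (sA : Fin k → Tot k U) = fun a => fT (.eps a) + fT (.A a) := rfl

theorem sB_eq : (sB : Fin m → Tot k U) = fun μ => fT (.psit μ) + fT (.psi μ) + fT (.B μ) := rfl

theorem sA_odd (a : Fin k) : (sA a : Tot k U) ∈ TPar 1 :=
  add_mem (tPar_of_bideg (fT_mem _) rfl) (tPar_of_bideg (fT_mem _) rfl)

theorem sB_even (μ : Fin m) : (sB μ : Tot k U) ∈ TPar 0 :=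
  add_mem (add_mem
    (tPar_of_bideg (fT_mem _) (by exact (by decide : ((0 + 2 : ℤ) : ZMod 2) = 0)))
    (tPar_of_bideg (fT_mem _) (by exact (by decide : ((1 + 1 : ℤ) : ZMod 2) = 0))))
    (tPar_of_bideg (fT_mem _) (by exact (by decide : ((2 + 0 : ℤ) : ZMod 2) = 0)))

theorem one_mem_tWt {M : Type*} [AddCommMonoid M] (w : Gen m k → M) : (1 : Tot k U) ∈ TWt w 0 :=
  τ_mem.2 (fn_mem_hasWt w 1)

theorem ct_mem_tWt {M : Type*} [AddCommMonoid M] {w : Gen m k → M} {n n' p : M} {ι : Type*}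
    [Fintype ι] {u Φ : ι → Tot k U} (hu : ∀ i, u i ∈ TWt w n) (hΦ : ∀ i, Φ i ∈ TWt w n')
    (h : n + n' = p) : ct u Φ ∈ TWt w p :=
  h ▸ Submodule.sum_mem _ fun i _ => mul_mem_tWt (hu i) (hΦ i)

end Superfields

namespace LocalCourantAlgebroid

variable {m k : ℕ} {U : TopologicalSpace.Opens (Fin m → ℝ)} (D : LocalCourantAlgebroid m k U)

local notation "εT" => fun a => fT (Fld.eps a)
local notation "AT" => fun a => fT (Fld.A a)
local notation "BT" => fun a => fT (Fld.B a)
local notation "ψT" => fun a => fT (Fld.psi a)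
local notation "ψtT" => fun a => fT (Fld.psit a)

theorem F_mem (μ : Fin m) : τ (D.F μ) ∈ TWt bideg (1, 0) := by
  rw [τ_F]
  exact sub_mem (dfT_mem _) (ct_mem_tWt (n := (1, 0)) A_mem
    (fun a => Submodule.smul_mem _ _ (one_mem_tWt _)) rfl)

theorem G_mem (a : Fin k) : τ (D.G a) ∈ TWt bideg (2, 0) := by
  rw [τ_G]
  refine add_mem (add_mem (dfT_mem _) (ct_mem_tWt (n := (2, 0)) B_mem
    (fun a => Submodule.smul_mem _ _ (one_mem_tWt _)) rfl)) (real_smul_mem_tWt _ ?_)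
  exact ct_mem_tWt (n := (1, 0)) (n' := (1, 0)) A_mem (fun a =>
    ct_mem_tWt (n := (1, 0)) A_mem
      (fun a => Submodule.smul_mem _ _ (one_mem_tWt _)) rfl) rfl

theorem H_mem (μ : Fin m) : D.H μ ∈ TWt bideg (3, 0) := by
  refine add_mem (add_mem (dfT_mem _) ?_) (real_smul_mem_tWt _ ?_)
  · exact ct_mem_tWt (n := (2, 0)) (n' := (1, 0)) B_mem (fun a =>
      ct_mem_tWt (n := (1, 0)) A_mem
        (fun a => Submodule.smul_mem _ _ (one_mem_tWt _)) rfl) rfl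
  · exact ct_mem_tWt (n := (1, 0)) (n' := (2, 0)) A_mem (fun a =>
      ct_mem_tWt (n := (1, 0)) (n' := (1, 0)) A_mem (fun a =>
        ct_mem_tWt (n := (1, 0)) A_mem
          (fun a => Submodule.smul_mem _ _ (one_mem_tWt _)) rfl) rfl) rfl

theorem Δ_fT (φ : Fld m k) : D.Δ (fT φ) = dfT φ
    + (sgn φ.species.deg : SmoothFn U) • τ (D.brst φ) := by
  rw [Δ, LinearMap.add_apply, dT_fT, fT, D.σ_τ (gen_mem_bideg _), s₀_fld]
  rfl

/-- Since d² = 0 and s₀ commutes with d, the two mixed terms of Δ² differ only by (-1)^deg evaluated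
in consecutive degrees, so they cancel; in σ² the two twists agree, leaving s₀². -/
theorem Δ_Δ_fT (φ : Fld m k) : D.Δ (D.Δ (fT φ)) = τ (D.s₀ (D.brst φ)) := by
  have h1 : D.Δ (dfT φ) = (sgn (φ.species.deg + 1) : SmoothFn U) • τ (d (D.brst φ)) := by
    rw [Δ, LinearMap.add_apply, dT_dfT, zero_add, dfT, D.σ_τ (gen_mem_bideg _), s₀_dfield]
    rfl
  have hm : (sgn φ.species.deg : SmoothFn U) • D.brst φ
      ∈ HasWt bideg (bideg (.field φ) + (0, 1)) := Submodule.smul_mem _ _ (D.brst_mem_bideg φ)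
  have h2 : D.Δ ((sgn φ.species.deg : SmoothFn U) • τ (D.brst φ))
      = (sgn φ.species.deg : SmoothFn U) • τ (d (D.brst φ)) + τ (D.s₀ (D.brst φ)) := by
    rw [← map_smul, Δ, LinearMap.add_apply, D.σ_τ hm, dT_τ, sgn_smul, map_smul D.s₀, map_smul d,
      ← sgn_smul, ← sgn_smul, map_smul τ, map_smul τ, smul_smul, ← sgn_add]
    congr 1
    refine (congrArg (· • _) (sgn_of_even ⟨φ.species.deg, ?_⟩)).trans (one_smul _ _)
    simp [bideg, Gen.deg]
  rw [Δ_fT, map_add, h1, h2, ← add_assoc, ← add_smul]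
  have : (sgn (φ.species.deg + 1) : SmoothFn U) + sgn φ.species.deg = 0 := by
    rw [sgn_add, sgn_one]; ring
  rw [this, zero_smul, zero_add]

/-- The chain rule: a function of X sees Δ only through ΔX. -/
theorem Δ_smul_one (f : SmoothFn U) :
    D.Δ (f • 1) = ct (fun μ => D.Δ (fT (.X μ))) fun μ => pd μ f • 1 := by
  rw [ct_smul_one_eq, smul_one_eq, Δ, LinearMap.add_apply, D.σ_τ (fn_mem_hasWt _ _), dT_τ, d_fn,
    s₀_fn]
  simp only [Prod.fst_zero, sgn_zero, one_smul, map_sum, map_smul]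
  rw [← Finset.sum_add_distrib]
  refine Finset.sum_congr rfl fun μ _ => ?_
  rw [← smul_add]
  congr 1
  have := D.Δ_fT (.X μ)
  rw [Δ, LinearMap.add_apply] at this
  rw [LinearMap.add_apply, this]
  simp only [Fld.species, Species.deg, sgn_zero, one_smul]
  rfl

theorem Δ_X (μ : Fin m) : D.Δ (fT (.X μ)) = τ (D.F μ) + ct sA fun a => D.ρ a μ • 1 := by
  rw [Δ_fT, τ_brst_X, τ_F]
  simp only [sA_eq, ct_add_left, Fld.species, Species.deg, sgn_zero, one_smul]
  abel

theorem Cup_antisymm (a b c : Fin k) : D.Cup a b c = -D.Cup a c b := by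
  simp only [Cup, ← Finset.sum_neg_distrib]
  exact Finset.sum_congr rfl fun e _ => by rw [D.C_antisymm₂₃ e b c, smul_neg]

theorem eps_mul_A (a b : Fin k) : (fT (.eps a) * fT (.A b) : Tot k U) = -(fT (.A b) * fT (.eps a)) :=
  odd_mul_comm (tPar_of_bideg (fT_mem _) rfl) (tPar_of_bideg (fT_mem _) rfl)

/-- The dε from Δε cancels the one in the BRST variation of A because the twist by (-1)^deg makes
the latter negative. Beyond the vector field only the curvature G remains. -/
theorem Δ_sA (a : Fin k) : D.Δ (sA a) = τ (D.G a) - (ct sB fun μ => D.ρup a μ • 1)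
    - (1 / 2 : ℝ) • ct sA fun b => ct sA fun c => D.Cup a b c • 1 := by
  have h : (ct εT fun b => ct AT fun c => D.Cup a b c • (1 : Tot k U))
      = ct AT fun b => ct εT fun c => D.Cup a b c • 1 := by
    rw [ct_anticomm eps_mul_A]
    simp only [← ct_neg_right]
    refine congrArg _ (funext fun b => congrArg _ (funext fun c => ?_))
    rw [D.Cup_antisymm a b c]
    exact (neg_smul (D.Cup a c b) (1 : Tot k U)).symm
  have h1 : (sgn 1 : SmoothFn U) • τ (D.brst (.A a)) = -τ (D.brst (.A a)) := by
    rw [sgn_one]; exact neg_one_smul (SmoothFn U) _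
  simp only [sA, map_add, Δ_fT, Fld.species, Species.deg, sgn_zero, one_smul]
  rw [h1, τ_brst_A, τ_brst_eps, τ_G]
  simp only [sA_eq, sB_eq, ct_add_left, ct_add_right, h]
  module

theorem isAlt_C : IsAlt D.C := ⟨D.C_antisymm₁₂, D.C_antisymm₂₃⟩

theorem isAlt_map (T : SmoothFn U →ₗ[ℝ] SmoothFn U) {t : Fin k → Fin k → Fin k → SmoothFn U}
    (ht : IsAlt t) : IsAlt fun a b c => T (t a b c) where
  swap₁₂ a b c := (congrArg T (ht.swap₁₂ a b c)).trans (map_neg T _)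
  swap₂₃ a b c := (congrArg T (ht.swap₂₃ a b c)).trans (map_neg T _)

theorem isAlt_pd_C (μ : Fin m) : IsAlt fun a b c => pd μ (D.C a b c) := isAlt_map _ D.isAlt_C

/-- Here dψ̃ and dψ cancel between neighbouring form degrees, and the mixed terms of the cube of ε +
A are collected by alternation. The pure A and B part of form degree three is compensated by H. -/
theorem Δ_sB (μ : Fin m) : D.Δ (sB μ) = D.H μ
    - (ct sB fun ν => ct sA fun a => pd μ (D.ρ a ν) • 1)
    - (1 / 6 : ℝ) • cube sA fun a b c => pd μ (D.C a b c) := by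
  have hC := D.isAlt_pd_C μ
  have h : ∀ i j, (fT (.eps i) * fT (.A j) : Tot k U) = -(fT (.A j) * fT (.eps i)) := eps_mul_A
  have h1 : (sgn 1 : SmoothFn U) • τ (D.brst (.psi μ)) = -τ (D.brst (.psi μ)) := by
    rw [sgn_one]; exact neg_one_smul (SmoothFn U) _
  have h2 : (sgn 2 : SmoothFn U) • τ (D.brst (.B μ)) = τ (D.brst (.B μ)) := by
    rw [sgn_of_even (by decide), one_smul]
  simp only [sB, map_add, Δ_fT, Fld.species, Species.deg, sgn_zero, one_smul]
  rw [h1, h2, τ_brst_psit, τ_brst_psi, τ_brst_B, H]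
  simp only [cube_eq_tri]
  have f1 : ∀ u v w : Fin k → Tot k U, (ct u fun a => ct v fun b => ct w fun c =>
    pd μ (D.C a b c) • 1) = tri (fun a b c => pd μ (D.C a b c)) u v w := fun _ _ _ => rfl
  simp only [f1, sA_eq, sB_eq, ct_add_left, ct_add_right, tri_add₁, tri_add₂, tri_add₃]
  rw [hC.tri_swap₁₂ h εT, hC.tri_swap₂₃ εT h, hC.tri_swap₁₂ h εT, hC.tri_swap₂₃ AT h,
    hC.tri_swap₁₂ h AT, hC.tri_swap₂₃ AT h]
  module

end LocalCourantAlgebroid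
-- The square of Δ on the superfields
namespace LocalCourantAlgebroid

variable {m k : ℕ} {U : TopologicalSpace.Opens (Fin m → ℝ)} (D : LocalCourantAlgebroid m k U)

theorem η_inv_symm (a b : Fin k) : D.η⁻¹ a b = D.η⁻¹ b a := by
  have h : (D.η⁻¹).transpose = D.η⁻¹ := by rw [Matrix.transpose_nonsing_inv, D.η_symm]
  exact congrFun (congrFun h b) a

theorem ρup_eq (a : Fin k) (μ : Fin m) : D.ρup a μ = raise D.η⁻¹ (fun b => D.ρ b μ) a := rfl

theorem Cup_eq (a b c : Fin k) : D.Cup a b c = raise D.η⁻¹ (fun e => D.C e b c) a := rfl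

theorem F_odd (μ : Fin m) : τ (D.F μ) ∈ TPar 1 := tPar_of_bideg (D.F_mem μ) rfl

theorem G_even (a : Fin k) : τ (D.G a) ∈ TPar 0 :=
  tPar_of_bideg (D.G_mem a) (by exact (by decide : ((2 + 0 : ℤ) : ZMod 2) = 0))

theorem sA_mul_sA (a b : Fin k) : (sA a * sA b : Tot k U) = -(sA b * sA a) :=
  odd_mul_comm (sA_odd a) (sA_odd b)

theorem Δ_sA_mul (a : Fin k) (x : Tot k U) : D.Δ (sA a * x) = D.Δ (sA a) * x - sA a * D.Δ x :=
  D.isOddDer_Δ.odd_mul _ (sA_odd a) x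

theorem Δ_sB_mul (μ : Fin m) (x : Tot k U) : D.Δ (sB μ * x) = D.Δ (sB μ) * x + sB μ * D.Δ x :=
  D.isOddDer_Δ.even_mul _ (sB_even μ) x

theorem Δ_Δ_X (μ : Fin m) : D.Δ (D.Δ (fT (.X μ))) = D.Δ (τ (D.F μ))
    + (ct (fun a => τ (D.G a)) fun a => D.ρ a μ • 1)
    + ct (fun l => τ (D.F l)) fun l => ct sA fun a => pd l (D.ρ a μ) • 1 := by
  refine square_X (T := D.Δ) (F := fun μ => τ (D.F μ)) (G := fun a => τ (D.G a)) (A := sA)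
    (B := sB) (dX := fun μ => D.Δ (fT (.X μ))) (dA := fun a => D.Δ (sA a))
    (δ := fun l f => pd l f) (ρ := D.ρ) (ρu := D.ρup) (Cu := D.Cup)
    sA_mul_sA (fun μ a => odd_mul_comm (D.F_odd μ) (sA_odd a)) D.Δ_sA_mul D.Δ_smul_one D.Δ_X D.Δ_sA
    (fun μ ν => ?_) (fun a b ν => ?_) μ
  · rw [← raised_isotropy D.anchor_isotropic μ ν, sum_mul_raise D.η_inv_symm]
    rfl
  · rw [← raised_bracket D.η_inv_symm D.anchor_bracket a b ν, ← sum_mul_raise D.η_inv_symm]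
    simp only [Cup_eq, mul_comm]

theorem Δ_Δ_sA (a : Fin k) : D.Δ (D.Δ (sA a)) = D.Δ (τ (D.G a))
    - (ct (fun l => τ (D.F l)) fun l => (ct sB fun μ => pd l (D.ρup a μ) • 1)
        + (1 / 2 : ℝ) • ct sA fun b => ct sA fun c => pd l (D.Cup a b c) • 1)
    - (ct D.H fun μ => D.ρup a μ • 1)
    - (ct (fun b => τ (D.G b)) fun b => ct sA fun c => D.Cup a b c • 1) :=
  square_A (T := D.Δ) (F := fun μ => τ (D.F μ)) (G := fun a => τ (D.G a)) (H := D.H) (A := sA)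
    (B := sB) (dX := fun μ => D.Δ (fT (.X μ))) (dA := fun a => D.Δ (sA a))
    (dB := fun μ => D.Δ (sB μ))
    (δ := fun l f => pd l f) (ρ := D.ρ) (ρu := D.ρup) (Cu := D.Cup) (C := D.C)
    sA_mul_sA (fun μ _ => even_mul_comm (sB_even μ) _)
    (fun μ a => odd_mul_comm (D.F_odd μ) (sA_odd a))
    (fun _ ν => (even_mul_comm (sB_even ν) _).symm) (fun a _ => even_mul_comm (D.G_even a) _)
    D.Δ_sA_mul D.Δ_sB_mul D.Δ_smul_one D.Δ_X D.Δ_sA D.Δ_sB D.Cup_antisymm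
    (square_A_bracket D.η_inv_symm D.C_antisymm₁₂ D.anchor_bracket)
    (square_A_jacobi D.C_antisymm₁₂ D.C_antisymm₂₃ D.jacobi) a

theorem Δ_Δ_sB (μ : Fin m) : D.Δ (D.Δ (sB μ)) = D.Δ (D.H μ)
    - (ct (fun l => τ (D.F l)) fun l => (ct sB fun ν => ct sA fun a => pd l (pd μ (D.ρ a ν)) • 1)
        + (1 / 6 : ℝ) • cube sA fun a b c => pd l (pd μ (D.C a b c)))
    - (ct D.H fun ν => ct sA fun a => pd μ (D.ρ a ν) • 1)
    - (ct (fun a => τ (D.G a)) fun a => (ct sB fun ν => pd μ (D.ρ a ν) • 1)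
        + (1 / 2 : ℝ) • ct sA fun b => ct sA fun c => pd μ (D.C a b c) • 1) :=
  square_B (T := D.Δ) (F := fun μ => τ (D.F μ)) (G := fun a => τ (D.G a)) (H := D.H) (A := sA)
    (B := sB) (dX := fun μ => D.Δ (fT (.X μ))) (dA := fun a => D.Δ (sA a))
    (dB := fun μ => D.Δ (sB μ))
    (δ := fun l f => pd l f) (ρ := D.ρ) (ρu := D.ρup) (Cu := D.Cup) (C := D.C)
    sA_mul_sA (fun μ _ => even_mul_comm (sB_even μ) _)
    (fun μ _ => even_mul_comm (sB_even μ) _)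
    (fun μ a => odd_mul_comm (D.F_odd μ) (sA_odd a))
    (fun _ ν => (even_mul_comm (sB_even ν) _).symm) (fun a _ => even_mul_comm (D.G_even a) _)
    (fun a _ => even_mul_comm (D.G_even a) _)
    D.Δ_sA_mul D.Δ_sB_mul D.Δ_smul_one D.Δ_X D.Δ_sA D.Δ_sB
    (fun μ => (D.isAlt_pd_C μ).swap₁₂) (fun μ => (D.isAlt_pd_C μ).swap₂₃)
    (square_B_isotropy D.η_inv_symm pd_mul D.anchor_isotropic)
    (square_B_bracket D.η_inv_symm pd_mul pd_comm D.anchor_bracket)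
    (square_B_jacobi D.η_inv_symm pd_mul pd_comm D.C_antisymm₁₂ D.C_antisymm₂₃ D.jacobi) μ

end LocalCourantAlgebroid

/-! ### Components of fixed form degree -/

section Degree

variable {m k : ℕ} {U : TopologicalSpace.Opens (Fin m → ℝ)}

theorem part_eq_self {p : Mon m k → Prop} {α : LForm k U} (h : ∀ e, coeffs α e ≠ 0 → p e) :
    part p α = α := by
  rw [part, rescale_eq_smul (c := 1) fun e he => if_pos (h e he), one_smul]

theorem part_eq_zero {p : Mon m k → Prop} {α : LForm k U} (h : ∀ e, coeffs α e ≠ 0 → ¬ p e) :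
    part p α = 0 := by
  rw [part, rescale_eq_smul (c := 0) fun e he => if_neg (h e he), zero_smul]

/-- The component of form degree `n`. -/
def gr (n : ℤ) : Tot k U →ₗ[ℝ] Tot k U :=
  (τ.toLinearMap.restrictScalars ℝ) ∘ₗ part (fun e => e.deg = n) ∘ₗ
    (τ.symm.toLinearMap.restrictScalars ℝ)

theorem gr_τ (n : ℤ) (α : LForm k U) : gr n (τ α) = τ (part (fun e => e.deg = n) α) := rfl

theorem mem_degree {p : ℤ × ℤ} {x : Tot k U} (hx : x ∈ TWt bideg p) : x ∈ TWt Gen.deg p.1 :=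
  fun e he => by
    have h := congrArg Prod.fst (hx e he)
    rw [← h]
    simp [wt, bideg, Prod.fst_sum]

theorem wt_degree (e : Mon m k) : wt Gen.deg e.1 = e.deg := by
  simp [wt, Mon.deg]

theorem gr_of_mem {p : ℤ} {x : Tot k U} (hx : x ∈ TWt Gen.deg p) (n : ℤ) :
    gr n x = if p = n then x else 0 := by
  rw [← τ.apply_symm_apply x, gr_τ]
  have h : ∀ e, coeffs (τ.symm x) e ≠ 0 → e.deg = p := fun e he => by
    rw [← wt_degree]; exact τ_symm_mem.2 hx e he
  split_ifs with hp
  · rw [part_eq_self fun e he => (h e he).trans hp]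
  · rw [part_eq_zero fun e he h' => hp ((h e he).symm.trans h'), map_zero]

theorem gr_mul {p : ℤ} {x : Tot k U} (hx : x ∈ TWt Gen.deg p) (y : Tot k U) (n : ℤ) :
    gr n (x * y) = x * gr (n - p) y := by
  induction y using Tot.induction with
  | h0 => rw [mul_zero, map_zero, map_zero, mul_zero]
  | hadd y z hy hz => rw [mul_add, map_add, map_add, mul_add, hy, hz]
  | hmon e f =>
    have he : τ (monOf e.1 f : LForm k U) ∈ TWt Gen.deg e.deg :=
      τ_mem.2 (monOf_mem_hasWt (wt_degree e) f)
    rw [gr_of_mem (mul_mem_tWt hx he), gr_of_mem he]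
    by_cases h : e.deg = n - p
    · rw [if_pos h, if_pos (by omega)]
    · rw [if_neg h, if_neg (by omega), mul_zero]

theorem gr_ct {p : ℤ} {ι : Type*} [Fintype ι] {u : ι → Tot k U} (hu : ∀ i, u i ∈ TWt Gen.deg p)
    (Φ : ι → Tot k U) (n : ℤ) : gr n (ct u Φ) = ct u fun i => gr (n - p) (Φ i) := by
  simp only [ct, map_sum, gr_mul (hu _)]

theorem gr_smul_one (n : ℤ) (f : SmoothFn U) :
    gr n (f • (1 : Tot k U)) = if n = 0 then f • 1 else 0 := by
  rw [gr_of_mem (Submodule.smul_mem _ f (one_mem_tWt Gen.deg))]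
  simp only [eq_comm]

theorem gr_ct_of_bideg {p : ℤ × ℤ} {ι : Type*} [Fintype ι] {u : ι → Tot k U}
    (hu : ∀ i, u i ∈ TWt bideg p) (Φ : ι → Tot k U) (n : ℤ) :
    gr n (ct u Φ) = ct u fun i => gr (n - p.1) (Φ i) := gr_ct (fun i => mem_degree (hu i)) Φ n

theorem gr_ct_eps (Φ : Fin k → Tot k U) (n : ℤ) : gr n (ct (fun a => fT (.eps a)) Φ)
    = ct (fun a => fT (.eps a)) fun i => gr n (Φ i) := by
  rw [gr_ct_of_bideg (p := (0, 1)) eps_mem Φ n]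
  simp only [sub_zero]

theorem gr_ct_A (Φ : Fin k → Tot k U) (n : ℤ) : gr n (ct (fun a => fT (.A a)) Φ)
    = ct (fun a => fT (.A a)) fun i => gr (n - 1) (Φ i) :=
  gr_ct_of_bideg (p := (1, 0)) A_mem Φ n

theorem gr_ct_B (Φ : Fin m → Tot k U) (n : ℤ) : gr n (ct (fun a => fT (.B a)) Φ)
    = ct (fun a => fT (.B a)) fun i => gr (n - 2) (Φ i) :=
  gr_ct_of_bideg (p := (2, 0)) B_mem Φ n

theorem gr_ct_psi (Φ : Fin m → Tot k U) (n : ℤ) : gr n (ct (fun a => fT (.psi a)) Φ)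
    = ct (fun a => fT (.psi a)) fun i => gr (n - 1) (Φ i) :=
  gr_ct_of_bideg (p := (1, 1)) psi_mem Φ n

theorem gr_ct_psit (Φ : Fin m → Tot k U) (n : ℤ) : gr n (ct (fun a => fT (.psit a)) Φ)
    = ct (fun a => fT (.psit a)) fun i => gr n (Φ i) := by
  rw [gr_ct_of_bideg (p := (0, 2)) psit_mem Φ n]
  simp only [sub_zero]

/-- All symbols have nonnegative form degree; this truncates every expansion below. -/
theorem gr_negative {n : ℤ} (hn : n < 0) (x : Tot k U) : gr n x = 0 := by
  induction x using Tot.induction with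
  | h0 => exact map_zero _
  | hadd y z hy hz => rw [map_add, hy, hz, add_zero]
  | hmon e f =>
    rw [gr_of_mem (τ_mem.2 (monOf_mem_hasWt (wt_degree e) f)), if_neg]
    have h : 0 ≤ e.deg := Finset.sum_nonneg fun g _ => mul_nonneg (by positivity) (by
      rcases g with φ | φ | φ | φ <;> cases φ <;>
        simp only [Gen.deg, Fld.species, Species.deg] <;> decide)
    omega

end Degree

/-! ### The square of the BRST operator -/

namespace LocalCourantAlgebroid

variable {m k : ℕ} {U : TopologicalSpace.Opens (Fin m → ℝ)} (D : LocalCourantAlgebroid m k U)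

theorem gr_ct_F (Φ : Fin m → Tot k U) (n : ℤ) : gr n (ct (fun l => τ (D.F l)) Φ)
    = ct (fun l => τ (D.F l)) fun i => gr (n - 1) (Φ i) :=
  gr_ct (fun i => mem_degree (D.F_mem i)) _ _

theorem gr_ct_G (Φ : Fin k → Tot k U) (n : ℤ) : gr n (ct (fun l => τ (D.G l)) Φ)
    = ct (fun l => τ (D.G l)) fun i => gr (n - 2) (Φ i) :=
  gr_ct (fun i => mem_degree (D.G_mem i)) _ _

theorem gr_ct_H (Φ : Fin m → Tot k U) (n : ℤ) : gr n (ct D.H Φ)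
    = ct D.H fun i => gr (n - 3) (Φ i) :=
  gr_ct (fun i => mem_degree (D.H_mem i)) _ _

theorem σ_mem {p : ℤ × ℤ} {x : Tot k U} (hx : x ∈ TWt bideg p) :
    D.σ x ∈ TWt bideg (p + (0, 1)) := by
  rw [← τ.apply_symm_apply x, D.σ_τ (τ_symm_mem.2 hx)]
  exact Submodule.smul_mem _ _ (τ_mem.2 (D.s₀_mem_bideg (τ_symm_mem.2 hx)))

/-- Δ never lowers the form degree, so ΔF, ΔG and ΔH are invisible in the low degrees from which s₀²
is read off. -/
theorem gr_Δ {p : ℤ × ℤ} {x : Tot k U} (hx : x ∈ TWt bideg p) {n : ℤ} (hn : n < p.1) :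
    gr n (D.Δ x) = 0 := by
  rw [Δ, LinearMap.add_apply, map_add, gr_of_mem (mem_degree (dT_mem hx)),
    gr_of_mem (mem_degree (D.σ_mem hx)), if_neg, if_neg, add_zero]
  · simp only [Prod.fst_add]; omega
  · simp only [Prod.fst_add]; omega

theorem gr_s₀_s₀ (φ : Fld m k) (n : ℤ) :
    gr n (τ (D.s₀ (D.brst φ))) = if φ.species.deg = n then τ (D.s₀ (D.brst φ)) else 0 := by
  rw [gr_of_mem (mem_degree (τ_mem.2 (D.s₀_mem_bideg (D.brst_mem_bideg φ))))]
  simp [bideg, Gen.deg]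

/-- Every curvature has positive form degree, so nothing survives in degree zero. The same argument
applies to ε and ψ̃. -/
theorem s₀_s₀_X (μ : Fin m) : τ (D.s₀ (D.brst (.X μ))) = 0 := by
  have h := congrArg (gr 0) (D.Δ_Δ_X μ)
  rw [Δ_Δ_fT, gr_s₀_s₀, map_add, map_add, D.gr_Δ (D.F_mem μ) (by decide), gr_ct_F, gr_ct_G] at h
  simpa [gr_negative, ct_zero_right, Fld.species, Species.deg] using h

theorem gr_s₀_s₀_sA (a : Fin k) (n : ℤ) : gr n (D.Δ (D.Δ (sA a)))
    = (if 0 = n then τ (D.s₀ (D.brst (.eps a))) else 0)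
      + (if 1 = n then τ (D.s₀ (D.brst (.A a))) else 0) := by
  rw [sA, map_add, map_add, Δ_Δ_fT, Δ_Δ_fT, map_add, gr_s₀_s₀, gr_s₀_s₀]; rfl

theorem gr_s₀_s₀_sB (a : Fin m) (n : ℤ) : gr n (D.Δ (D.Δ (sB a)))
    = (if 0 = n then τ (D.s₀ (D.brst (.psit a))) else 0)
      + (if 1 = n then τ (D.s₀ (D.brst (.psi a))) else 0)
      + (if 2 = n then τ (D.s₀ (D.brst (.B a))) else 0) := by
  simp only [sB, map_add, Δ_Δ_fT, gr_s₀_s₀]; rfl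

local notation "εT" => fun a => fT (Fld.eps a)
local notation "AT" => fun a => fT (Fld.A a)
local notation "BT" => fun a => fT (Fld.B a)
local notation "ψT" => fun a => fT (Fld.psi a)
local notation "ψtT" => fun a => fT (Fld.psit a)
local notation "FT" => fun l => τ (LocalCourantAlgebroid.F D l)
local notation "GT" => fun l => τ (LocalCourantAlgebroid.G D l)

theorem s₀_s₀_eps (a : Fin k) : τ (D.s₀ (D.brst (.eps a))) = 0 := by
  have h := congrArg (gr 0) (D.Δ_Δ_sA a)
  rw [gr_s₀_s₀_sA, map_sub, map_sub, map_sub, D.gr_Δ (D.G_mem a) (by decide), gr_ct_F, gr_ct_G,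
    gr_ct_H] at h
  simpa [gr_negative, ct_zero_right] using h

theorem s₀_s₀_psit (μ : Fin m) : τ (D.s₀ (D.brst (.psit μ))) = 0 := by
  have h := congrArg (gr 0) (D.Δ_Δ_sB μ)
  rw [gr_s₀_s₀_sB, map_sub, map_sub, map_sub, D.gr_Δ (D.H_mem μ) (by decide), gr_ct_F, gr_ct_G,
    gr_ct_H] at h
  simpa [gr_negative, ct_zero_right] using h

/-- In degree one only the terms with F and a cofactor of degree zero remain, since G, H and ΔG
start in higher degree. -/
theorem s₀_s₀_A (a : Fin k) : τ (D.s₀ (D.brst (.A a))) = -ct FT fun l =>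
    (ct ψtT fun μ => pd l (D.ρup a μ) • 1)
      + (1 / 2 : ℝ) • ct εT fun b => ct εT fun c => pd l (D.Cup a b c) • 1 := by
  have h := congrArg (gr 1) (D.Δ_Δ_sA a)
  rw [gr_s₀_s₀_sA, map_sub, map_sub, map_sub, D.gr_Δ (D.G_mem a) (by decide), gr_ct_F, gr_ct_G,
    gr_ct_H] at h
  simpa only [gr_negative, ct_zero_right, sA_eq, sB_eq, ct_add_left, map_add, map_smul, ct_add_right,
    gr_ct_eps, gr_ct_A, gr_ct_B, gr_ct_psi, gr_ct_psit, gr_smul_one, Int.reduceSub, Int.reduceNeg,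
    Int.reduceEq, Int.reduceLT, if_true, if_false, one_ne_zero, zero_ne_one, add_zero, zero_add,
    sub_zero, zero_sub, sub_self, Int.neg_eq_zero] using h

theorem s₀_s₀_psi (μ : Fin m) : τ (D.s₀ (D.brst (.psi μ))) = -ct FT fun l =>
    (ct ψtT fun ν => ct εT fun a => pd l (pd μ (D.ρ a ν)) • 1)
      + (1 / 6 : ℝ) • cube εT fun a b c => pd l (pd μ (D.C a b c)) := by
  have h := congrArg (gr 1) (D.Δ_Δ_sB μ)
  rw [gr_s₀_s₀_sB, map_sub, map_sub, map_sub, D.gr_Δ (D.H_mem μ) (by decide), gr_ct_F, gr_ct_G,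
    gr_ct_H] at h
  simpa only [gr_negative, ct_zero_right, sA_eq, sB_eq, cube, ct_add_left, map_add, map_smul,
    ct_add_right,
    gr_ct_eps, gr_ct_A, gr_ct_B, gr_ct_psi, gr_ct_psit, gr_smul_one, Int.reduceSub, Int.reduceNeg,
    Int.reduceEq, Int.reduceLT, if_true, if_false, one_ne_zero, zero_ne_one, add_zero, zero_add,
    sub_zero, zero_sub, sub_self, Int.neg_eq_zero,
    smul_zero] using h

/-- In degree two, F occurs with cofactors of degree one and G with cofactors of degree zero; H and
ΔH start in degree three. -/
theorem s₀_s₀_B (μ : Fin m) : τ (D.s₀ (D.brst (.B μ))) = -(ct FT fun l =>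
    (ct ψT fun ν => ct εT fun a => pd l (pd μ (D.ρ a ν)) • 1)
      + (ct ψtT fun ν => ct AT fun a => pd l (pd μ (D.ρ a ν)) • 1)
      + (1 / 2 : ℝ) • tri (fun a b c => pd l (pd μ (D.C a b c))) AT εT εT)
    - ct GT fun a => (ct ψtT fun ν => pd μ (D.ρ a ν) • 1)
      + (1 / 2 : ℝ) • ct εT fun b => ct εT fun c => pd μ (D.C a b c) • 1 := by
  have h := congrArg (gr 2) (D.Δ_Δ_sB μ)
  rw [gr_s₀_s₀_sB, map_sub, map_sub, map_sub, D.gr_Δ (D.H_mem μ) (by decide), gr_ct_F, gr_ct_G,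
    gr_ct_H] at h
  have hC := fun l => isAlt_map (pd l) (D.isAlt_pd_C μ)
  have he : ∀ i j, (fT (.eps i) * fT (.A j) : Tot k U) = -(fT (.A j) * fT (.eps i)) := eps_mul_A
  simp only [gr_negative, ct_zero_right, sA_eq, sB_eq, cube, ct_add_left, map_add, map_smul,
    ct_add_right,
    gr_ct_eps, gr_ct_A, gr_ct_B, gr_ct_psi, gr_ct_psit, gr_smul_one, Int.reduceSub, Int.reduceNeg,
    Int.reduceEq, Int.reduceLT, if_true, if_false, one_ne_zero, add_zero, zero_add,
    sub_zero, zero_sub, sub_self] at h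
  rw [h]
  have f1 : ∀ (l : Fin m) (u v w : Fin k → Tot k U), (ct u fun a => ct v fun b => ct w fun c =>
    pd l (pd μ (D.C a b c)) • 1) = tri (fun a b c => pd l (pd μ (D.C a b c))) u v w :=
    fun _ _ _ _ => rfl
  simp only [f1, (hC _).tri_swap₁₂ he, (hC _).tri_swap₂₃ εT he]
  congr 2
  · rw [← ct_add_right, ← ct_add_right]
    congr 1
    funext l
    module
  · rw [← ct_add_right]

end LocalCourantAlgebroid

/-! ### Forms without differentials of fields -/

section Weights

variable {m k : ℕ} {U : TopologicalSpace.Opens (Fin m → ℝ)}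

/-- The number of differentials of fields. -/
def dfieldWt : Gen m k → ℕ
  | .dfield _ => 1
  | _ => 0

theorem lder_dfield_eq_zero (φ : Fld m k) {α : LForm k U} (hα : α ∈ HasWt dfieldWt 0) :
    lder (.dfield φ) α = 0 := lder_eq_zero (by simp) (by simp [dfieldWt]) hα

theorem τ_gen_mem_wt {M : Type*} [AddCommMonoid M] {w : Gen m k → M}
    (hw : ∀ μ, w (.field (.X μ)) = 0) {g : Gen m k} {n : M} (hg : w g = n) :
    τ (gen g : LForm k U) ∈ TWt w n := τ_mem.2 (hg ▸ gen_mem_hasWt w hw g)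

theorem ct_smul_one_mem {M : Type*} [AddCommMonoid M] {w : Gen m k → M} {n : M} {ι : Type*}
    [Fintype ι] {u : ι → Tot k U} (hu : ∀ i, u i ∈ TWt w n) (s : ι → SmoothFn U) :
    (ct u fun i => s i • 1) ∈ TWt w n :=
  ct_mem_tWt hu (fun _ => Submodule.smul_mem _ _ (one_mem_tWt w)) (add_zero n)

theorem ct_ct_smul_one_mem {M : Type*} [AddCommMonoid M] {w : Gen m k → M} {n n' p : M}
    {ι κ : Type*} [Fintype ι] [Fintype κ] {u : ι → Tot k U} {v : κ → Tot k U}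
    (hu : ∀ i, u i ∈ TWt w n) (hv : ∀ i, v i ∈ TWt w n') (s : ι → κ → SmoothFn U)
    (h : n + n' = p) : (ct u fun i => ct v fun j => s i j • 1) ∈ TWt w p :=
  ct_mem_tWt hu (fun _ => ct_smul_one_mem hv _) h

theorem tri_mem {M : Type*} [AddCommMonoid M] {w : Gen m k → M} {n n' n'' p : M}
    {u v x : Fin k → Tot k U} (hu : ∀ i, u i ∈ TWt w n) (hv : ∀ i, v i ∈ TWt w n')
    (hx : ∀ i, x i ∈ TWt w n'') (t : Fin k → Fin k → Fin k → SmoothFn U)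
    (h : n + (n' + n'') = p) : tri t u v x ∈ TWt w p :=
  ct_mem_tWt hu (fun _ => ct_ct_smul_one_mem hv hx _ rfl) h

end Weights

/-! ### Ghost polynomials occurring in the square of s₀ -/

section Polynomials

variable {m k : ℕ} {U : TopologicalSpace.Opens (Fin m → ℝ)}

local notation "εT" => fun a => fT (Fld.eps a)
local notation "AT" => fun a => fT (Fld.A a)
local notation "ψT" => fun a => fT (Fld.psi a)
local notation "ψtT" => fun a => fT (Fld.psit a)

/-- `r^μ ψ̃_μ + ½ c_{bc} ε^b ε^c` -/
def quadGhost (r : Fin m → SmoothFn U) (c : Fin k → Fin k → SmoothFn U) : Tot k U :=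
  (ct ψtT fun μ => r μ • 1) + (1 / 2 : ℝ) • ct εT fun b => ct εT fun e => c b e • 1

/-- `r_a^μ ψ̃_μ ε^a + ⅙ c_{abc} ε^a ε^b ε^c` -/
def cubicGhost (r : Fin k → Fin m → SmoothFn U) (c : Fin k → Fin k → Fin k → SmoothFn U) :
    Tot k U :=
  (ct ψtT fun μ => ct εT fun a => r a μ • 1) + (1 / 6 : ℝ) • tri c εT εT εT

/-- The component of form degree one of `r_a^μ 𝐁_μ 𝐀^a + ⅙ c_{abc} 𝐀^a 𝐀^b 𝐀^c`. -/
def cubicGhost₁ (r : Fin k → Fin m → SmoothFn U) (c : Fin k → Fin k → Fin k → SmoothFn U) :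
    Tot k U :=
  (ct ψT fun μ => ct εT fun a => r a μ • 1) + (ct ψtT fun μ => ct AT fun a => r a μ • 1)
    + (1 / 2 : ℝ) • tri c AT εT εT

variable {M : Type*} [AddCommMonoid M] {w : Gen m k → M} {n : M}

/-- The weight is kept general because bidegree, number of differentials and antifield content of
the same polynomial are all needed; likewise for the two cubic polynomials. -/
theorem quadGhost_mem (hw : ∀ μ, w (.field (.X μ)) = 0) {p : M}
    (h₁ : ∀ μ, w (.field (.psit μ)) = n) (h₂ : ∀ a, w (.field (.eps a)) = p) (h : p + p = n)
    (r : Fin m → SmoothFn U) (c : Fin k → Fin k → SmoothFn U) : quadGhost r c ∈ TWt w n :=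
  add_mem (ct_smul_one_mem (fun μ => τ_gen_mem_wt hw (h₁ μ)) _)
    (real_smul_mem_tWt _ (ct_ct_smul_one_mem (fun a => τ_gen_mem_wt hw (h₂ a))
      (fun a => τ_gen_mem_wt hw (h₂ a)) _ h))

theorem cubicGhost_mem (hw : ∀ μ, w (.field (.X μ)) = 0) {p q : M}
    (h₁ : ∀ μ, w (.field (.psit μ)) = q) (h₂ : ∀ a, w (.field (.eps a)) = p) (h : p + (p + p) = n)
    (h' : q + p = n) (r : Fin k → Fin m → SmoothFn U)
    (c : Fin k → Fin k → Fin k → SmoothFn U) : cubicGhost r c ∈ TWt w n :=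
  add_mem (ct_ct_smul_one_mem (fun μ => τ_gen_mem_wt hw (h₁ μ))
      (fun a => τ_gen_mem_wt hw (h₂ a)) _ h')
    (real_smul_mem_tWt _ (tri_mem (fun a => τ_gen_mem_wt hw (h₂ a))
      (fun a => τ_gen_mem_wt hw (h₂ a)) (fun a => τ_gen_mem_wt hw (h₂ a)) _ h))

theorem cubicGhost₁_mem (hw : ∀ μ, w (.field (.X μ)) = 0) {p q p' q' : M}
    (h₁ : ∀ μ, w (.field (.psit μ)) = q) (h₂ : ∀ a, w (.field (.eps a)) = p)
    (h₃ : ∀ μ, w (.field (.psi μ)) = q') (h₄ : ∀ a, w (.field (.A a)) = p')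
    (h : p' + (p + p) = n)
    (h' : q + p' = n) (h'' : q' + p = n) (r : Fin k → Fin m → SmoothFn U)
    (c : Fin k → Fin k → Fin k → SmoothFn U) : cubicGhost₁ r c ∈ TWt w n :=
  add_mem (add_mem (ct_ct_smul_one_mem (fun μ => τ_gen_mem_wt hw (h₃ μ))
      (fun a => τ_gen_mem_wt hw (h₂ a)) _ h'')
    (ct_ct_smul_one_mem (fun μ => τ_gen_mem_wt hw (h₁ μ))
      (fun a => τ_gen_mem_wt hw (h₄ a)) _ h'))
    (real_smul_mem_tWt _ (tri_mem (fun a => τ_gen_mem_wt hw (h₄ a))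
      (fun a => τ_gen_mem_wt hw (h₂ a)) (fun a => τ_gen_mem_wt hw (h₂ a)) _ h))

theorem quadGhost_bideg (r : Fin m → SmoothFn U) (c : Fin k → Fin k → SmoothFn U) :
    quadGhost r c ∈ TWt bideg (0, 2) :=
  quadGhost_mem bideg_X (p := (0, 1)) (fun _ => rfl) (fun _ => rfl) rfl r c

theorem cubicGhost_bideg (r : Fin k → Fin m → SmoothFn U)
    (c : Fin k → Fin k → Fin k → SmoothFn U) : cubicGhost r c ∈ TWt bideg (0, 3) :=
  cubicGhost_mem bideg_X (p := (0, 1)) (q := (0, 2)) (fun _ => rfl) (fun _ => rfl) rfl rfl r c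

theorem cubicGhost₁_bideg (r : Fin k → Fin m → SmoothFn U)
    (c : Fin k → Fin k → Fin k → SmoothFn U) : cubicGhost₁ r c ∈ TWt bideg (1, 2) :=
  cubicGhost₁_mem bideg_X (p := (0, 1)) (q := (0, 2)) (p' := (1, 0)) (q' := (1, 1))
    (fun _ => rfl) (fun _ => rfl) (fun _ => rfl) (fun _ => rfl) rfl rfl rfl r c

theorem quadGhost_dfield (r : Fin m → SmoothFn U) (c : Fin k → Fin k → SmoothFn U) :
    quadGhost r c ∈ TWt dfieldWt 0 :=
  quadGhost_mem (fun _ => rfl) (p := 0) (fun _ => rfl) (fun _ => rfl) rfl r c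

theorem cubicGhost_dfield (r : Fin k → Fin m → SmoothFn U)
    (c : Fin k → Fin k → Fin k → SmoothFn U) : cubicGhost r c ∈ TWt dfieldWt 0 :=
  cubicGhost_mem (fun _ => rfl) (p := 0) (q := 0) (fun _ => rfl) (fun _ => rfl) rfl rfl r c

theorem cubicGhost₁_dfield (r : Fin k → Fin m → SmoothFn U)
    (c : Fin k → Fin k → Fin k → SmoothFn U) : cubicGhost₁ r c ∈ TWt dfieldWt 0 :=
  cubicGhost₁_mem (fun _ => rfl) (p := 0) (q := 0) (p' := 0) (q' := 0)
    (fun _ => rfl) (fun _ => rfl) (fun _ => rfl) (fun _ => rfl) rfl rfl rfl r c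

end Polynomials

/-! ### The operation 𝔣 and the second-order expressions -/

namespace LocalCourantAlgebroid

variable {m k : ℕ} {U : TopologicalSpace.Opens (Fin m → ℝ)} (D : LocalCourantAlgebroid m k U)

/-- `η^{ab} A†_b` in the totally graded algebra. -/
def aup (a : Fin k) : Tot k U := ∑ b, D.η⁻¹ a b • aT (.A b)

local notation "FT" => fun l => τ (LocalCourantAlgebroid.F D l)
local notation "GT" => fun l => τ (LocalCourantAlgebroid.G D l)
local notation "B†" => fun l => aT (Fld.B l)

theorem replaceEOM_of_mem {α : LForm k U} (hα : α ∈ HasWt dfieldWt 0) : D.replaceEOM α = α := by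
  simp [replaceEOM, lder_dfield_eq_zero _ hα]

theorem lder_dX_F (μ ν : Fin m) : lder (.dfield (.X μ)) (D.F ν) = if ν = μ then 1 else 0 := by
  have h : ∑ a, D.ρ a ν • fld (.A a) ∈ HasWt (dfieldWt : Gen m k → ℕ) 0 :=
    Submodule.sum_mem _ fun a _ => Submodule.smul_mem _ _ (gen_mem_hasWt _ (fun _ => rfl) _)
  rw [F, map_sub, lder_dfield_eq_zero _ h, sub_zero]
  split_ifs with e
  · rw [e, lder_gen_self (by simp)]
  · rw [lder_gen_of_ne (by simpa using e)]

theorem lder_dA_F (b : Fin k) (ν : Fin m) : lder (.dfield (.A b)) (D.F ν) = 0 := by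
  have h : ∑ a, D.ρ a ν • fld (.A a) ∈ HasWt (dfieldWt : Gen m k → ℕ) 0 :=
    Submodule.sum_mem _ fun a _ => Submodule.smul_mem _ _ (gen_mem_hasWt _ (fun _ => rfl) _)
  rw [F, map_sub, lder_dfield_eq_zero _ h, sub_zero, lder_gen_of_ne (by simp)]

theorem G_sub_mem (a : Fin k) : D.G a - gen (.dfield (.A a)) ∈ HasWt (dfieldWt : Gen m k → ℕ) 0 := by
  rw [G, add_assoc, add_sub_cancel_left]
  refine add_mem (Submodule.sum_mem _ fun a _ => Submodule.smul_mem _ _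
    (gen_mem_hasWt _ (fun _ => rfl) _)) (real_smul_mem _ ?_)
  exact Submodule.sum_mem _ fun a _ => Submodule.sum_mem _ fun b _ => Submodule.smul_mem _ _
    (mul_mem_hasWt (n := 0) (n' := 0) (gen_mem_hasWt _ (fun _ => rfl) _)
      (gen_mem_hasWt _ (fun _ => rfl) _))

theorem lder_dfield_G (φ : Fld m k) (a : Fin k) :
    lder (.dfield φ) (D.G a) = lder (.dfield φ) (gen (.dfield (.A a))) := by
  rw [← sub_eq_zero, ← map_sub, lder_dfield_eq_zero _ (D.G_sub_mem a)]

theorem lder_dX_G (μ : Fin m) (a : Fin k) : lder (.dfield (.X μ)) (D.G a) = 0 := by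
  rw [lder_dfield_G, lder_gen_of_ne (by simp)]

theorem lder_dA_G (a b : Fin k) : lder (.dfield (.A b)) (D.G a) = if a = b then 1 else 0 := by
  rw [lder_dfield_G]
  split_ifs with e
  · rw [e, lder_gen_self (by simp)]
  · rw [lder_gen_of_ne (by simpa using e)]

theorem lder_F_mul (φ : Fld m k) (l : Fin m) {P : LForm k U} (hP : P ∈ HasWt dfieldWt 0) :
    lder (.dfield φ) (D.F l * P) = lder (.dfield φ) (D.F l) * P := by
  rw [lder_mul _ (τ_mem.1 (D.F_mem l)), lder_dfield_eq_zero _ hP, mul_zero, smul_zero, add_zero]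

theorem lder_G_mul (φ : Fld m k) (l : Fin k) {P : LForm k U} (hP : P ∈ HasWt dfieldWt 0) :
    lder (.dfield φ) (D.G l * P) = lder (.dfield φ) (D.G l) * P := by
  rw [lder_mul _ (τ_mem.1 (D.G_mem l)), lder_dfield_eq_zero _ hP, mul_zero, smul_zero, add_zero]

/-- If the cofactors contain no differentials, ∂/∂(dX) and ∂/∂(dA) extract precisely the cofactors
of F and G, so the definition removes each field equation and inserts its antifield. -/
theorem replaceEOM_eq {P : Fin m → LForm k U} {R : Fin k → LForm k U}
    (hP : ∀ l, P l ∈ HasWt dfieldWt 0) (hR : ∀ a, R a ∈ HasWt dfieldWt 0) :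
    D.replaceEOM (∑ l, D.F l * P l + ∑ a, D.G a * R a) = ∑ l, anti (.B l) * P l
      - ∑ a, (∑ b, D.η⁻¹ a b • anti (.A b)) * R a := by
  simp only [replaceEOM, map_add, map_sum, D.lder_F_mul _ _ (hP _), D.lder_G_mul _ _ (hR _),
    lder_dX_F, lder_dA_F, lder_dX_G, lder_dA_G, ite_mul, one_mul, zero_mul,
    Finset.sum_ite_eq', Finset.sum_const_zero, Finset.mem_univ, if_true, add_zero, zero_add, sub_mul,
    neg_mul, Finset.sum_sub_distrib, Finset.sum_neg_distrib]
  abel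

/-- F and G have ghost number zero, whereas the antifields replacing them have ghost number -1. In ⊙
this costs the sign (-1)^deg of the cofactor. -/
theorem τ_replaceEOM {α : LForm k U} {P : Fin m → Tot k U} {R : Fin k → Tot k U} {p q : ℤ × ℤ}
    (hα : τ α = ct FT P + ct GT R) (hP : ∀ l, P l ∈ TWt dfieldWt 0)
    (hR : ∀ a, R a ∈ TWt dfieldWt 0) (hp : ∀ l, P l ∈ TWt bideg p) (hq : ∀ a, R a ∈ TWt bideg q) :
    τ (D.replaceEOM α) = (sgn p.1 : SmoothFn U) • ct B† P - (sgn q.1 : SmoothFn U) • ct D.aup R := by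
  have h0 : ∀ x : ℤ, (sgn (0 * x) : SmoothFn U) = 1 := fun x => by rw [zero_mul, sgn_zero]
  have e : α = ∑ l, D.F l * τ.symm (P l) + ∑ a, D.G a * τ.symm (R a) := by
    apply τ.injective
    rw [hα, map_add, map_sum, map_sum]
    simp only [τ_mul (τ_mem.1 (D.F_mem _)) (τ_symm_mem.2 (hp _)),
      τ_mul (τ_mem.1 (D.G_mem _)) (τ_symm_mem.2 (hq _)), h0, one_smul, LinearEquiv.apply_symm_apply]
    rfl
  rw [e, D.replaceEOM_eq (fun l => τ_symm_mem.2 (hP l)) fun a => τ_symm_mem.2 (hR a), map_sub,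
    map_sum, map_sum]
  have h1 : ∀ x : ℤ, (sgn (-1 * x) : SmoothFn U) = sgn x := fun x => sgn_congr ⟨-x, by ring⟩
  have hm : ∀ a, ∑ b, D.η⁻¹ a b • anti (.A b) ∈ HasWt (U := U) (bideg : Gen m k → ℤ × ℤ) (2, -1) :=
    fun a => Submodule.sum_mem _ fun b _ => real_smul_mem _ (gen_mem_bideg (.anti (.A b)))
  have hB : ∀ l, anti (.B l) ∈ HasWt (U := U) (bideg : Gen m k → ℤ × ℤ) (1, -1) :=
    fun l => gen_mem_bideg (.anti (.B l))
  simp only [τ_mul (hB _) (τ_symm_mem.2 (hp _)), τ_mul (hm _) (τ_symm_mem.2 (hq _)), h1,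
    LinearEquiv.apply_symm_apply, ← Finset.smul_sum, map_sum, τ_real_smul]
  rfl

/-- The operation `𝔣` on products with the field equation `F` only. -/
theorem τ_replaceEOM_F {α : LForm k U} {P : Fin m → Tot k U} {p : ℤ × ℤ}
    (hα : τ α = ct FT P) (hP : ∀ l, P l ∈ TWt dfieldWt 0) (hp : ∀ l, P l ∈ TWt bideg p) :
    τ (D.replaceEOM α) = (sgn p.1 : SmoothFn U) • ct B† P := by
  rw [D.τ_replaceEOM (P := P) (R := fun _ => 0) (p := p) (q := 0) (by rw [hα, ct_zero_right, add_zero])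
    hP (fun _ => zero_mem _) hp (fun _ => zero_mem _), ct_zero_right, smul_zero, sub_zero]

theorem τ_O₂_A (a : Fin k) : τ (D.O₂ (.A a)) = -ct B† fun l =>
    quadGhost (fun μ => pd l (D.ρup a μ)) fun b c => pd l (D.Cup a b c) := by
  rw [O₂, O₁, s₀_fld, D.τ_replaceEOM_F ((D.s₀_s₀_A a).trans (ct_neg_right _ _).symm)
    (fun l => neg_mem (quadGhost_dfield (fun μ => pd l (D.ρup a μ)) fun b c => pd l (D.Cup a b c)))
    (fun l => neg_mem (quadGhost_bideg (fun μ => pd l (D.ρup a μ)) fun b c => pd l (D.Cup a b c))),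
    sgn_zero, one_smul, ct_neg_right]
  rfl

theorem τ_O₂_psi (μ : Fin m) : τ (D.O₂ (.psi μ)) = -ct B† fun l =>
    cubicGhost (fun a ν => pd l (pd μ (D.ρ a ν))) fun a b c => pd l (pd μ (D.C a b c)) := by
  rw [O₂, O₁, s₀_fld, D.τ_replaceEOM_F ((D.s₀_s₀_psi μ).trans (ct_neg_right _ _).symm)
    (fun l => neg_mem (cubicGhost_dfield (fun a ν => pd l (pd μ (D.ρ a ν)))
      fun a b c => pd l (pd μ (D.C a b c))))
    (fun l => neg_mem (cubicGhost_bideg (fun a ν => pd l (pd μ (D.ρ a ν)))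
      fun a b c => pd l (pd μ (D.C a b c)))),
    sgn_zero, one_smul, ct_neg_right]
  rfl

/-- Both terms turn positive: the first because its cofactor has form degree one, the second because
G is replaced by minus the raised antifield. -/
theorem τ_O₂_B (μ : Fin m) : τ (D.O₂ (.B μ)) = (ct B† fun l =>
    cubicGhost₁ (fun a ν => pd l (pd μ (D.ρ a ν))) fun a b c => pd l (pd μ (D.C a b c)))
    + ct D.aup fun a => quadGhost (fun ν => pd μ (D.ρ a ν)) fun b c => pd μ (D.C a b c) := by
  have h : τ (D.s₀ (D.brst (.B μ))) = (ct FT fun l =>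
    -cubicGhost₁ (fun a ν => pd l (pd μ (D.ρ a ν))) fun a b c => pd l (pd μ (D.C a b c)))
    + ct GT fun a => -quadGhost (fun ν => pd μ (D.ρ a ν)) fun b c => pd μ (D.C a b c) := by
    rw [s₀_s₀_B, ct_neg_right, ct_neg_right, sub_eq_add_neg]
    rfl
  rw [O₂, O₁, s₀_fld, D.τ_replaceEOM h (fun l => neg_mem (cubicGhost₁_dfield _ _))
    (fun l => neg_mem (quadGhost_dfield _ _)) (fun l => neg_mem (cubicGhost₁_bideg _ _))
    (fun l => neg_mem (quadGhost_bideg _ _)), sgn_zero, one_smul, ct_neg_right, ct_neg_right,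
    sgn_one, sub_neg_eq_add]
  congr 1
  rw [smul_neg]
  exact (congrArg Neg.neg (neg_one_smul (SmoothFn U) _)).trans (neg_neg _)

theorem replaceEOM_zero : D.replaceEOM 0 = 0 := D.replaceEOM_of_mem (zero_mem _)

theorem O₂_X (μ : Fin m) : D.O₂ (.X μ) = 0 := by
  rw [O₂, O₁, s₀_fld, (map_eq_zero_iff τ τ.injective).1 (D.s₀_s₀_X μ), replaceEOM_zero]

theorem O₂_eps (a : Fin k) : D.O₂ (.eps a) = 0 := by
  rw [O₂, O₁, s₀_fld, (map_eq_zero_iff τ τ.injective).1 (D.s₀_s₀_eps a), replaceEOM_zero]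

theorem O₂_psit (μ : Fin m) : D.O₂ (.psit μ) = 0 := by
  rw [O₂, O₁, s₀_fld, (map_eq_zero_iff τ τ.injective).1 (D.s₀_s₀_psit μ), replaceEOM_zero]

end LocalCourantAlgebroid

/-! ### The contraction that undoes differentiation of ghosts -/

section GhostContraction

variable {m k : ℕ} {U : TopologicalSpace.Opens (Fin m → ℝ)}

/-- The derivation `∑ c ∂/∂(dc)`, where `c` runs over the ghosts. -/
def ghostContraction : LForm k U →ₗ[ℝ] LForm k U :=
  ∑ φ : Fld m k, if 0 < φ.species.gh then lmul (fld φ) ∘ₗ lder (.dfield φ) else 0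

theorem ghostContraction_apply (α : LForm k U) : ghostContraction α
    = ∑ φ : Fld m k, if 0 < φ.species.gh then fld φ * lder (.dfield φ) α else 0 := by
  rw [ghostContraction, LinearMap.sum_apply]
  refine Finset.sum_congr rfl fun φ _ => ?_
  split_ifs <;> rfl

theorem bideg_dfield_sub (φ : Fld m k) : bideg (.dfield φ) + (-1, 0) = bideg (.field φ) := by
  rw [bideg_dfield, add_assoc]; simp

theorem isDer_ghostContraction : IsDer (-1, 0) (ghostContraction : LForm k U →ₗ[ℝ] LForm k U) :=
  IsDer.sum _ fun φ => by
    split_ifs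
    · exact isDer_lmul_lder (bideg_dfield_sub φ ▸ gen_mem_bideg _)
    · exact fun p α _ β => by simp

theorem ghostContraction_mem_bideg {p : ℤ × ℤ} {α : LForm k U} (hα : α ∈ HasWt bideg p) :
    ghostContraction α ∈ HasWt bideg (p + (-1, 0)) := by
  rw [ghostContraction, LinearMap.sum_apply]
  refine Submodule.sum_mem _ fun φ _ => ?_
  split_ifs
  · exact lmul_lder_mem_hasWt bideg_X (bideg_dfield_sub φ ▸ gen_mem_bideg _) hα
  · exact zero_mem _

theorem ghostContraction_eq_zero {α : LForm k U} (hα : α ∈ HasWt dfieldWt 0) :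
    ghostContraction α = 0 := by
  rw [ghostContraction_apply]
  exact Finset.sum_eq_zero fun φ _ => by rw [lder_dfield_eq_zero φ hα, mul_zero, ite_self]

/-- The derivation `∑ c ∂/∂(dc)` on the totally graded algebra. -/
def gcT : Tot k U →ₗ[ℝ] Tot k U :=
  (τ.toLinearMap.restrictScalars ℝ) ∘ₗ ghostContraction ∘ₗ (τ.symm.toLinearMap.restrictScalars ℝ)

theorem gcT_τ (α : LForm k U) : gcT (τ α) = τ (ghostContraction α) := rfl

theorem isOddDer_gcT : IsOddDer (gcT : Tot k U →ₗ[ℝ] Tot k U) :=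
  isOddDer_of_bideg fun p q α β hα hβ => by
    rw [τ_mul_τ hα hβ, ← map_smul, sgn_smul, gcT_τ, map_smul, isDer_ghostContraction p α hα, gcT_τ,
      gcT_τ, τ_mul_τ (ghostContraction_mem_bideg hα) hβ, τ_mul_τ hα (ghostContraction_mem_bideg hβ),
      ← sgn_smul, smul_add, smul_smul, map_add, map_smul, map_smul, smul_smul, ← sgn_add, ← sgn_add]
    simp only [Prod.fst_add, Prod.snd_add, add_zero]
    congr 2
    refine sgn_congr ⟨-p.1, ?_⟩
    simp only [par]; ring

theorem gcT_eq_zero {x : Tot k U} (hx : x ∈ TWt dfieldWt 0) : gcT x = 0 := by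
  rw [← τ.apply_symm_apply x, gcT_τ, ghostContraction_eq_zero (τ_symm_mem.2 hx), map_zero]

theorem gcT_dfT (φ : Fld m k) (h : 0 < φ.species.gh) : gcT (dfT φ : Tot k U) = fT φ := by
  rw [dfT, gcT_τ, ghostContraction_apply, Finset.sum_eq_single φ, if_pos h,
    lder_gen_self (by simp), mul_one]
  · rfl
  · intro χ _ hχ
    rw [lder_gen_of_ne (by simpa using hχ.symm), mul_zero, ite_self]
  · simp

/-- The weight that counts the ghosts. -/
def ghostWt : Gen m k → ℕ
  | .field φ => if 0 < φ.species.gh then 1 else 0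
  | .dfield φ => if 0 < φ.species.gh then 1 else 0
  | _ => 0

theorem Gen.sum_eq {M : Type*} [AddCommMonoid M] (h : Gen m k → M) : ∑ g, h g
    = ∑ φ, h (.field φ) + (∑ φ, h (.anti φ) + (∑ φ, h (.dfield φ) + ∑ φ, h (.danti φ))) := by
  let E : (Fld m k ⊕ Fld m k ⊕ Fld m k ⊕ Fld m k) ≃ Gen m k :=
    { toFun := Sum.elim .field (Sum.elim .anti (Sum.elim .dfield .danti))
      invFun := fun g => match g with
        | .field φ => .inl φ
        | .anti φ => .inr (.inl φ)
        | .dfield φ => .inr (.inr (.inl φ))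
        | .danti φ => .inr (.inr (.inr φ))
      left_inv := by rintro (_ | _ | _ | _) <;> rfl
      right_inv := by rintro (_ | _ | _ | _) <;> rfl }
  rw [← E.sum_comp]
  simp only [Fintype.sum_sum_type]
  rfl

theorem ghostCount_eq (e : Mon m k) : ghostCount e = wt ghostWt e.1 := by
  rw [wt, Gen.sum_eq, ghostCount]
  simp only [ghostWt, smul_zero, Finset.sum_const_zero, zero_add, add_zero]
  rw [← Finset.sum_add_distrib]
  refine Finset.sum_congr rfl fun φ _ => ?_
  split_ifs <;> simp

theorem rescale_ghostCount {n : ℕ} {x : Tot k U} (hx : x ∈ TWt ghostWt n) :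
    τ (rescale (fun e => ((ghostCount e : ℝ))⁻¹) (τ.symm x)) = (n : ℝ)⁻¹ • x := by
  rw [rescale_eq_smul (c := (n : ℝ)⁻¹) fun e he => by
    rw [ghostCount_eq, τ_symm_mem.2 hx e he], τ_real_smul, LinearEquiv.apply_symm_apply]

theorem ghostPrimitive_eq (α : LForm k U) :
    ghostPrimitive α = rescale (fun e => ((ghostCount e : ℝ))⁻¹) (ghostContraction α) := by
  rw [ghostContraction_apply]; rfl

theorem integrateByParts_of_mem {α : LForm k U} (hα : α ∈ HasWt dfieldWt 0) :
    integrateByParts α = α := by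
  rw [integrateByParts, ghostPrimitive_eq, ghostContraction_eq_zero hα, map_zero, map_zero,
    sub_zero]

end GhostContraction

/-! ### Integration by parts for cubic ghost polynomials -/

section Exact

variable {m k : ℕ} {U : TopologicalSpace.Opens (Fin m → ℝ)}

local notation "εT" => fun a => fT (Fld.eps a)
local notation "ψtT" => fun a => fT (Fld.psit a)
local notation "dεT" => fun a => dfT (Fld.eps a)
local notation "dψtT" => fun a => dfT (Fld.psit a)
local notation "dXT" => fun a => dfT (Fld.X a)
local notation "B†" => fun l => aT (Fld.B l)
local notation "dB†" => fun l => daT (Fld.B l)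

theorem eps_odd (a : Fin k) : (fT (.eps a) : Tot k U) ∈ TPar 1 := tPar_of_bideg (fT_mem _) rfl

theorem A_odd (a : Fin k) : (fT (.A a) : Tot k U) ∈ TPar 1 := tPar_of_bideg (fT_mem _) rfl

theorem psi_even (μ : Fin m) : (fT (.psi μ) : Tot k U) ∈ TPar 0 :=
  tPar_of_bideg (fT_mem _) (by exact (by decide : ((1 + 1 : ℤ) : ZMod 2) = 0))

theorem psit_even (μ : Fin m) : (fT (.psit μ) : Tot k U) ∈ TPar 0 :=
  tPar_of_bideg (fT_mem _) (by exact (by decide : ((0 + 2 : ℤ) : ZMod 2) = 0))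

theorem antiB_even (μ : Fin m) : (aT (.B μ) : Tot k U) ∈ TPar 0 :=
  tPar_of_bideg (aT_mem _) (by exact (by decide : ((3 - 2 + (-1 - 0) : ℤ) : ZMod 2) = 0))

theorem dX_odd (μ : Fin m) : (dfT (.X μ) : Tot k U) ∈ TPar 1 := tPar_of_bideg (dfT_mem _) rfl

theorem deps_even (a : Fin k) : (dfT (.eps a) : Tot k U) ∈ TPar 0 :=
  tPar_of_bideg (dfT_mem _) (by exact (by decide : ((0 + 1 + 1 : ℤ) : ZMod 2) = 0))

theorem dpsit_odd (μ : Fin m) : (dfT (.psit μ) : Tot k U) ∈ TPar 1 :=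
  tPar_of_bideg (dfT_mem _) (by exact (by decide : ((0 + 1 + 2 : ℤ) : ZMod 2) = 1))

variable {T : Tot k U →ₗ[ℝ] Tot k U} {ι : Type*} [Fintype ι]

theorem IsOddDer.ct_even (hT : IsOddDer T) {u : ι → Tot k U} (hu : ∀ i, u i ∈ TPar 0)
    (Φ : ι → Tot k U) : T (ct u Φ) = (ct (fun i => T (u i)) Φ) + ct u fun i => T (Φ i) := by
  simp only [ct, map_sum, hT.even_mul _ (hu _), Finset.sum_add_distrib]

theorem IsOddDer.ct_odd (hT : IsOddDer T) {u : ι → Tot k U} (hu : ∀ i, u i ∈ TPar 1)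
    (Φ : ι → Tot k U) : T (ct u Φ) = (ct (fun i => T (u i)) Φ) - ct u fun i => T (Φ i) := by
  simp only [ct, map_sum, hT.odd_mul _ (hu _), Finset.sum_sub_distrib]

theorem dT_smul_one (f : SmoothFn U) :
    dT (f • (1 : Tot k U)) = ct dXT fun μ => pd μ f • 1 := by
  rw [ct_smul_one_eq, smul_one_eq, dT_τ, d_fn, map_sum]
  simp only [map_smul]
  rfl

/-- The part of `d(r_a^μ ψ̃_μ ε^a + ⅙ c_{abc} ε^a ε^b ε^c)` in which the coefficients are not
differentiated. -/
def dcubicGhost (r : Fin k → Fin m → SmoothFn U) (c : Fin k → Fin k → Fin k → SmoothFn U) :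
    Tot k U :=
  (ct dψtT fun μ => ct εT fun a => r a μ • 1) + (ct ψtT fun μ => ct dεT fun a => r a μ • 1)
    + (1 / 2 : ℝ) • tri c dεT εT εT

/-- By alternation the three positions of dε merge, turning ⅙ into ½. The derivative of the
coefficients produces dX, which is where a field equation becomes visible after integration by
parts. -/
theorem dT_cubicGhost (r : Fin k → Fin m → SmoothFn U) {c : Fin k → Fin k → Fin k → SmoothFn U}
    (hc : IsAlt c) : dT (cubicGhost r c) = dcubicGhost r c
      + ct dXT fun l => cubicGhost (fun a μ => pd l (r a μ)) fun a b e => pd l (c a b e) := by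
  have h := isOddDer_dT (k := k) (U := U)
  have c1 : ∀ (a b : Fin k), (fT (.eps a) * dfT (.eps b) : Tot k U) = dfT (.eps b) * fT (.eps a) :=
    fun a b => (even_mul_comm (deps_even b) _).symm
  have c2 : ∀ (a : Fin k) (l : Fin m), (fT (.eps a) * dfT (.X l) : Tot k U)
      = -(dfT (.X l) * fT (.eps a)) := fun a l => odd_mul_comm (eps_odd a) (dX_odd l)
  have c3 : ∀ (a : Fin m) (l : Fin m), (fT (.psit a) * dfT (.X l) : Tot k U)
      = dfT (.X l) * fT (.psit a) := fun a l => even_mul_comm (psit_even a) _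
  simp only [cubicGhost, dcubicGhost, tri, map_add, map_smul, h.ct_even psit_even, h.ct_odd eps_odd,
    dT_smul_one, dT_fT, ct_add_right, ct_sub_right, ct_smul_right (S := ℝ), ct_anticomm c2,
    ct_neg_right, ct_comm c3]
  have e1 : (ct εT fun a => ct dεT fun b => ct εT fun d => c a b d • (1 : Tot k U))
      = -ct dεT fun a => ct εT fun b => ct εT fun d => c a b d • 1 := by
    rw [ct_comm c1, ← ct_neg_right]
    simp only [← ct_neg_right, ← neg_smul, ← hc.swap₁₂]
  have e2 : (ct εT fun a => ct εT fun b => ct dεT fun d => c a b d • (1 : Tot k U))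
      = ct dεT fun a => ct εT fun b => ct εT fun d => c a b d • 1 := by
    simp only [ct_comm c1]
    have : ∀ a b d, c b d a = c a b d := fun a b d => by
      rw [hc.swap₂₃ b d a, hc.swap₁₂ b a d, neg_neg]
    simp only [this]
  rw [e1, e2]
  module

/-- Each monomial returns as often as it has ghosts: twice for ψ̃ε, three times for εεε, where 3 · ⅙
= ½. -/
theorem gcT_dcubicGhost (r : Fin k → Fin m → SmoothFn U)
    (c : Fin k → Fin k → Fin k → SmoothFn U) : gcT (dcubicGhost r c)
      = (2 : ℝ) • (ct ψtT fun μ => ct εT fun a => r a μ • 1) + (1 / 2 : ℝ) • tri c εT εT εT := by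
  have h := isOddDer_gcT (k := k) (U := U)
  have e1 : ∀ f : SmoothFn U, gcT (f • (1 : Tot k U)) = 0 := fun f =>
    gcT_eq_zero (Submodule.smul_mem _ _ (one_mem_tWt _))
  have e2 : ∀ φ : Fld m k, gcT (fT φ : Tot k U) = 0 := fun φ =>
    gcT_eq_zero (τ_gen_mem_wt (fun _ => rfl) rfl)
  have e3 : ∀ a : Fin k, gcT (dfT (.eps a) : Tot k U) = fT (.eps a) := fun a =>
    gcT_dfT _ Int.one_pos
  have e4 : ∀ μ : Fin m, gcT (dfT (.psit μ) : Tot k U) = fT (.psit μ) := fun μ =>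
    gcT_dfT _ (by exact (by decide : (0 : ℤ) < 2))
  simp only [dcubicGhost, tri, map_add, map_smul, h.ct_even psit_even, h.ct_odd eps_odd,
    h.ct_even deps_even, h.ct_odd dpsit_odd, e1, e2, e3, e4, ct_zero_left, ct_zero_right, sub_zero,
    add_zero, zero_add]
  module

theorem gcT_ct_antiB (Φ : Fin m → Tot k U) : gcT (ct B† Φ) = ct B† fun l => gcT (Φ l) := by
  have e : ∀ φ : Fld m k, gcT (aT φ : Tot k U) = 0 := fun φ =>
    gcT_eq_zero (τ_gen_mem_wt (fun _ => rfl) rfl)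
  rw [isOddDer_gcT.ct_even antiB_even]
  simp only [e, ct_zero_left, zero_add]

/-- Division by the ghost numbers of factors, 2 and 3, undoes exactly the multiplicities of
`gcT_dcubicGhost`; N is annihilated because it has no differentials of fields or ghosts. -/
theorem ghostPrimitive_of_eq {α : LForm k U} {N : Tot k U} (hN : N ∈ TWt dfieldWt 0)
    {r : Fin m → Fin k → Fin m → SmoothFn U} {c : Fin m → Fin k → Fin k → Fin k → SmoothFn U}
    (hα : τ α = -(ct B† fun l => dcubicGhost (r l) (c l)) + N) :
    τ (ghostPrimitive α) = -ct B† fun l => cubicGhost (r l) (c l) := by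
  have h : τ (ghostContraction α) = (-2 : ℝ) • (ct B† fun l => ct ψtT fun μ => ct εT fun a => r l a μ • 1)
      + (-1 / 2 : ℝ) • ct B† fun l => tri (c l) εT εT εT := by
    rw [← gcT_τ, hα, map_add, map_neg, gcT_eq_zero hN, gcT_ct_antiB]
    simp only [gcT_dcubicGhost, ct_add_right, ct_smul_right (S := ℝ)]
    module
  have hB : ∀ l, (aT (.B l) : Tot k U) ∈ TWt ghostWt 0 := fun l => τ_gen_mem_wt (fun _ => rfl) rfl
  have hε : ∀ l, (fT (.eps l) : Tot k U) ∈ TWt ghostWt 1 := fun l => τ_gen_mem_wt (fun _ => rfl) rfl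
  -- A ghost for ghost counts once here, although its ghost number is two.
  have hψ : ∀ l, (fT (.psit l) : Tot k U) ∈ TWt ghostWt 1 :=
    fun l => τ_gen_mem_wt (fun _ => rfl) rfl
  have h1 : (ct B† fun l => ct ψtT fun μ => ct εT fun a => r l a μ • (1 : Tot k U)) ∈ TWt ghostWt 2 :=
    ct_mem_tWt (n := 0) (n' := 2) hB (fun l => ct_ct_smul_one_mem (n := 1) (n' := 1) hψ hε _ rfl) rfl
  have h2 : (ct B† fun l => tri (c l) εT εT εT) ∈ TWt (U := U) ghostWt 3 :=
    ct_mem_tWt (n := 0) (n' := 3) hB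
      (fun l => tri_mem (n := 1) (n' := 1) (n'' := 1) hε hε hε _ rfl) rfl
  have e1 := rescale_ghostCount h1
  have e2 := rescale_ghostCount h2
  rw [ghostPrimitive_eq, ← τ.symm_apply_apply (ghostContraction α), h, map_add, map_add, map_add,
    τ_symm_real_smul, τ_symm_real_smul, map_smul (rescale _), map_smul (rescale _), τ_real_smul,
    τ_real_smul, e1, e2]
  simp only [cubicGhost, ct_add_right, ct_smul_right (S := ℝ)]
  push_cast
  module

end Exact
-- The third-order expressions
namespace LocalCourantAlgebroid

variable {m k : ℕ} {U : TopologicalSpace.Opens (Fin m → ℝ)} (D : LocalCourantAlgebroid m k U)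

local notation "εT" => fun a => fT (Fld.eps a)
local notation "AT" => fun a => fT (Fld.A a)
local notation "ψT" => fun a => fT (Fld.psi a)
local notation "ψtT" => fun a => fT (Fld.psit a)
local notation "dεT" => fun a => dfT (Fld.eps a)
local notation "dψtT" => fun a => dfT (Fld.psit a)
local notation "dXT" => fun a => dfT (Fld.X a)
local notation "FT" => fun l => τ (LocalCourantAlgebroid.F D l)
local notation "B†" => fun l => aT (Fld.B l)
local notation "dB†" => fun l => daT (Fld.B l)

theorem fT_mem_dfield (φ : Fld m k) : (fT φ : Tot k U) ∈ TWt dfieldWt 0 :=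
  τ_gen_mem_wt (fun _ => rfl) rfl

theorem aT_mem_dfield (φ : Fld m k) : (aT φ : Tot k U) ∈ TWt dfieldWt 0 :=
  τ_gen_mem_wt (fun _ => rfl) rfl

theorem daT_mem_dfield (φ : Fld m k) : (daT φ : Tot k U) ∈ TWt dfieldWt 0 :=
  τ_gen_mem_wt (fun _ => rfl) rfl

theorem smul_one_mem_dfield (f : SmoothFn U) : (f • 1 : Tot k U) ∈ TWt dfieldWt 0 :=
  Submodule.smul_mem _ _ (one_mem_tWt _)

theorem ct_mem_dfield {ι : Type*} [Fintype ι] {u Φ : ι → Tot k U}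
    (hu : ∀ i, u i ∈ TWt dfieldWt 0) (hΦ : ∀ i, Φ i ∈ TWt dfieldWt 0) :
    ct u Φ ∈ TWt dfieldWt 0 := ct_mem_tWt hu hΦ rfl

theorem aup_mem (a : Fin k) : D.aup a ∈ TWt bideg (2, -1) :=
  Submodule.sum_mem _ fun b _ => real_smul_mem_tWt _ (antiA_mem b)

theorem aup_odd (a : Fin k) : D.aup a ∈ TPar 1 :=
  tPar_of_bideg (D.aup_mem a) (by exact (by decide : ((2 + -1 : ℤ) : ZMod 2) = 1))

theorem aup_mem_dfield (a : Fin k) : D.aup a ∈ TWt dfieldWt 0 :=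
  Submodule.sum_mem _ fun b _ => real_smul_mem_tWt _ (aT_mem_dfield (.A b))

theorem σ_fT (φ : Fld m k) :
    D.σ (fT φ) = (sgn φ.species.deg : SmoothFn U) • τ (D.brst φ) := by
  rw [fT, D.σ_τ (gen_mem_bideg _), s₀_fld]
  rfl

theorem σ_aT (φ : Fld m k) : D.σ (aT φ) = 0 := by
  rw [aT, D.σ_τ (gen_mem_bideg _), s₀_anti, map_zero, smul_zero]

theorem σ_aup (a : Fin k) : D.σ (D.aup a) = 0 := by
  rw [aup, map_sum]
  exact Finset.sum_eq_zero fun b _ => by rw [map_smul D.σ, σ_aT, smul_zero]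

theorem σ_eps_mem (a : Fin k) : D.σ (fT (.eps a)) ∈ TWt dfieldWt 0 := by
  rw [σ_fT, τ_brst_eps]
  refine Submodule.smul_mem _ _ (sub_mem (neg_mem ?_) (real_smul_mem_tWt _ ?_))
  · exact ct_smul_one_mem (fun _ => fT_mem_dfield _) _
  · exact ct_ct_smul_one_mem (fun _ => fT_mem_dfield _) (fun _ => fT_mem_dfield _) _ rfl

theorem σ_psit_mem (μ : Fin m) : D.σ (fT (.psit μ)) ∈ TWt dfieldWt 0 := by
  rw [σ_fT, τ_brst_psit]
  refine Submodule.smul_mem _ _ (sub_mem (neg_mem ?_) (real_smul_mem_tWt _ ?_))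
  · exact ct_ct_smul_one_mem (fun _ => fT_mem_dfield _) (fun _ => fT_mem_dfield _) _ rfl
  · exact tri_mem (fun _ => fT_mem_dfield _) (fun _ => fT_mem_dfield _)
      (fun _ => fT_mem_dfield _) _ rfl

/-- The only differential in σA is -dε; adding dε leaves a polynomial in undifferentiated symbols.
-/
theorem σ_A_mem (a : Fin k) : D.σ (fT (.A a)) + dfT (.eps a) ∈ TWt dfieldWt 0 := by
  have h1 : (sgn 1 : SmoothFn U) • τ (D.brst (.A a)) = -τ (D.brst (.A a)) := by
    rw [sgn_one]; exact neg_one_smul (SmoothFn U) _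
  rw [σ_fT]
  simp only [Fld.species, Species.deg]
  rw [h1, τ_brst_A, add_assoc, neg_add, neg_add_cancel_comm]
  refine neg_mem (add_mem ?_ ?_)
  · exact ct_smul_one_mem (fun _ => fT_mem_dfield _) _
  · exact ct_ct_smul_one_mem (fun _ => fT_mem_dfield _) (fun _ => fT_mem_dfield _) _ rfl

theorem σ_psi_mem (μ : Fin m) : D.σ (fT (.psi μ)) + dfT (.psit μ) ∈ TWt dfieldWt 0 := by
  have h1 : (sgn 1 : SmoothFn U) • τ (D.brst (.psi μ)) = -τ (D.brst (.psi μ)) := by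
    rw [sgn_one]; exact neg_one_smul (SmoothFn U) _
  rw [σ_fT]
  simp only [Fld.species, Species.deg]
  rw [h1, τ_brst_psi, add_assoc, add_assoc, neg_add, neg_add_cancel_comm, ← add_assoc]
  refine neg_mem (add_mem (add_mem ?_ ?_) (real_smul_mem_tWt _ ?_))
  · exact ct_ct_smul_one_mem (fun _ => fT_mem_dfield _) (fun _ => fT_mem_dfield _) _ rfl
  · exact ct_ct_smul_one_mem (fun _ => fT_mem_dfield _) (fun _ => fT_mem_dfield _) _ rfl
  · exact tri_mem (fun _ => fT_mem_dfield _) (fun _ => fT_mem_dfield _)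
      (fun _ => fT_mem_dfield _) _ rfl

theorem σ_smul_one (f : SmoothFn U) :
    D.σ (f • 1) = ct (fun μ => D.σ (fT (.X μ))) fun μ => pd μ f • 1 := by
  rw [ct_smul_one_eq, smul_one_eq, D.σ_τ (fn_mem_hasWt _ _), s₀_fn, map_sum]
  simp only [Prod.fst_zero, sgn_zero, one_smul, map_smul, σ_fT, Fld.species, Species.deg]

theorem σ_smul_one_mem (f : SmoothFn U) : D.σ (f • 1) ∈ TWt dfieldWt 0 := by
  rw [σ_smul_one]
  refine ct_smul_one_mem (fun μ => ?_) _
  rw [σ_fT, τ_brst_X]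
  exact Submodule.smul_mem _ _ (ct_smul_one_mem (fun _ => fT_mem_dfield _) _)

theorem σ_ct_eps_mem {Φ : Fin k → Tot k U} (h : ∀ a, Φ a ∈ TWt dfieldWt 0)
    (h' : ∀ a, D.σ (Φ a) ∈ TWt dfieldWt 0) : D.σ (ct εT Φ) ∈ TWt dfieldWt 0 := by
  rw [D.isOddDer_σ.ct_odd eps_odd]
  exact sub_mem (ct_mem_dfield (fun a => D.σ_eps_mem a) h)
    (ct_mem_dfield (fun _ => fT_mem_dfield _) h')

theorem σ_ct_psit_mem {Φ : Fin m → Tot k U} (h : ∀ a, Φ a ∈ TWt dfieldWt 0)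
    (h' : ∀ a, D.σ (Φ a) ∈ TWt dfieldWt 0) : D.σ (ct ψtT Φ) ∈ TWt dfieldWt 0 := by
  rw [D.isOddDer_σ.ct_even psit_even]
  exact add_mem (ct_mem_dfield (fun a => D.σ_psit_mem a) h)
    (ct_mem_dfield (fun _ => fT_mem_dfield _) h')

theorem σ_eps_eps_mem (c : Fin k → Fin k → SmoothFn U) :
    D.σ (ct εT fun a => ct εT fun b => c a b • 1) ∈ TWt dfieldWt 0 :=
  D.σ_ct_eps_mem (fun _ => ct_smul_one_mem (fun _ => fT_mem_dfield _) _) fun _ =>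
    D.σ_ct_eps_mem (fun _ => smul_one_mem_dfield _) fun _ => D.σ_smul_one_mem _

theorem σ_quadGhost_mem (r : Fin m → SmoothFn U) (c : Fin k → Fin k → SmoothFn U) :
    D.σ (quadGhost r c) ∈ TWt dfieldWt 0 := by
  rw [quadGhost, map_add, map_smul D.σ]
  exact add_mem (D.σ_ct_psit_mem (fun _ => smul_one_mem_dfield _) fun _ => D.σ_smul_one_mem _)
    (real_smul_mem_tWt _ (D.σ_eps_eps_mem _))

theorem σ_cubicGhost_mem (r : Fin k → Fin m → SmoothFn U)
    (c : Fin k → Fin k → Fin k → SmoothFn U) : D.σ (cubicGhost r c) ∈ TWt dfieldWt 0 := by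
  rw [cubicGhost, map_add, map_smul D.σ]
  refine add_mem (D.σ_ct_psit_mem (fun _ => ct_smul_one_mem (fun _ => fT_mem_dfield _) _) fun _ =>
    D.σ_ct_eps_mem (fun _ => smul_one_mem_dfield _) fun _ => D.σ_smul_one_mem _)
    (real_smul_mem_tWt _ (D.σ_ct_eps_mem (fun _ => ?_) fun _ => D.σ_eps_eps_mem _))
  exact ct_ct_smul_one_mem (fun _ => fT_mem_dfield _) (fun _ => fT_mem_dfield _) _ rfl

/-- Differentials arise only from ψ ↦ -dψ̃ and A ↦ -dε. Substituted into the three terms they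
assemble to minus `dcubicGhost`. -/
theorem σ_cubicGhost₁_mem (r : Fin k → Fin m → SmoothFn U)
    (c : Fin k → Fin k → Fin k → SmoothFn U) :
    D.σ (cubicGhost₁ r c) + dcubicGhost r c ∈ TWt dfieldWt 0 := by
  -- The Leibniz expansion, with the variations of ψ and A completed to the differential-free
  -- combinations of `σ_psi_mem` and `σ_A_mem`.
  have e : D.σ (cubicGhost₁ r c) + dcubicGhost r c
      = (ct (fun μ => D.σ (fT (.psi μ)) + dfT (.psit μ)) fun μ => ct εT fun a => r a μ • 1)
      + (ct ψT fun μ => D.σ (ct εT fun a => r a μ • 1))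
      + (ct (fun μ => D.σ (fT (.psit μ))) fun μ => ct AT fun a => r a μ • 1)
      + (ct ψtT fun μ => (ct (fun a => D.σ (fT (.A a)) + dfT (.eps a)) fun a => r a μ • 1)
        - ct AT fun a => D.σ (r a μ • 1))
      + (1 / 2 : ℝ) • ((tri c (fun a => D.σ (fT (.A a)) + dfT (.eps a)) εT εT)
        - ct AT fun a => D.σ (ct εT fun b => ct εT fun d => c a b d • 1)) := by
    simp only [cubicGhost₁, dcubicGhost, tri, map_add, map_smul D.σ, D.isOddDer_σ.ct_even psi_even,
      D.isOddDer_σ.ct_even psit_even, D.isOddDer_σ.ct_odd A_odd, ct_add_left, ct_add_right,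
      ct_sub_right]
    module
  rw [e]
  refine add_mem (add_mem (add_mem (add_mem ?_ ?_) ?_) ?_) (real_smul_mem_tWt _ (sub_mem ?_ ?_))
  · exact ct_mem_dfield (fun _ => D.σ_psi_mem _)
      fun _ => ct_smul_one_mem (fun _ => fT_mem_dfield _) _
  · exact ct_mem_dfield (fun _ => fT_mem_dfield _) fun _ =>
      D.σ_ct_eps_mem (fun _ => smul_one_mem_dfield _) fun _ => D.σ_smul_one_mem _
  · exact ct_mem_dfield (fun _ => D.σ_psit_mem _)
      fun _ => ct_smul_one_mem (fun _ => fT_mem_dfield _) _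
  · refine ct_mem_dfield (fun _ => fT_mem_dfield _) fun _ => sub_mem ?_ ?_
    · exact ct_smul_one_mem (fun _ => D.σ_A_mem _) _
    · exact ct_mem_dfield (fun _ => fT_mem_dfield _) fun _ => D.σ_smul_one_mem _
  · exact tri_mem (fun _ => D.σ_A_mem _) (fun _ => fT_mem_dfield _)
      (fun _ => fT_mem_dfield _) _ rfl
  · exact ct_mem_dfield (fun _ => fT_mem_dfield _) fun _ => D.σ_eps_eps_mem _

theorem σ_ct_antiB (Φ : Fin m → Tot k U) : D.σ (ct B† Φ) = ct B† fun l => D.σ (Φ l) := by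
  rw [D.isOddDer_σ.ct_even antiB_even]
  simp only [σ_aT, ct_zero_left, zero_add]

theorem O₂_A_mem (a : Fin k) : D.O₂ (.A a) ∈ HasWt bideg (1, 1) := by
  rw [← τ_mem, τ_O₂_A]
  exact neg_mem (ct_mem_tWt (n := (1, -1)) (n' := (0, 2)) antiB_mem
    (fun l => quadGhost_bideg _ _) rfl)

theorem O₂_psi_mem (μ : Fin m) : D.O₂ (.psi μ) ∈ HasWt bideg (1, 2) := by
  rw [← τ_mem, τ_O₂_psi]
  exact neg_mem (ct_mem_tWt (n := (1, -1)) (n' := (0, 3)) antiB_mem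
    (fun l => cubicGhost_bideg _ _) rfl)

theorem O₂_B_mem (μ : Fin m) : D.O₂ (.B μ) ∈ HasWt bideg (2, 1) := by
  rw [← τ_mem, τ_O₂_B]
  exact add_mem (ct_mem_tWt (n := (1, -1)) (n' := (1, 2)) antiB_mem
    (fun l => cubicGhost₁_bideg _ _) rfl) (ct_mem_tWt (n := (2, -1)) (n' := (0, 2)) D.aup_mem
    (fun l => quadGhost_bideg _ _) rfl)

theorem O₂_A_mem_dfield (a : Fin k) : D.O₂ (.A a) ∈ HasWt dfieldWt 0 := by
  rw [← τ_mem, τ_O₂_A]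
  exact neg_mem (ct_mem_dfield (fun _ => aT_mem_dfield _) fun _ => quadGhost_dfield _ _)

theorem O₂_psi_mem_dfield (μ : Fin m) : D.O₂ (.psi μ) ∈ HasWt dfieldWt 0 := by
  rw [← τ_mem, τ_O₂_psi]
  exact neg_mem (ct_mem_dfield (fun _ => aT_mem_dfield _) fun _ => cubicGhost_dfield _ _)

theorem O₂_B_mem_dfield (μ : Fin m) : D.O₂ (.B μ) ∈ HasWt dfieldWt 0 := by
  rw [← τ_mem, τ_O₂_B]
  exact add_mem (ct_mem_dfield (fun _ => aT_mem_dfield _) fun _ => cubicGhost₁_dfield _ _)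
    (ct_mem_dfield D.aup_mem_dfield fun _ => quadGhost_dfield _ _)

theorem τ_s₀ {p : ℤ × ℤ} {α : LForm k U} (hα : α ∈ HasWt bideg p) :
    τ (D.s₀ α) = (sgn p.1 : SmoothFn U) • D.σ (τ α) := by
  rw [D.σ_τ hα, smul_smul, sgn_mul_self, one_smul]

/-- Without differentials of fields or ghosts neither 𝔣 nor the integration by parts does anything.
-/
theorem O₃_eq_of_mem {φ : Fld m k} (h : D.O₂ φ ∈ HasWt dfieldWt 0)
    (h' : D.s₀ (D.O₂ φ) ∈ HasWt dfieldWt 0) : D.O₃ φ = D.s₀ (D.O₂ φ) := by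
  rw [O₃, D.replaceEOM_of_mem h, integrateByParts_of_mem h', D.replaceEOM_of_mem h']

theorem O₃_eq_zero {φ : Fld m k} (h : D.O₂ φ = 0) : D.O₃ φ = 0 := by
  rw [D.O₃_eq_of_mem (h ▸ zero_mem _) (by rw [h, map_zero]; exact zero_mem _), h, map_zero]

/-- Only the bidegree is recorded: A† has ghost number -1, so the pairing has ghost number one and
is removed by the projection. For ψ the numbers are -2 and 3. -/
theorem O₃_A_mem (a : Fin k) : D.O₃ (.A a) ∈ HasWt bideg (1, 2) := by
  rw [D.O₃_eq_of_mem (D.O₂_A_mem_dfield a)]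
  · exact D.s₀_mem_bideg (D.O₂_A_mem a)
  · rw [← τ_mem, D.τ_s₀ (D.O₂_A_mem a), τ_O₂_A, map_neg, σ_ct_antiB]
    exact Submodule.smul_mem _ _ (neg_mem
      (ct_mem_dfield (fun _ => aT_mem_dfield _) fun _ => D.σ_quadGhost_mem _ _))

theorem O₃_psi_mem (μ : Fin m) : D.O₃ (.psi μ) ∈ HasWt bideg (1, 3) := by
  rw [D.O₃_eq_of_mem (D.O₂_psi_mem_dfield μ)]
  · exact D.s₀_mem_bideg (D.O₂_psi_mem μ)
  · rw [← τ_mem, D.τ_s₀ (D.O₂_psi_mem μ), τ_O₂_psi, map_neg, σ_ct_antiB]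
    exact Submodule.smul_mem _ _ (neg_mem
      (ct_mem_dfield (fun _ => aT_mem_dfield _) fun _ => D.σ_cubicGhost_mem _ _))

/-- Antifields are annihilated and the variation of `quadGhost` has no differentials, so all
differentiated ghosts come from `cubicGhost₁`. -/
theorem τ_s₀_O₂_B (μ : Fin m) : ∃ N ∈ TWt (U := U) (dfieldWt : Gen m k → ℕ) 0,
    τ (D.s₀ (D.O₂ (.B μ))) = -(ct B† fun l => dcubicGhost (fun a ν => pd l (pd μ (D.ρ a ν)))
      fun a b c => pd l (pd μ (D.C a b c))) + N := by
  refine ⟨(ct B† fun l => D.σ (cubicGhost₁ (fun a ν => pd l (pd μ (D.ρ a ν)))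
      fun a b c => pd l (pd μ (D.C a b c))) + dcubicGhost (fun a ν => pd l (pd μ (D.ρ a ν)))
      fun a b c => pd l (pd μ (D.C a b c)))
    - ct D.aup fun a => D.σ (quadGhost (fun ν => pd μ (D.ρ a ν)) fun b c => pd μ (D.C a b c)),
    sub_mem (ct_mem_dfield (fun _ => aT_mem_dfield _) fun _ => D.σ_cubicGhost₁_mem _ _)
      (ct_mem_dfield D.aup_mem_dfield fun _ => D.σ_quadGhost_mem _ _), ?_⟩
  rw [D.τ_s₀ (D.O₂_B_mem μ), τ_O₂_B, map_add, σ_ct_antiB, D.isOddDer_σ.ct_odd D.aup_odd,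
    sgn_of_even (by decide), one_smul]
  simp only [σ_aup, ct_zero_left, ct_add_right]
  abel

theorem replaceEOM_add (α β : LForm k U) :
    D.replaceEOM (α + β) = D.replaceEOM α + D.replaceEOM β := by
  simp only [replaceEOM, map_add, mul_add, Finset.sum_add_distrib]
  abel

theorem τ_replaceEOM_F_add {α : LForm k U} {P : Fin m → Tot k U} {N : Tot k U} {p : ℤ × ℤ}
    (hα : τ α = ct FT P + N) (hP : ∀ l, P l ∈ TWt dfieldWt 0) (hp : ∀ l, P l ∈ TWt bideg p)
    (hN : N ∈ TWt dfieldWt 0) :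
    τ (D.replaceEOM α) = (sgn p.1 : SmoothFn U) • ct B† P + N := by
  have e : α = τ.symm (ct FT P) + τ.symm N := by
    rw [← map_add, ← hα, LinearEquiv.symm_apply_apply]
  rw [e, replaceEOM_add, D.replaceEOM_of_mem (τ_symm_mem.2 hN), map_add,
    LinearEquiv.apply_symm_apply, D.τ_replaceEOM_F (LinearEquiv.apply_symm_apply _ _) hP hp]

/-- Removing the total derivative trades the differentiated ghosts for dB† and for dX on the
coefficients. The part F of dX = F + ρA becomes another B†, with a minus sign since its cofactor has
form degree one. The rest N keeps ghost number two and is lost in the projection; only its bidegree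
is needed. -/
theorem τ_O₃_B (μ : Fin m) : ∃ N ∈ TWt (U := U) (bideg : Gen m k → ℤ × ℤ) (2, 2),
    τ (D.O₃ (.B μ)) = -(ct B† fun κ => ct B† fun l =>
      cubicGhost (fun a ν => pd κ (pd l (pd μ (D.ρ a ν))))
        fun a b c => pd κ (pd l (pd μ (D.C a b c)))) + N := by
  obtain ⟨N₀, hN₀, h₀⟩ := D.τ_s₀_O₂_B μ
  have hΘ := ghostPrimitive_of_eq hN₀ h₀
  set α := D.s₀ (D.O₂ (.B μ)) with hα
  have hαm : α ∈ HasWt bideg (2, 2) := D.s₀_mem_bideg (D.O₂_B_mem μ)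
  have hΘm : ghostPrimitive α ∈ HasWt bideg (1, 2) := by
    rw [← τ_mem, hΘ]
    exact neg_mem (ct_mem_tWt (n := (1, -1)) (n' := (0, 3)) antiB_mem
      (fun l => cubicGhost_bideg _ _) rfl)
  have hβm : integrateByParts α ∈ HasWt bideg (2, 2) := sub_mem hαm (d_mem_bideg hΘm)
  set M : Fin m → Tot k U := fun κ => ct B† fun l =>
    cubicGhost (fun a ν => pd κ (pd l (pd μ (D.ρ a ν))))
      fun a b c => pd κ (pd l (pd μ (D.C a b c))) with hM
  have hMm : ∀ κ, M κ ∈ TWt bideg (1, 2) := fun κ =>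
    ct_mem_tWt (n := (1, -1)) (n' := (0, 3)) antiB_mem
      (fun l => cubicGhost_bideg _ _) rfl
  have hMd : ∀ κ, M κ ∈ TWt dfieldWt 0 := fun κ =>
    ct_mem_dfield (fun _ => aT_mem_dfield _) fun _ => cubicGhost_dfield _ _
  have hFM : ct FT M ∈ TWt bideg (2, 2) := ct_mem_tWt (n := (1, 0)) (n' := (1, 2)) D.F_mem hMm rfl
  have hX : ∀ l, (dfT (.X l) : Tot k U) = τ (D.F l) + ct AT fun a => D.ρ a l • 1 := fun l => by
    rw [τ_F, sub_add_cancel]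
  have hBX : ∀ l κ, (aT (.B l) * dfT (.X κ) : Tot k U) = dfT (.X κ) * aT (.B l) :=
    fun l κ => even_mul_comm (antiB_even l) _
  have hβ : τ (integrateByParts α) = ct FT M + (N₀
      + (ct dB† fun l => cubicGhost (fun a ν => pd l (pd μ (D.ρ a ν)))
        fun a b c => pd l (pd μ (D.C a b c)))
      + ct (fun l => ct AT fun a => D.ρ a l • 1) M) := by
    -- Splitting dX into the field equation and its on-shell value; only the former is seen by 𝔣.
    have hFA : ct FT M + ct (fun l => ct AT fun a => D.ρ a l • 1) M = ct dXT M := by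
      rw [← ct_add_left]
      simp only [← hX]
    have hc := fun l => isAlt_map (pd l) (D.isAlt_pd_C μ)
    have hd := fun l => dT_cubicGhost (fun a ν => pd l (pd μ (D.ρ a ν))) (hc l)
    rw [integrateByParts, map_sub, ← dT_τ, hΘ, h₀, map_neg, isOddDer_dT.ct_even antiB_even]
    simp only [hd, ct_add_right, dT_aT]
    rw [ct_comm hBX]
    have hpd : (ct dXT fun κ => ct B† fun l => cubicGhost (fun a ν => pd κ (pd l (pd μ (D.ρ a ν))))
      fun a b c => pd κ (pd l (pd μ (D.C a b c)))) = ct dXT M := rfl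
    rw [hpd, ← hFA]
    abel
  set N := N₀ + (ct dB† fun l => cubicGhost (fun a ν => pd l (pd μ (D.ρ a ν)))
        fun a b c => pd l (pd μ (D.C a b c))) + ct (fun l => ct AT fun a => D.ρ a l • 1) M with hN
  have hNd : N ∈ TWt dfieldWt 0 := add_mem (add_mem hN₀ (ct_mem_dfield (fun _ => daT_mem_dfield _)
    fun _ => cubicGhost_dfield _ _))
    (ct_mem_dfield (fun _ => ct_smul_one_mem (fun _ => fT_mem_dfield _) _) hMd)
  clear_value N α
  -- The summand `N₀` comes with no bidegree, so that of N is inferred from the difference of two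
  -- bihomogeneous forms.
  have hNm : N ∈ TWt bideg (2, 2) := by
    rw [eq_sub_of_add_eq' hβ.symm]
    exact sub_mem (τ_mem.2 hβm) hFM
  refine ⟨N, hNm, ?_⟩
  rw [O₃, D.replaceEOM_of_mem (D.O₂_B_mem_dfield μ), ← hα,
    D.τ_replaceEOM_F_add hβ hMd hMm hNd, sgn_one]
  refine congrArg (· + N) ?_
  exact neg_one_smul (SmoothFn U) _

end LocalCourantAlgebroid

/-! ### Antifield content, and the first-order terms -/

section Counting

variable {m k : ℕ} {U : TopologicalSpace.Opens (Fin m → ℝ)}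

/-- The weight that counts the antifields of each species. -/
def antifieldWt : Gen m k → Species → ℕ
  | .anti φ => Pi.single φ.species 1
  | .danti φ => Pi.single φ.species 1
  | _ => 0

theorem antifieldCount_eq (s : Species) (e : Mon m k) :
    LocalCourantAlgebroid.antifieldCount s e = wt antifieldWt e.1 s := by
  rw [wt, Gen.sum_eq, LocalCourantAlgebroid.antifieldCount]
  simp only [antifieldWt, smul_zero, Finset.sum_const_zero, zero_add]
  rw [← Finset.sum_add_distrib, Finset.sum_apply]
  refine Finset.sum_congr rfl fun φ _ => ?_
  simp only [Pi.add_apply, Pi.smul_apply, Pi.single_apply, eq_comm (a := s)]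
  split_ifs <;> simp

theorem antifieldFactorial_eq {e : Mon m k} {v : Species → ℕ} (h : wt antifieldWt e.1 = v) :
    LocalCourantAlgebroid.antifieldFactorial e = ∏ s, (v s).factorial := by
  simp only [LocalCourantAlgebroid.antifieldFactorial, antifieldCount_eq, h]

/-- Forms with different antifield content share no monomial. Multiplicities can thus be read off
without inspecting individual coefficients. -/
theorem coeffs_eq_zero_of_ne {v v' : Species → ℕ} {α β : LForm k U}
    (hα : α ∈ HasWt antifieldWt v) (hβ : β ∈ HasWt antifieldWt v') (hv : v' ≠ v) {e : Mon m k}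
    (h : coeffs α e ≠ 0) : coeffs β e = 0 := by
  by_contra h'
  exact hv ((hβ e h').symm.trans (hα e h))

end Counting

namespace LocalCourantAlgebroid

variable {m k : ℕ} {U : TopologicalSpace.Opens (Fin m → ℝ)} (D : LocalCourantAlgebroid m k U)

theorem brst_mem_of_wt {M : Type*} [AddCommMonoid M] {w : Gen m k → M}
    (h₁ : ∀ φ, w (.field φ) = 0) (h₂ : ∀ φ, w (.dfield φ) = 0) (φ : Fld m k) :
    D.brst φ ∈ HasWt w 0 := by
  have k1 : ∀ φ, (fld φ : LForm k U) ∈ HasWt w 0 := fun φ =>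
    h₁ φ ▸ gen_mem_hasWt w (fun _ => h₁ _) (.field φ)
  have k1' : ∀ φ, (gen (.dfield φ) : LForm k U) ∈ HasWt w 0 := fun φ =>
    h₂ φ ▸ gen_mem_hasWt w (fun _ => h₁ _) (.dfield φ)
  have k2 : ∀ φ χ, (fld φ * fld χ : LForm k U) ∈ HasWt w 0 := fun φ χ =>
    add_zero (0 : M) ▸ mul_mem_hasWt (k1 φ) (k1 χ)
  have k3 : ∀ φ χ υ, (fld φ * fld χ * fld υ : LForm k U) ∈ HasWt w 0 := fun φ χ υ =>
    add_zero (0 : M) ▸ mul_mem_hasWt (k2 φ χ) (k1 υ)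
  cases φ <;> simp only [brst]
  all_goals
    repeat' first
      | with_reducible_and_instances apply add_mem
      | with_reducible_and_instances apply sub_mem
      | with_reducible_and_instances apply neg_mem
      | (with_reducible_and_instances refine Submodule.sum_mem _ fun _ _ => ?_)
      | with_reducible_and_instances apply real_smul_mem
      | with_reducible_and_instances apply Submodule.smul_mem
      | with_reducible_and_instances apply k3
      | with_reducible_and_instances apply k2
      | with_reducible_and_instances apply k1
      | with_reducible_and_instances apply k1'

theorem antifieldPairing_mem {O : Fld m k → LForm k U} (h : ∀ φ, O φ ∈ HasWt antifieldWt 0)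
    (s : Species) : antifieldPairing O s ∈ HasWt antifieldWt (Pi.single s 1) := by
  refine Submodule.sum_mem _ fun φ _ => ?_
  split_ifs with hφ
  · have h1 := mul_mem_hasWt (gen_mem_hasWt (U := U) antifieldWt (fun _ => rfl) (.anti φ)) (h φ)
    rw [add_zero] at h1
    rw [← hφ]
    exact h1
  · exact zero_mem _

theorem multiplicity_eq_one {n : ℕ} {s : Species} {e : Mon m k} (h : coeffs (D.pairing n s) e ≠ 0)
    (h' : ∀ s', s' ≠ s → coeffs (D.pairing n s') e = 0) : D.multiplicity n e = 1 := by
  rw [multiplicity, Finset.card_eq_one]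
  refine ⟨s, ?_⟩
  ext s'
  simp only [Finset.mem_filter, Finset.mem_univ, true_and, Finset.mem_singleton]
  exact ⟨fun hs' => by_contra fun hne => hs' (h' s' hne), fun hs => hs ▸ h⟩

/-- On a form of fixed antifield content and fixed multiplicity the termwise factor is one number.
-/
theorem rescale_weight {n : ℕ} {s : Species} {α : LForm k U} {v : Species → ℕ}
    (hα : α ∈ HasWt antifieldWt v) {b f : ℕ} (hf : ∏ s, (v s).factorial = f)
    (hb : ∀ e, coeffs α e ≠ 0 → D.multiplicity n e = b) :
    rescale (fun e => ((s.gh + n).negOnePow : ℤ) /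
      ((antifieldFactorial e : ℝ) * (D.multiplicity n e : ℝ))) α
    = (((s.gh + n).negOnePow : ℤ) / ((f : ℝ) * b) : ℝ) • α :=
  rescale_eq_smul fun e he => by
    rw [antifieldFactorial_eq (hα e he), hf, hb e he]

theorem Species.sum_eq {M : Type*} [AddCommMonoid M] (h : Species → M) :
    ∑ s, h s = h .X + h .A + h .B + h .eps + h .psi + h .psit := by
  simp only [Finset.sum, Finset.univ, Fintype.elems]
  simp [add_assoc]

theorem Species.prod_eq (h : Species → ℕ) :
    ∏ s, h s = h .X * h .A * h .B * h .eps * h .psi * h .psit := by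
  simp only [Finset.prod, Finset.univ, Fintype.elems]
  simp [mul_assoc]

theorem pairing_one_mem (s : Species) : D.pairing 1 s ∈ HasWt antifieldWt (Pi.single s 1) :=
  antifieldPairing_mem (fun φ => by
    rw [O₁, s₀_fld]
    exact D.brst_mem_of_wt (fun _ => rfl) (fun _ => rfl) φ) s

/-- Each term contains a single antifield, whose species identifies the pairing it comes from, so
both factors are 1. -/
theorem weightedPairing_one (s : Species) :
    D.weightedPairing 1 s = (((s.gh + 1).negOnePow : ℤ) : ℝ) • D.pairing 1 s := by
  rw [weightedPairing, D.rescale_weight (D.pairing_one_mem s) (b := 1) (f := 1)]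
  · simp
  · rw [Species.prod_eq]
    cases s <;> simp
  · exact fun e he => D.multiplicity_eq_one he fun s' hs' =>
      coeffs_eq_zero_of_ne (D.pairing_one_mem s) (D.pairing_one_mem s')
        (fun h => hs' (by simpa [Pi.single_apply] using congrFun h s')) he

theorem τ_anti_mul (φ : Fld m k) {q : ℤ × ℤ} {x : LForm k U} (hx : x ∈ HasWt bideg q) :
    τ (anti φ * x) = (sgn ((-1 - φ.species.gh) * q.1) : SmoothFn U) • (aT φ * τ x) := by
  have h := τ_mul (gen_mem_bideg (U := U) (.anti φ)) hx
  simpa only [bideg, Gen.gh, aT] using h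

theorem antifieldPairing_X (O : Fld m k → LForm k U) :
    antifieldPairing O .X = ∑ μ, anti (.X μ) * O (.X μ) := by
  simp [antifieldPairing, Fld.sum_eq, Fld.species]

theorem antifieldPairing_A (O : Fld m k → LForm k U) :
    antifieldPairing O .A = ∑ μ, anti (.A μ) * O (.A μ) := by
  simp [antifieldPairing, Fld.sum_eq, Fld.species]

theorem antifieldPairing_B (O : Fld m k → LForm k U) :
    antifieldPairing O .B = ∑ μ, anti (.B μ) * O (.B μ) := by
  simp [antifieldPairing, Fld.sum_eq, Fld.species]

theorem antifieldPairing_eps (O : Fld m k → LForm k U) :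
    antifieldPairing O .eps = ∑ μ, anti (.eps μ) * O (.eps μ) := by
  simp [antifieldPairing, Fld.sum_eq, Fld.species]

theorem antifieldPairing_psi (O : Fld m k → LForm k U) :
    antifieldPairing O .psi = ∑ μ, anti (.psi μ) * O (.psi μ) := by
  simp [antifieldPairing, Fld.sum_eq, Fld.species]

theorem antifieldPairing_psit (O : Fld m k → LForm k U) :
    antifieldPairing O .psit = ∑ μ, anti (.psit μ) * O (.psit μ) := by
  simp [antifieldPairing, Fld.sum_eq, Fld.species]

theorem τ_sum_anti_mul_even {ι : Type*} [Fintype ι] (f : ι → Fld m k) {q : ℤ × ℤ}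
    {x : ι → LForm k U} (hx : ∀ i, x i ∈ HasWt bideg q)
    (h : ∀ i, Even ((-1 - (f i).species.gh) * q.1)) :
    τ (∑ i, anti (f i) * x i) = ct (fun i => aT (f i)) fun i => τ (x i) := by
  rw [map_sum]
  exact Finset.sum_congr rfl fun i _ => by rw [τ_anti_mul _ (hx i), sgn_of_even (h i), one_smul]

theorem τ_sum_anti_mul_odd {ι : Type*} [Fintype ι] (f : ι → Fld m k) {q : ℤ × ℤ}
    {x : ι → LForm k U} (hx : ∀ i, x i ∈ HasWt bideg q)
    (h : ∀ i, Odd ((-1 - (f i).species.gh) * q.1)) :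
    τ (∑ i, anti (f i) * x i) = -ct (fun i => aT (f i)) fun i => τ (x i) := by
  rw [map_sum, ct, ← Finset.sum_neg_distrib]
  refine Finset.sum_congr rfl fun i _ => ?_
  rw [τ_anti_mul _ (hx i), sgn_of_odd (h i)]
  exact neg_one_smul (SmoothFn U) _

/-- Besides (-1)^(gh φ + 1) there is the sign of passing to ⊙, which is nontrivial only for A: its
antifield has ghost number -1 and its variation has form degree one. -/
theorem sum_weightedPairing_one : τ (∑ s, D.weightedPairing 1 s)
    = -(ct (fun μ => aT (.X μ)) fun μ => τ (D.brst (.X μ)))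
      + (ct (fun a => aT (.A a)) fun a => τ (D.brst (.A a)))
      - (ct (fun μ => aT (.B μ)) fun μ => τ (D.brst (.B μ)))
      + (ct (fun a => aT (.eps a)) fun a => τ (D.brst (.eps a)))
      + (ct (fun μ => aT (.psi μ)) fun μ => τ (D.brst (.psi μ)))
      - (ct (fun μ => aT (.psit μ)) fun μ => τ (D.brst (.psit μ))) := by
  have hs : ∑ s, D.weightedPairing 1 s = D.weightedPairing 1 .X + D.weightedPairing 1 .A
      + D.weightedPairing 1 .B + D.weightedPairing 1 .eps + D.weightedPairing 1 .psi
      + D.weightedPairing 1 .psit := by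
    exact Species.sum_eq _
  have hO : D.O₁ = D.brst := funext fun φ => D.s₀_fld φ
  have eX : τ (D.pairing 1 .X) = ct (fun μ => aT (.X μ)) fun μ => τ (D.brst (.X μ)) := by
    rw [pairing, antifieldPairing_X, hO, τ_sum_anti_mul_even (q := (0, 1)) _
      (fun μ => D.brst_mem_bideg (.X μ)) fun _ => (by exact (by decide : Even ((-1 - 0) * 0 : ℤ)))]
  have eA : τ (D.pairing 1 .A) = -ct (fun μ => aT (.A μ)) fun μ => τ (D.brst (.A μ)) := by
    rw [pairing, antifieldPairing_A, hO, τ_sum_anti_mul_odd (q := (1, 1)) _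
      (fun μ => D.brst_mem_bideg (.A μ)) fun _ => (by exact (by decide : Odd ((-1 - 0) * 1 : ℤ)))]
  have eB : τ (D.pairing 1 .B) = ct (fun μ => aT (.B μ)) fun μ => τ (D.brst (.B μ)) := by
    rw [pairing, antifieldPairing_B, hO, τ_sum_anti_mul_even (q := (2, 1)) _
      (fun μ => D.brst_mem_bideg (.B μ)) fun _ => (by exact (by decide : Even ((-1 - 0) * 2 : ℤ)))]
  have eE : τ (D.pairing 1 .eps) = ct (fun μ => aT (.eps μ)) fun μ => τ (D.brst (.eps μ)) := by
    rw [pairing, antifieldPairing_eps, hO, τ_sum_anti_mul_even (q := (0, 2)) _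
      (fun μ => D.brst_mem_bideg (.eps μ)) fun _ => (by exact (by decide : Even ((-1 - 1) * 0 : ℤ)))]
  have eP : τ (D.pairing 1 .psi) = ct (fun μ => aT (.psi μ)) fun μ => τ (D.brst (.psi μ)) := by
    rw [pairing, antifieldPairing_psi, hO, τ_sum_anti_mul_even (q := (1, 2)) _
      (fun μ => D.brst_mem_bideg (.psi μ)) fun _ => (by exact (by decide : Even ((-1 - 1) * 1 : ℤ)))]
  have eT : τ (D.pairing 1 .psit) = ct (fun μ => aT (.psit μ)) fun μ => τ (D.brst (.psit μ)) := by
    rw [pairing, antifieldPairing_psit, hO, τ_sum_anti_mul_even (q := (0, 3)) _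
      (fun μ => D.brst_mem_bideg (.psit μ)) fun _ => (by exact (by decide : Even ((-1 - 2) * 0 : ℤ)))]
  have n1 : (((0 + 1 : ℤ).negOnePow : ℤ) : ℝ) = -1 := by simp
  have n2 : (((1 + 1 : ℤ).negOnePow : ℤ) : ℝ) = 1 := by
    rw [Int.negOnePow_even _ (by decide)]; simp
  have n3 : (((2 + 1 : ℤ).negOnePow : ℤ) : ℝ) = -1 := by
    rw [Int.negOnePow_odd _ (by decide)]; simp
  rw [hs]
  simp only [weightedPairing_one, Species.gh, n1, n2, n3, map_add, τ_real_smul, eX, eA, eB, eE,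
    eP, eT]
  module

end LocalCourantAlgebroid

/-! ### The second- and third-order terms -/

section Quadratic

variable {m k : ℕ} {U : TopologicalSpace.Opens (Fin m → ℝ)}

theorem quadGhost_raise (N : Matrix (Fin k) (Fin k) ℝ) (r : Fin k → Fin m → SmoothFn U)
    (c : Fin k → Fin k → Fin k → SmoothFn U) (a : Fin k) :
    quadGhost (fun μ => raise N (fun b => r b μ) a) (fun d e => raise N (fun b => c b d e) a)
      = ∑ b, N a b • quadGhost (r b) (c b) := by
  simp only [quadGhost, raise, Finset.sum_smul, smul_add, Finset.sum_add_distrib, ← sum_ct,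
    smul_assoc, ct_smul_right (S := ℝ), Finset.smul_sum, smul_smul, mul_comm]

end Quadratic

namespace LocalCourantAlgebroid

variable {m k : ℕ} {U : TopologicalSpace.Opens (Fin m → ℝ)} (D : LocalCourantAlgebroid m k U)

local notation "B†" => fun l => aT (Fld.B l)

/-- The symmetric inverse metric is moved from the cofactor onto the antifield. -/
theorem ct_antiA_sum (Φ : Fin k → Tot k U) :
    (ct (fun a => aT (.A a)) fun a => ∑ b, D.η⁻¹ a b • Φ b) = ct D.aup Φ := by
  simp only [ct, aup, Finset.mul_sum, Finset.sum_mul, mul_smul_comm, smul_mul_assoc]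
  rw [Finset.sum_comm]
  simp only [D.η_inv_symm]

/-- The terms of the master action that contain one antifield of `A` and one of `B`. -/
def actionAB : Tot k U := ct B† fun l => ct D.aup fun a =>
  quadGhost (fun ν => pd l (D.ρ a ν)) fun b c => pd l (D.C a b c)

/-- The terms that contain two antifields of `B`. -/
def actionBB : Tot k U := ct B† fun μ => ct B† fun l =>
  cubicGhost₁ (fun a ν => pd l (pd μ (D.ρ a ν))) fun a b c => pd l (pd μ (D.C a b c))

/-- The terms that contain an antifield of `ψ` and one of `B`. -/
def actionPsiB : Tot k U := ct (fun μ => aT (.psi μ)) fun μ => ct B† fun l =>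
  cubicGhost (fun a ν => pd l (pd μ (D.ρ a ν))) fun a b c => pd l (pd μ (D.C a b c))

/-- The terms that contain three antifields of `B`. -/
def actionBBB : Tot k U := ct B† fun μ => ct B† fun κ => ct B† fun l =>
  cubicGhost (fun a ν => pd κ (pd l (pd μ (D.ρ a ν)))) fun a b c => pd κ (pd l (pd μ (D.C a b c)))

theorem aT_mem_antifieldWt (φ : Fld m k) :
    (aT φ : Tot k U) ∈ TWt antifieldWt (Pi.single φ.species 1) := τ_gen_mem_wt (fun _ => rfl) rfl

theorem antiB_mem_antifieldWt (l : Fin m) :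
    (aT (.B l) : Tot k U) ∈ TWt antifieldWt (Pi.single .B 1) := aT_mem_antifieldWt _

theorem quadGhost_antifieldWt (r : Fin m → SmoothFn U) (c : Fin k → Fin k → SmoothFn U) :
    quadGhost r c ∈ TWt antifieldWt 0 :=
  quadGhost_mem (fun _ => rfl) (p := 0) (fun _ => rfl) (fun _ => rfl) rfl r c

theorem cubicGhost_antifieldWt (r : Fin k → Fin m → SmoothFn U)
    (c : Fin k → Fin k → Fin k → SmoothFn U) : cubicGhost r c ∈ TWt antifieldWt 0 :=
  cubicGhost_mem (fun _ => rfl) (p := 0) (q := 0) (fun _ => rfl) (fun _ => rfl) rfl rfl r c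

theorem cubicGhost₁_antifieldWt (r : Fin k → Fin m → SmoothFn U)
    (c : Fin k → Fin k → Fin k → SmoothFn U) : cubicGhost₁ r c ∈ TWt antifieldWt 0 :=
  cubicGhost₁_mem (fun _ => rfl) (p := 0) (q := 0) (p' := 0) (q' := 0)
    (fun _ => rfl) (fun _ => rfl) (fun _ => rfl) (fun _ => rfl) rfl rfl rfl r c

theorem aup_mem_antifieldWt (a : Fin k) : D.aup a ∈ TWt antifieldWt (Pi.single .A 1) :=
  Submodule.sum_mem _ fun b _ => real_smul_mem_tWt _ (aT_mem_antifieldWt (.A b))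

theorem actionAB_mem : D.actionAB ∈ TWt antifieldWt (Pi.single .B 1 + Pi.single .A 1) :=
  ct_mem_tWt antiB_mem_antifieldWt
    (fun _ => ct_mem_tWt D.aup_mem_antifieldWt (fun _ => quadGhost_antifieldWt _ _) (add_zero _)) rfl

theorem actionBB_mem : D.actionBB ∈ TWt antifieldWt (Pi.single .B 1 + Pi.single .B 1) :=
  ct_mem_tWt antiB_mem_antifieldWt (fun _ => ct_mem_tWt antiB_mem_antifieldWt
    (fun _ => cubicGhost₁_antifieldWt _ _) (add_zero _)) rfl

theorem actionPsiB_mem : D.actionPsiB ∈ TWt antifieldWt (Pi.single .psi 1 + Pi.single .B 1) :=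
  ct_mem_tWt (fun l => aT_mem_antifieldWt (.psi l)) (fun _ => ct_mem_tWt antiB_mem_antifieldWt
    (fun _ => cubicGhost_antifieldWt _ _) (add_zero _)) rfl

theorem actionBBB_mem : D.actionBBB
    ∈ TWt antifieldWt (Pi.single .B 1 + (Pi.single .B 1 + Pi.single .B 1)) :=
  ct_mem_tWt antiB_mem_antifieldWt (fun _ => ct_mem_tWt antiB_mem_antifieldWt
    (fun _ => ct_mem_tWt antiB_mem_antifieldWt
      (fun _ => cubicGhost_antifieldWt _ _) (add_zero _)) rfl) rfl

theorem pairing_two_X : D.pairing 2 .X = 0 := by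
  simp [pairing, antifieldPairing_X, O₂_X]

theorem pairing_two_eps : D.pairing 2 .eps = 0 := by
  simp [pairing, antifieldPairing_eps, O₂_eps]

theorem pairing_two_psit : D.pairing 2 .psit = 0 := by
  simp [pairing, antifieldPairing_psit, O₂_psit]

theorem antiB_mul_comm (l : Fin m) (x : Tot k U) : aT (.B l) * x = x * aT (.B l) :=
  even_mul_comm (antiB_even l) x

/-- The metric is constant, so the raised index of the differentiated structure functions can be
shifted to A†. The result is the same expression that G contributes to the pairing of B. -/
theorem pairing_two_A : τ (D.pairing 2 .A) = D.actionAB := by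
  rw [pairing, antifieldPairing_A, τ_sum_anti_mul_odd (q := (1, 1)) _ D.O₂_A_mem
    fun _ => (by exact (by decide : Odd ((-1 - 0) * 1 : ℤ)))]
  simp only [τ_O₂_A, ct_neg_right, neg_neg, Cup_eq, ρup_eq, map_raise]
  simp only [quadGhost_raise, actionAB]
  rw [ct_comm fun l a => antiB_mul_comm l (D.aup a), ← D.ct_antiA_sum]
  simp only [← sum_ct, ct_smul_right (S := ℝ)]

theorem pairing_two_B : τ (D.pairing 2 .B) = D.actionAB + D.actionBB := by
  rw [pairing, antifieldPairing_B, τ_sum_anti_mul_even (q := (2, 1)) _ D.O₂_B_mem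
    fun _ => (by exact (by decide : Even ((-1 - 0) * 2 : ℤ)))]
  simp only [τ_O₂_B, ct_add_right]
  exact add_comm _ _

theorem pairing_two_psi : τ (D.pairing 2 .psi) = -D.actionPsiB := by
  rw [pairing, antifieldPairing_psi, τ_sum_anti_mul_even (q := (1, 2)) _ D.O₂_psi_mem
    fun _ => (by exact (by decide : Even ((-1 - 1) * 1 : ℤ)))]
  simp only [τ_O₂_psi, ct_neg_right]
  rfl

theorem coeffs_pairing_two_A : D.pairing 2 .A = τ.symm D.actionAB := by
  rw [← pairing_two_A, LinearEquiv.symm_apply_apply]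

theorem coeffs_pairing_two_B : D.pairing 2 .B = τ.symm D.actionAB + τ.symm D.actionBB := by
  rw [← map_add, ← pairing_two_B, LinearEquiv.symm_apply_apply]

theorem coeffs_pairing_two_psi : D.pairing 2 .psi = -τ.symm D.actionPsiB := by
  rw [← map_neg, ← pairing_two_psi, LinearEquiv.symm_apply_apply]

theorem coeffs_neg_ne_zero {α : LForm k U} {e : Mon m k} :
    coeffs (-α) e ≠ 0 ↔ coeffs α e ≠ 0 := by
  rw [map_neg, Finsupp.neg_apply]
  exact neg_ne_zero

theorem antifieldWt_ne₁ : (Pi.single .B 1 + Pi.single .B 1 : Species → ℕ)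
    ≠ Pi.single .B 1 + Pi.single .A 1 := fun h => by
  simpa using congrFun h Species.A

theorem antifieldWt_ne₂ : (Pi.single .psi 1 + Pi.single .B 1 : Species → ℕ)
    ≠ Pi.single .B 1 + Pi.single .A 1 := fun h => by
  simpa using congrFun h Species.A

theorem antifieldWt_ne₃ : (Pi.single .psi 1 + Pi.single .B 1 : Species → ℕ)
    ≠ Pi.single .B 1 + Pi.single .B 1 := fun h => by
  simpa using congrFun h Species.psi

/-- These terms occur for A and for B. The other terms in the pairings of B and ψ have different
antifield content and cannot cancel them. -/
theorem multiplicity_actionAB {e : Mon m k} (h : coeffs (τ.symm D.actionAB) e ≠ 0) :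
    D.multiplicity 2 e = 2 := by
  have h₁ := coeffs_eq_zero_of_ne (τ_symm_mem.2 D.actionAB_mem) (τ_symm_mem.2 D.actionBB_mem)
    antifieldWt_ne₁ h
  have h₂ := coeffs_eq_zero_of_ne (τ_symm_mem.2 D.actionAB_mem) (τ_symm_mem.2 D.actionPsiB_mem)
    antifieldWt_ne₂ h
  classical
  rw [multiplicity, Finset.card_eq_two]
  refine ⟨.A, .B, by decide, ?_⟩
  ext s
  rw [Finset.mem_filter]
  cases s
  · simp [pairing_two_X]
  · simp [coeffs_pairing_two_A, h]
  · simp [coeffs_pairing_two_B, h, h₁]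
  · simp [pairing_two_eps]
  · simp [coeffs_pairing_two_psi, h₂]
  · simp [pairing_two_psit]

theorem multiplicity_actionBB {e : Mon m k} (h : coeffs (τ.symm D.actionBB) e ≠ 0) :
    D.multiplicity 2 e = 1 := by
  have h₁ := coeffs_eq_zero_of_ne (τ_symm_mem.2 D.actionBB_mem) (τ_symm_mem.2 D.actionAB_mem)
    antifieldWt_ne₁.symm h
  have h₂ := coeffs_eq_zero_of_ne (τ_symm_mem.2 D.actionBB_mem) (τ_symm_mem.2 D.actionPsiB_mem)
    antifieldWt_ne₃ h
  refine D.multiplicity_eq_one (s := .B) (by simp [coeffs_pairing_two_B, h₁, h]) fun s hs => ?_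
  cases s
  · simp [pairing_two_X]
  · simp [coeffs_pairing_two_A, h₁]
  · exact absurd rfl hs
  · simp [pairing_two_eps]
  · simp [coeffs_pairing_two_psi, h₂]
  · simp [pairing_two_psit]

theorem multiplicity_actionPsiB {e : Mon m k} (h : coeffs (τ.symm D.actionPsiB) e ≠ 0) :
    D.multiplicity 2 e = 1 := by
  have h₁ := coeffs_eq_zero_of_ne (τ_symm_mem.2 D.actionPsiB_mem) (τ_symm_mem.2 D.actionAB_mem)
    antifieldWt_ne₂.symm h
  have h₂ := coeffs_eq_zero_of_ne (τ_symm_mem.2 D.actionPsiB_mem) (τ_symm_mem.2 D.actionBB_mem)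
    antifieldWt_ne₃.symm h
  refine D.multiplicity_eq_one (s := .psi) (by simp [coeffs_pairing_two_psi, h]) fun s hs => ?_
  cases s
  · simp [pairing_two_X]
  · simp [coeffs_pairing_two_A, h₁]
  · simp [coeffs_pairing_two_B, h₁, h₂]
  · simp [pairing_two_eps]
  · exact absurd rfl hs
  · simp [pairing_two_psit]

/-- The A†B† term is recovered from two halves with β = 2; the ½ in front of B†B† is 1/2!; for ψ the
sign (-1)^(1+2) cancels the minus of `pairing_two_psi`. -/
theorem sum_weightedPairing_two : τ (∑ s, D.weightedPairing 2 s)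
    = D.actionAB + (1 / 2 : ℝ) • D.actionBB + D.actionPsiB := by
  have n0 : (((0 + (2 : ℕ) : ℤ).negOnePow : ℤ) : ℝ) = 1 := by
    rw [Int.negOnePow_even _ (by decide)]; simp
  have n1 : (((1 + (2 : ℕ) : ℤ).negOnePow : ℤ) : ℝ) = -1 := by
    rw [Int.negOnePow_odd _ (by decide)]; simp
  have eA : τ (D.weightedPairing 2 .A) = (1 / 2 : ℝ) • D.actionAB := by
    rw [weightedPairing, coeffs_pairing_two_A, D.rescale_weight (τ_symm_mem.2 D.actionAB_mem)
      (b := 2) (f := 1) (by simp [Species.prod_eq]) fun _ => D.multiplicity_actionAB, τ_real_smul,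
      LinearEquiv.apply_symm_apply]
    simp only [Species.gh, n0]
    norm_num
  have eB : τ (D.weightedPairing 2 .B) = (1 / 2 : ℝ) • D.actionAB + (1 / 2 : ℝ) • D.actionBB := by
    rw [weightedPairing, coeffs_pairing_two_B, map_add,
      D.rescale_weight (τ_symm_mem.2 D.actionAB_mem)
      (b := 2) (f := 1) (by simp [Species.prod_eq]) fun _ => D.multiplicity_actionAB,
      D.rescale_weight (τ_symm_mem.2 D.actionBB_mem)
      (b := 1) (f := 2) (by simp [Species.prod_eq]) fun _ => D.multiplicity_actionBB, map_add,
      τ_real_smul, τ_real_smul, LinearEquiv.apply_symm_apply, LinearEquiv.apply_symm_apply]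
    simp only [Species.gh, n0]
    norm_num
  have eP : τ (D.weightedPairing 2 .psi) = D.actionPsiB := by
    rw [weightedPairing, coeffs_pairing_two_psi, map_neg,
      D.rescale_weight (τ_symm_mem.2 D.actionPsiB_mem)
      (b := 1) (f := 1) (by simp [Species.prod_eq]) fun _ => D.multiplicity_actionPsiB, map_neg,
      τ_real_smul, LinearEquiv.apply_symm_apply]
    simp only [Species.gh, n1]
    norm_num
  have eX : D.weightedPairing 2 .X = 0 := by rw [weightedPairing, pairing_two_X, map_zero]
  have eE : D.weightedPairing 2 .eps = 0 := by rw [weightedPairing, pairing_two_eps, map_zero]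
  have eT : D.weightedPairing 2 .psit = 0 := by rw [weightedPairing, pairing_two_psit, map_zero]
  rw [Species.sum_eq, eX, eE, eT]
  simp only [map_add, map_zero, eA, eB, eP]
  module

theorem part_gh {q : ℤ × ℤ} {α : LForm k U} (hα : α ∈ HasWt bideg q) :
    part (fun e => e.gh = 0) α = if q.2 = 0 then α else 0 := by
  have h : ∀ e, coeffs α e ≠ 0 → e.gh = q.2 := fun e he => by rw [← hα e he, wt_bideg]
  split_ifs with hq
  · exact part_eq_self fun e he => (h e he).trans hq
  · exact part_eq_zero fun e he h' => hq ((h e he).symm.trans h')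

theorem pairing_three_eq_zero (s : Species) (hs : s ≠ .B) : D.pairing 3 s = 0 := by
  rw [pairing]
  cases s
  · simp [antifieldPairing_X, D.O₃_eq_zero (D.O₂_X _)]
  · rw [antifieldPairing_A, map_sum]
    refine Finset.sum_eq_zero fun a _ => ?_
    have h : anti (.A a) * D.O₃ (.A a) ∈ HasWt bideg ((2, -1) + (1, 2)) :=
      mul_mem_hasWt (gen_mem_bideg (.anti (.A a))) (D.O₃_A_mem a)
    rw [part_gh h, if_neg (by decide)]
  · exact absurd rfl hs
  · simp [antifieldPairing_eps, D.O₃_eq_zero (D.O₂_eps _)]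
  · rw [antifieldPairing_psi, map_sum]
    refine Finset.sum_eq_zero fun a _ => ?_
    have h : anti (.psi a) * D.O₃ (.psi a) ∈ HasWt bideg ((2, -2) + (1, 3)) :=
      mul_mem_hasWt (gen_mem_bideg (.anti (.psi a))) (D.O₃_psi_mem a)
    rw [part_gh h, if_neg (by decide)]
  · simp [antifieldPairing_psit, D.O₃_eq_zero (D.O₂_psit _)]

/-- The projection to ghost number zero keeps the terms with three B† and discards N, which has
ghost number one after pairing. -/
theorem pairing_three_B : D.pairing 3 .B = -τ.symm D.actionBBB := by
  choose N hN h using D.τ_O₃_B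
  set P : Fin m → Tot k U := fun μ => ct B† fun κ => ct B† fun l =>
    cubicGhost (fun a ν => pd κ (pd l (pd μ (D.ρ a ν))))
      fun a b c => pd κ (pd l (pd μ (D.C a b c))) with hP
  have hPm : ∀ μ, P μ ∈ TWt bideg (2, 1) := fun μ =>
    ct_mem_tWt (n := (1, -1)) (n' := (1, 2)) antiB_mem (fun l =>
      ct_mem_tWt (n := (1, -1)) (n' := (0, 3)) antiB_mem
      (fun l => cubicGhost_bideg _ _) rfl) rfl
  have hZ : ct B† P = D.actionBBB := rfl
  have h' : ∀ μ, τ (D.O₃ (.B μ)) = -P μ + N μ := h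
  clear_value P
  have e : ∀ μ, D.O₃ (.B μ) = -τ.symm (P μ) + τ.symm (N μ) := fun μ => by
    rw [← map_neg, ← map_add, ← h', LinearEquiv.symm_apply_apply]
  have h1 : ∀ μ, anti (.B μ) * τ.symm (P μ) ∈ HasWt bideg ((1, -1) + (2, 1)) := fun μ =>
    mul_mem_hasWt (gen_mem_bideg (.anti (.B μ))) (τ_symm_mem.2 (hPm μ))
  have h2 : ∀ μ, anti (.B μ) * τ.symm (N μ) ∈ HasWt bideg ((1, -1) + (2, 2)) := fun μ =>
    mul_mem_hasWt (gen_mem_bideg (.anti (.B μ))) (τ_symm_mem.2 (hN μ))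
  have h3 : D.pairing 3 .B = -∑ μ, anti (.B μ) * τ.symm (P μ) := by
    rw [pairing, antifieldPairing_B, map_sum, ← Finset.sum_neg_distrib]
    refine Finset.sum_congr rfl fun μ _ => ?_
    rw [e, mul_add, mul_neg, map_add, map_neg, part_gh (h1 μ), part_gh (h2 μ), if_pos (by decide),
      if_neg (by decide), add_zero]
  have h4 := τ_sum_anti_mul_even (fun μ => Fld.B μ) (q := (2, 1)) (fun μ => τ_symm_mem.2 (hPm μ))
    fun _ => (by exact (by decide : Even ((-1 - 0) * 2 : ℤ)))
  simp only [LinearEquiv.apply_symm_apply, hZ] at h4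
  rw [h3, ← h4, LinearEquiv.symm_apply_apply]

theorem sum_weightedPairing_three :
    τ (∑ s, D.weightedPairing 3 s) = (1 / 6 : ℝ) • D.actionBBB := by
  have n0 : (((0 + (3 : ℕ) : ℤ).negOnePow : ℤ) : ℝ) = -1 := by
    rw [Int.negOnePow_odd _ (by decide)]; simp
  have hm : ∀ e, coeffs (τ.symm D.actionBBB) e ≠ 0 → D.multiplicity 3 e = 1 := fun e he =>
    D.multiplicity_eq_one (s := .B) (by rw [pairing_three_B]; exact coeffs_neg_ne_zero.2 he)
      fun s hs => by rw [D.pairing_three_eq_zero s hs]; simp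
  rw [Finset.sum_eq_single .B, weightedPairing, pairing_three_B, map_neg,
    D.rescale_weight (τ_symm_mem.2 D.actionBBB_mem) (b := 1) (f := 6) _ hm, map_neg, τ_real_smul,
    LinearEquiv.apply_symm_apply]
  · simp only [Species.gh, n0]
    rw [← neg_smul]
    norm_num
  -- Three antifields of B give β_†! = 3! = 6.
  · rw [Species.prod_eq]; simp [Nat.factorial]
  · exact fun s _ hs => by rw [weightedPairing, D.pairing_three_eq_zero s hs, map_zero]
  · simp

end LocalCourantAlgebroid
-- Expansion of the superfield action
namespace LocalCourantAlgebroid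

variable {m k : ℕ} {U : TopologicalSpace.Opens (Fin m → ℝ)} (D : LocalCourantAlgebroid m k U)

local notation "εT" => fun a => fT (Fld.eps a)
local notation "AT" => fun a => fT (Fld.A a)
local notation "BT" => fun a => fT (Fld.B a)
local notation "ψT" => fun a => fT (Fld.psi a)
local notation "ψtT" => fun a => fT (Fld.psit a)
local notation "B†" => fun l => aT (Fld.B l)
local notation "ψ†" => fun l => aT (Fld.psi l)
local notation "ψt†" => fun l => aT (Fld.psit l)

/-- `-X†_μ` in the totally graded algebra. -/
def negAntiX (μ : Fin m) : Tot k U := -aT (.X μ)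

/-- `-η^{ab} ε†_b` in the totally graded algebra. -/
def epsup (a : Fin k) : Tot k U := -∑ b, D.η⁻¹ a b • aT (.eps b)

/-- The nilpotent part of the superfield of degree zero in the totally graded algebra. -/
def bfN (μ : Fin m) : Tot k U := aT (.B μ) + aT (.psi μ) + aT (.psit μ)

/-- The superfield of degree one in the totally graded algebra. -/
def bfA (a : Fin k) : Tot k U := fT (.eps a) + fT (.A a) + D.aup a + D.epsup a

/-- The superfield of degree two in the totally graded algebra. -/
def bfB (μ : Fin m) : Tot k U := fT (.psit μ) + fT (.psi μ) + fT (.B μ) + negAntiX μ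

theorem bfN_eq : (bfN : Fin m → Tot k U)
    = fun μ => aT (.B μ) + aT (.psi μ) + aT (.psit μ) := rfl

theorem bfA_eq : D.bfA = fun a => fT (.eps a) + fT (.A a) + D.aup a + D.epsup a := rfl

theorem bfB_eq : (bfB : Fin m → Tot k U)
    = fun μ => fT (.psit μ) + fT (.psi μ) + fT (.B μ) + negAntiX μ := rfl

theorem antiPsi_even (μ : Fin m) : (aT (.psi μ) : Tot k U) ∈ TPar 0 :=
  tPar_of_bideg (aT_mem _) (by exact (by decide : ((3 - 1 + (-1 - 1) : ℤ) : ZMod 2) = 0))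

theorem antiPsit_even (μ : Fin m) : (aT (.psit μ) : Tot k U) ∈ TPar 0 :=
  tPar_of_bideg (aT_mem _) (by exact (by decide : ((3 - 0 + (-1 - 2) : ℤ) : ZMod 2) = 0))

theorem bfN_even (μ : Fin m) : (bfN μ : Tot k U) ∈ TPar 0 :=
  add_mem (add_mem (antiB_even μ) (antiPsi_even μ)) (antiPsit_even μ)

theorem negAntiX_mem (μ : Fin m) : (negAntiX μ : Tot k U) ∈ TWt bideg (3, -1) :=
  neg_mem (antiX_mem μ)

theorem epsup_mem (a : Fin k) : D.epsup a ∈ TWt bideg (3, -2) :=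
  neg_mem (Submodule.sum_mem _ fun b _ => real_smul_mem_tWt _ (antiEps_mem b))

theorem epsup_odd (a : Fin k) : D.epsup a ∈ TPar 1 :=
  tPar_of_bideg (D.epsup_mem a) (by exact (by decide : ((3 + -2 : ℤ) : ZMod 2) = 1))

theorem τ_superXNil (μ : Fin m) : τ (superXNil μ : LForm k U) = bfN μ := by
  simp only [superXNil, map_add]; rfl

theorem τ_superX (μ : Fin m) : τ (superX μ : LForm k U) = fT (.X μ) + bfN μ := by
  rw [superX, map_add, τ_superXNil]; rfl

theorem τ_superA (a : Fin k) : τ (D.superA a) = D.bfA a := by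
  simp only [superA, map_add, map_sum, τ_real_smul, sub_eq_add_neg]; rfl

theorem τ_superB (μ : Fin m) : τ (superB μ : LForm k U) = bfB μ := by
  simp only [superB, map_add, sub_eq_add_neg]; rfl

theorem τ_fn (f : SmoothFn U) : τ (fn f : LForm k U) = f • 1 := (smul_one_eq f).symm

theorem τ_superFn (f : SmoothFn U) : τ (superFn f : LForm k U) = f • 1
    + (ct bfN fun μ => pd μ f • 1)
    + (1 / 2 : ℝ) • (ct bfN fun μ => ct bfN fun ν => pd μ (pd ν f) • 1)
    + (1 / 6 : ℝ) • (ct bfN fun μ => ct bfN fun ν => ct bfN fun l => pd μ (pd ν (pd l f)) • 1) := by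
  rw [ct_smul_one_eq, ct_ct_smul_one_eq, ct_ct_ct_smul_one_eq]
  simp only [superFn, map_add, map_sum, τ_real_smul, τ_superMul, τ_superXNil, τ_fn, smul_mul_assoc,
    one_mul]

theorem smul_one_even (f : SmoothFn U) : (f • 1 : Tot k U) ∈ TPar 0 :=
  Submodule.smul_mem _ _ (one_mem_tWt _)

theorem τ_superFn_even (f : SmoothFn U) : τ (superFn f : LForm k U) ∈ TPar 0 := by
  have h1 : ∀ {Φ : Fin m → Tot k U}, (∀ μ, Φ μ ∈ TPar 0) → ct bfN Φ ∈ TPar 0 := fun h =>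
    ct_mem_tWt bfN_even h rfl
  rw [τ_superFn]
  exact add_mem (add_mem (add_mem (smul_one_even f) (h1 fun _ => smul_one_even _))
    (real_smul_mem_tWt _ (h1 fun _ => h1 fun _ => smul_one_even _)))
    (real_smul_mem_tWt _ (h1 fun _ => h1 fun _ => h1 fun _ => smul_one_even _))

/-- `r_a^μ 𝐁_μ 𝐀^a + ⅙ c_{abc} 𝐀^a 𝐀^b 𝐀^c` with coefficients that are not expanded. -/
def cubicSuper (r : Fin k → Fin m → SmoothFn U) (c : Fin k → Fin k → Fin k → SmoothFn U) :
    Tot k U :=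
  (ct bfB fun μ => ct D.bfA fun a => r a μ • 1) + (1 / 6 : ℝ) • tri c D.bfA D.bfA D.bfA

/-- The interaction terms of the superfield action. -/
theorem τ_interaction : τ (∑ a, ∑ μ, superMul (superMul (superFn (D.ρ a μ)) (superB μ)) (D.superA a)
    + (1 / 6 : ℝ) • ∑ a, ∑ b, ∑ c,
        superMul (superMul (superMul (superFn (D.C a b c)) (D.superA a)) (D.superA b))
          (D.superA c))
    = D.cubicSuper D.ρ D.C
      + (ct bfN fun l => D.cubicSuper (fun a μ => pd l (D.ρ a μ)) fun a b c => pd l (D.C a b c))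
      + (1 / 2 : ℝ) • (ct bfN fun l => ct bfN fun κ => D.cubicSuper
          (fun a μ => pd l (pd κ (D.ρ a μ))) fun a b c => pd l (pd κ (D.C a b c)))
      + (1 / 6 : ℝ) • (ct bfN fun l => ct bfN fun κ => ct bfN fun i => D.cubicSuper
          (fun a μ => pd l (pd κ (pd i (D.ρ a μ)))) fun a b c => pd l (pd κ (pd i (D.C a b c)))) := by
  -- Functions of 𝐗 are even, so they can be moved behind 𝐁 and 𝐀; the Taylor expansion then takes
  -- place innermost.
  have e1 : ∀ (f : SmoothFn U) (x y : Tot k U),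
      τ (superFn f) * x * y = x * (y * τ (superFn f)) := fun f x y => by
    rw [mul_assoc, even_mul_comm (τ_superFn_even f), mul_assoc]
  have e2 : ∀ (f : SmoothFn U) (x y z : Tot k U),
      x * (y * τ (superFn f)) * z = x * (y * (z * τ (superFn f))) := fun f x y z => by
    rw [mul_assoc, mul_assoc, even_mul_comm (τ_superFn_even f) z]
  have h1 : ∑ a, ∑ μ, bfB μ * (D.bfA a * τ (superFn (D.ρ a μ)))
      = ct bfB fun μ => ct D.bfA fun a => τ (superFn (D.ρ a μ)) := by
    rw [Finset.sum_comm]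
    simp only [ct, Finset.mul_sum]
  have h2 : ∑ a, ∑ b, ∑ c, D.bfA a * (D.bfA b * (D.bfA c * τ (superFn (D.C a b c))))
      = ct D.bfA fun a => ct D.bfA fun b => ct D.bfA fun c => τ (superFn (D.C a b c)) := by
    simp only [ct, Finset.mul_sum]
  simp only [map_add, map_sum, τ_real_smul, τ_superMul, τ_superA, τ_superB, e1, e2]
  rw [h1, h2]
  -- The nilpotent part of 𝐗 is even as well and is pulled to the front, so each Taylor order is a
  -- contraction with a derivative of Θ.
  have cB : ∀ (i j : Fin m), (bfB i * bfN j : Tot k U) = bfN j * bfB i := fun i j =>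
    (even_mul_comm (bfN_even j) _).symm
  have cA : ∀ (i : Fin k) (j : Fin m), (D.bfA i * bfN j : Tot k U) = bfN j * D.bfA i := fun i j =>
    (even_mul_comm (bfN_even j) _).symm
  simp only [τ_superFn, cubicSuper, tri, ct_add_right, ct_smul_right (S := ℝ), ct_comm cA, ct_comm cB]
  module

theorem gr_ct_aup (Φ : Fin k → Tot k U) (n : ℤ) :
    gr n (ct D.aup Φ) = ct D.aup fun i => gr (n - 2) (Φ i) := gr_ct_of_bideg D.aup_mem Φ n

theorem gr_ct_epsup (Φ : Fin k → Tot k U) (n : ℤ) :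
    gr n (ct D.epsup Φ) = ct D.epsup fun i => gr (n - 3) (Φ i) := gr_ct_of_bideg D.epsup_mem Φ n

theorem gr_ct_negAntiX (Φ : Fin m → Tot k U) (n : ℤ) :
    gr n (ct negAntiX Φ) = ct negAntiX fun i => gr (n - 3) (Φ i) := gr_ct_of_bideg negAntiX_mem Φ n

theorem gr_ct_antiB (Φ : Fin m → Tot k U) (n : ℤ) :
    gr n (ct B† Φ) = ct B† fun i => gr (n - 1) (Φ i) :=
  gr_ct_of_bideg (p := (1, -1)) antiB_mem Φ n

theorem gr_ct_antiPsi (Φ : Fin m → Tot k U) (n : ℤ) :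
    gr n (ct ψ† Φ) = ct ψ† fun i => gr (n - 2) (Φ i) :=
  gr_ct_of_bideg (p := (2, -2)) antiPsi_mem Φ n

theorem gr_ct_antiPsit (Φ : Fin m → Tot k U) (n : ℤ) :
    gr n (ct ψt† Φ) = ct ψt† fun i => gr (n - 3) (Φ i) :=
  gr_ct_of_bideg (p := (3, -3)) antiPsit_mem Φ n

theorem eps_mul_aup (i j : Fin k) : fT (.eps i) * D.aup j = -(D.aup j * fT (.eps i)) :=
  odd_mul_comm (eps_odd i) (D.aup_odd j)

theorem A_mul_aup (i j : Fin k) : fT (.A i) * D.aup j = -(D.aup j * fT (.A i)) :=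
  odd_mul_comm (A_odd i) (D.aup_odd j)

theorem eps_mul_epsup (i j : Fin k) : fT (.eps i) * D.epsup j = -(D.epsup j * fT (.eps i)) :=
  odd_mul_comm (eps_odd i) (D.epsup_odd j)

variable (r : Fin k → Fin m → SmoothFn U) {c : Fin k → Fin k → Fin k → SmoothFn U}

theorem ct_eq_tri (u v w : Fin k → Tot k U) :
    (ct u fun a => ct v fun b => ct w fun d => c a b d • 1) = tri c u v w := rfl

/-- Form degree zero allows only ε and ψ̃. The components of Θ in degrees 0 and 1 are precisely the
polynomials found in s₀², which is what matches the two sides of the theorem. -/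
theorem gr_cubicSuper_zero : gr 0 (D.cubicSuper r c) = cubicGhost r c := by
  simp only [cubicSuper, cubicGhost, gr_negative, ct_zero_right, bfA_eq, bfB_eq, tri, ct_add_left,
    map_add, map_smul, ct_add_right, gr_ct_eps, gr_ct_A, gr_ct_B, gr_ct_psi, gr_ct_psit,
    gr_ct_aup, gr_ct_epsup, gr_ct_negAntiX, gr_smul_one, Int.reduceNeg, Int.reduceLT, if_true,
    add_zero, zero_sub]

theorem gr_cubicSuper_one (hc : IsAlt c) : gr 1 (D.cubicSuper r c) = cubicGhost₁ r c := by
  simp only [cubicSuper, cubicGhost₁, gr_negative, ct_zero_right, bfA_eq, bfB_eq, tri, ct_add_left,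
    map_add, map_smul, ct_add_right, gr_ct_eps, gr_ct_A, gr_ct_B, gr_ct_psi, gr_ct_psit,
    gr_ct_aup, gr_ct_epsup, gr_ct_negAntiX, gr_smul_one, Int.reduceSub, Int.reduceNeg,
    Int.reduceEq, Int.reduceLT, if_true, if_false, add_zero, zero_add, zero_sub]
  have he : ∀ i j, (fT (.eps i) * fT (.A j) : Tot k U) = -(fT (.A j) * fT (.eps i)) := eps_mul_A
  simp only [ct_eq_tri, hc.tri_swap₁₂ he, hc.tri_swap₂₃ εT he]
  module

/-- Besides the terms of the BRST variation of B there is one with A†; contracted with the first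
Taylor coefficient along B† it becomes the A†B† term. -/
theorem gr_cubicSuper_two (hc : IsAlt c) : gr 2 (D.cubicSuper r c)
    = (ct BT fun μ => ct εT fun a => r a μ • 1) + (ct ψT fun μ => ct AT fun a => r a μ • 1)
      + (1 / 2 : ℝ) • tri c AT AT εT + ct D.aup fun a => quadGhost (r a) (c a) := by
  have he : ∀ i j, (fT (.eps i) * fT (.A j) : Tot k U) = -(fT (.A j) * fT (.eps i)) := eps_mul_A
  have hq : (ct D.aup fun a => quadGhost (r a) (c a)) = (ct ψtT fun μ => ct D.aup fun a => r a μ • 1)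
      + (1 / 2 : ℝ) • tri c D.aup εT εT := by
    simp only [quadGhost, ct_add_right, ct_smul_right (S := ℝ), tri]
    rw [ct_comm fun i j => (even_mul_comm (psit_even j) (D.aup i)).symm]
  rw [hq]
  simp only [cubicSuper, gr_negative, ct_zero_right, bfA_eq, bfB_eq, tri, ct_add_left,
    map_add, map_smul, ct_add_right, gr_ct_eps, gr_ct_A, gr_ct_B, gr_ct_psi, gr_ct_psit,
    gr_ct_aup, gr_ct_epsup, gr_ct_negAntiX, gr_smul_one, Int.reduceSub, Int.reduceNeg,
    Int.reduceEq, Int.reduceLT, if_true, if_false, add_zero, zero_add, zero_sub]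
  simp only [ct_eq_tri, hc.tri_swap₁₂ he, hc.tri_swap₂₃ _ he, hc.tri_swap₁₂ D.eps_mul_aup,
    hc.tri_swap₂₃ _ D.eps_mul_aup]
  module

/-- The undifferentiated Θ supplies the classical interaction together with the algebraic part of
the couplings of X†, A† and ε†. -/
theorem gr_cubicSuper_three (hc : IsAlt c) : gr 3 (D.cubicSuper r c)
    = (ct negAntiX fun μ => ct εT fun a => r a μ • 1) + (ct BT fun μ => ct AT fun a => r a μ • 1)
      + (ct ψT fun μ => ct D.aup fun a => r a μ • 1)
      + (ct ψtT fun μ => ct D.epsup fun a => r a μ • 1)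
      + (1 / 2 : ℝ) • tri c D.epsup εT εT + tri c D.aup AT εT
      + (1 / 6 : ℝ) • tri c AT AT AT := by
  have he : ∀ i j, (fT (.eps i) * fT (.A j) : Tot k U) = -(fT (.A j) * fT (.eps i)) := eps_mul_A
  simp only [cubicSuper, gr_negative, ct_zero_right, bfA_eq, bfB_eq, tri, ct_add_left,
    map_add, map_smul, ct_add_right, gr_ct_eps, gr_ct_A, gr_ct_B, gr_ct_psi, gr_ct_psit,
    gr_ct_aup, gr_ct_epsup, gr_ct_negAntiX, gr_smul_one, Int.reduceSub, Int.reduceNeg,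
    Int.reduceEq, Int.reduceLT, if_true, if_false, add_zero, zero_add, zero_sub, sub_self]
  simp only [ct_eq_tri, hc.tri_swap₁₂ he, hc.tri_swap₂₃ _ he, hc.tri_swap₁₂ D.eps_mul_aup,
    hc.tri_swap₂₃ _ D.eps_mul_aup, hc.tri_swap₁₂ D.A_mul_aup,
    hc.tri_swap₁₂ D.eps_mul_epsup, hc.tri_swap₂₃ _ D.eps_mul_epsup]
  module

end LocalCourantAlgebroid
namespace LocalCourantAlgebroid

variable {m k : ℕ} {U : TopologicalSpace.Opens (Fin m → ℝ)} (D : LocalCourantAlgebroid m k U)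

local notation "εT" => fun a => fT (Fld.eps a)
local notation "AT" => fun a => fT (Fld.A a)
local notation "BT" => fun a => fT (Fld.B a)
local notation "ψT" => fun a => fT (Fld.psi a)
local notation "ψtT" => fun a => fT (Fld.psit a)
local notation "A†" => fun l => aT (Fld.A l)
local notation "B†" => fun l => aT (Fld.B l)
local notation "ψ†" => fun l => aT (Fld.psi l)
local notation "ψt†" => fun l => aT (Fld.psit l)

/-- The interaction terms of form degree three. -/
theorem gr_interaction : gr 3 (τ (∑ a, ∑ μ,
        superMul (superMul (superFn (D.ρ a μ)) (superB μ)) (D.superA a)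
      + (1 / 6 : ℝ) • ∑ a, ∑ b, ∑ c,
        superMul (superMul (superMul (superFn (D.C a b c)) (D.superA a)) (D.superA b))
          (D.superA c)))
    = gr 3 (D.cubicSuper D.ρ D.C)
      + (ct B† fun l => (ct BT fun μ => ct εT fun a => pd l (D.ρ a μ) • 1)
        + (ct ψT fun μ => ct AT fun a => pd l (D.ρ a μ) • 1)
        + (1 / 2 : ℝ) • tri (fun a b c => pd l (D.C a b c)) AT AT εT)
      + (ct ψ† fun l => cubicGhost₁ (fun a μ => pd l (D.ρ a μ)) fun a b c => pd l (D.C a b c))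
      + (ct ψt† fun l => cubicGhost (fun a μ => pd l (D.ρ a μ)) fun a b c => pd l (D.C a b c))
      + D.actionAB + (1 / 2 : ℝ) • D.actionBB + D.actionPsiB + (1 / 6 : ℝ) • D.actionBBB := by
  have h1 := fun l => D.isAlt_pd_C l
  have h2 := fun l κ => isAlt_map (pd κ) (h1 l)
  have n : ∀ j : ℕ, ∀ x : Tot k U, gr (-(j + 1 : ℕ) : ℤ) x = 0 := fun j x =>
    gr_negative (by omega) x
  have n1 : ∀ x : Tot k U, gr (-1) x = 0 := n 0
  have n2 : ∀ x : Tot k U, gr (-2) x = 0 := n 1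
  have n3 : ∀ x : Tot k U, gr (-3) x = 0 := n 2
  have e2 := fun l => D.gr_cubicSuper_two (fun a μ => pd l (D.ρ a μ)) (h1 l)
  have e1 := fun l => D.gr_cubicSuper_one (fun a μ => pd l (D.ρ a μ)) (h1 l)
  have e1' := fun l κ => D.gr_cubicSuper_one (fun a μ => pd l (pd κ (D.ρ a μ))) (h2 κ l)
  -- The mixed term B†ψ† occurs in both orders in the quadratic Taylor term, which compensates the
  -- ½; for B†B† the ½ survives.
  have hP : (ct B† fun l => ct ψ† fun κ => cubicGhost (fun a μ => pd l (pd κ (D.ρ a μ)))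
      fun a b c => pd l (pd κ (D.C a b c))) = D.actionPsiB := by
    rw [ct_comm fun i j => antiB_mul_comm i _]
    rfl
  have hP' : (ct ψ† fun l => ct B† fun κ => cubicGhost (fun a μ => pd l (pd κ (D.ρ a μ)))
      fun a b c => pd l (pd κ (D.C a b c))) = D.actionPsiB := by
    simp only [actionPsiB, pd_comm]
  have hB : (ct B† fun l => ct B† fun κ => cubicGhost₁ (fun a μ => pd l (pd κ (D.ρ a μ)))
      fun a b c => pd l (pd κ (D.C a b c))) = D.actionBB := by
    simp only [actionBB, pd_comm]
  have hBBB : (ct B† fun l => ct B† fun κ => ct B† fun i =>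
      cubicGhost (fun a μ => pd l (pd κ (pd i (D.ρ a μ))))
        fun a b c => pd l (pd κ (pd i (D.C a b c)))) = D.actionBBB := by
    simp only [actionBBB, pd_comm]
  rw [τ_interaction]
  simp only [map_add, map_smul, bfN_eq, ct_add_left, gr_ct_antiB, gr_ct_antiPsi, gr_ct_antiPsit,
    ct_add_right, Int.reduceSub, n1, n2, n3, ct_zero_right, add_zero, e1, e2, e1',
    gr_cubicSuper_zero, hP, hP', hB, hBBB, actionAB]
  module

end LocalCourantAlgebroid
-- Kinetic terms and comparison of the two actions
namespace LocalCourantAlgebroid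

variable {m k : ℕ} {U : TopologicalSpace.Opens (Fin m → ℝ)} (D : LocalCourantAlgebroid m k U)

local notation "εT" => fun a => fT (Fld.eps a)
local notation "AT" => fun a => fT (Fld.A a)
local notation "BT" => fun a => fT (Fld.B a)
local notation "ψT" => fun a => fT (Fld.psi a)
local notation "ψtT" => fun a => fT (Fld.psit a)
local notation "dεT" => fun a => dfT (Fld.eps a)
local notation "dAT" => fun a => dfT (Fld.A a)
local notation "dXT" => fun a => dfT (Fld.X a)
local notation "dψT" => fun a => dfT (Fld.psi a)
local notation "dψtT" => fun a => dfT (Fld.psit a)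
local notation "A†" => fun l => aT (Fld.A l)
local notation "B†" => fun l => aT (Fld.B l)
local notation "ψ†" => fun l => aT (Fld.psi l)
local notation "ψt†" => fun l => aT (Fld.psit l)
local notation "ε†" => fun l => aT (Fld.eps l)
local notation "dA†" => fun l => daT (Fld.A l)
local notation "dB†" => fun l => daT (Fld.B l)
local notation "dψ†" => fun l => daT (Fld.psi l)

theorem gr_dfT (φ : Fld m k) (n : ℤ) :
    gr n (dfT φ : Tot k U) = if φ.species.deg + 1 = n then dfT φ else 0 :=
  gr_of_mem (mem_degree (dfT_mem φ)) n

theorem gr_daT (φ : Fld m k) (n : ℤ) :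
    gr n (daT φ : Tot k U) = if 3 - φ.species.deg + 1 = n then daT φ else 0 :=
  gr_of_mem (mem_degree (daT_mem φ)) n

theorem sum_η_η_inv (x : Fin k → Tot k U) (a : Fin k) :
    ∑ b, D.η a b • ∑ c, D.η⁻¹ b c • x c = x a := by
  have h : ∀ c, ∑ b, D.η a b * D.η⁻¹ b c = (1 : Matrix (Fin k) (Fin k) ℝ) a c := fun c => by
    rw [← Matrix.mul_nonsing_inv _ D.η_nondeg, Matrix.mul_apply]
  simp only [Finset.smul_sum, smul_smul]
  rw [Finset.sum_comm]
  simp only [← Finset.sum_smul, h, Matrix.one_apply, ite_smul, one_smul, zero_smul,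
    Finset.sum_ite_eq, Finset.mem_univ, if_true]

/-- The differential of the superfield of degree one with its index lowered. -/
def dbfA (a : Fin k) : Tot k U := (∑ b, D.η a b • dfT (.eps b)) + (∑ b, D.η a b • dfT (.A b))
  + daT (.A a) - daT (.eps a)

theorem lower_dT_bfA (a : Fin k) : ∑ b, D.η a b • dT (D.bfA b) = D.dbfA a := by
  simp only [bfA, aup, epsup, dbfA, map_add, map_neg, map_sum, map_smul, dT_fT, dT_aT, smul_add,
    smul_neg, Finset.sum_add_distrib, Finset.sum_neg_distrib, sum_η_η_inv, sub_eq_add_neg]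

theorem ct_aup_lower (x : Fin k → Tot k U) :
    (ct D.aup fun a => ∑ b, D.η a b • x b) = ct A† x := by
  rw [← ct_antiA_sum]
  have h : ∀ a, ∑ b, D.η⁻¹ a b • ∑ c, D.η b c • x c = x a := fun a => by
    have h : ∀ c, ∑ b, D.η⁻¹ a b * D.η b c = (1 : Matrix (Fin k) (Fin k) ℝ) a c := fun c => by
      rw [← Matrix.nonsing_inv_mul _ D.η_nondeg, Matrix.mul_apply]
    simp only [Finset.smul_sum, smul_smul]
    rw [Finset.sum_comm]
    simp only [← Finset.sum_smul, h, Matrix.one_apply, ite_smul, one_smul, zero_smul,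
      Finset.sum_ite_eq, Finset.mem_univ, if_true]
  simp only [h]

/-- The kinetic terms of the superfield action. -/
theorem τ_kinetic : τ (- ∑ μ, superMul (superB μ) (d (superX μ))
    + (1 / 2 : ℝ) • ∑ a, ∑ b, D.η a b • superMul (D.superA a) (d (D.superA b)))
    = -(ct bfB fun μ => dfT (.X μ) + daT (.B μ) + daT (.psi μ) + daT (.psit μ))
      + (1 / 2 : ℝ) • ct D.bfA D.dbfA := by
  have h : ∀ μ, dT (fT (.X μ)) + dT (bfN μ : Tot k U)
      = dfT (.X μ) + daT (.B μ) + daT (.psi μ) + daT (.psit μ) := fun μ => by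
    simp only [bfN, map_add, dT_fT, dT_aT, add_assoc]
  simp only [map_add, map_neg, τ_real_smul, map_sum, τ_superMul, ← dT_τ, τ_superX, τ_superA,
    τ_superB]
  simp only [h, ← lower_dT_bfA, ct, Finset.mul_sum, mul_smul_comm]

/-- The metric is absorbed into d𝐀, so ε and A meet the antifield differentials without a metric.
Selecting degree three pairs each component with its complementary partner. -/
theorem gr_kinetic : gr 3 (τ (- ∑ μ, superMul (superB μ) (d (superX μ))
      + (1 / 2 : ℝ) • ∑ a, ∑ b, D.η a b • superMul (D.superA a) (d (D.superA b))))
    = -(ct BT dXT + ct ψT dB† + ct ψtT dψ†)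
      + (1 / 2 : ℝ) • ((ct AT fun a => ∑ b, D.η a b • dfT (.A b)) + ct εT dA† + ct A† dεT) := by
  rw [τ_kinetic, ← ct_aup_lower]
  simp only [bfA_eq, bfB_eq, dbfA, ct_add_left, ct_add_right, ct_sub_right, map_add, map_sub,
    map_neg, map_sum, map_smul, gr_ct_eps, gr_ct_A, gr_ct_B, gr_ct_psi, gr_ct_psit, gr_ct_aup,
    gr_ct_epsup, gr_ct_negAntiX, gr_dfT, gr_daT, Fld.species, Species.deg]
  norm_num only [if_true, if_false, smul_zero, Finset.sum_const_zero, ct_zero_right]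
  abel_nf

/-- A primitive of the total derivative by which the kinetic terms differ from the terms with
differentiated ghosts. -/
def kineticPrimitive : Tot k U :=
  -ct B† ψT - ct ψ† ψtT + (1 / 2 : ℝ) • ct A† εT

theorem antiA_odd (a : Fin k) : (aT (.A a) : Tot k U) ∈ TPar 1 :=
  tPar_of_bideg (aT_mem _) (by exact (by decide : ((3 - 1 + (-1 - 0) : ℤ) : ZMod 2) = 1))

theorem dantiA_even (a : Fin k) : (daT (.A a) : Tot k U) ∈ TPar 0 :=
  tPar_of_bideg (daT_mem _) (by exact (by decide : ((3 - 1 + 1 + (-1 - 0) : ℤ) : ZMod 2) = 0))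

/-- The first-order terms contain B†dψ, ψ†dψ̃ and A†dε. The superfield kinetic term instead has -ψ
dB†, -ψ̃ dψ† and half of each of ε dA† and A†dε; the difference is this exact form. -/
theorem dT_kineticPrimitive : dT (kineticPrimitive : Tot k U)
    = -ct ψT dB† - ct B† dψT - ct ψtT dψ† - ct ψ† dψtT
      + (1 / 2 : ℝ) • (ct εT dA† - ct A† dεT) := by
  have h1 : (ct dB† ψT : Tot k U) = ct ψT dB† :=
    Finset.sum_congr rfl fun μ _ => (even_mul_comm (psi_even μ) _).symm
  have h2 : (ct dψ† ψtT : Tot k U) = ct ψtT dψ† :=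
    Finset.sum_congr rfl fun μ _ => (even_mul_comm (psit_even μ) _).symm
  have h3 : (ct dA† εT : Tot k U) = ct εT dA† :=
    Finset.sum_congr rfl fun μ _ => even_mul_comm (dantiA_even μ) _
  simp only [kineticPrimitive, map_add, map_sub, map_neg, map_smul, isOddDer_dT.ct_even antiB_even,
    isOddDer_dT.ct_even antiPsi_even, isOddDer_dT.ct_odd antiA_odd, dT_aT, dT_fT, h1, h2, h3]
  abel_nf

theorem gr_ct_antiA (Φ : Fin k → Tot k U) (n : ℤ) :
    gr n (ct A† Φ) = ct A† fun i => gr (n - 2) (Φ i) :=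
  gr_ct_of_bideg (p := (2, -1)) antiA_mem Φ n

/-- The integral projects to form degree three before dividing by total derivatives, so the
primitive must not be cut by that projection. -/
theorem gr_dT_kineticPrimitive :
    gr 3 (dT (kineticPrimitive : Tot k U)) = dT kineticPrimitive := by
  rw [dT_kineticPrimitive]
  simp only [map_add, map_sub, map_neg, map_smul, gr_ct_eps, gr_ct_psi, gr_ct_psit, gr_ct_antiA,
    gr_ct_antiB, gr_ct_antiPsi, gr_dfT, gr_daT, Fld.species, Species.deg]
  norm_num only [if_true]

theorem gr_gr (n : ℤ) (x : Tot k U) : gr n (gr n x) = gr n x := by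
  induction x using Tot.induction with
  | h0 => simp only [map_zero]
  | hadd x y hx hy => simp only [map_add, hx, hy]
  | hmon e f =>
    have h : τ (monOf e.1 f : LForm k U) ∈ TWt Gen.deg (wt Gen.deg e.1) :=
      τ_mem.2 (monOf_mem_hasWt rfl _)
    rw [gr_of_mem h]
    split_ifs with hn
    · rw [gr_of_mem h, if_pos hn]
    · exact map_zero _

theorem τ_classicalLagrangian : τ D.classicalLagrangian
    = -ct BT dXT + (1 / 2 : ℝ) • (ct AT fun a => ∑ b, D.η a b • dfT (.A b))
      + (ct BT fun μ => ct AT fun a => D.ρ a μ • 1) + (1 / 6 : ℝ) • tri D.C AT AT AT := by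
  rw [tri, ct_ct_smul_one_eq, ct_ct_ct_smul_one_eq, classicalLagrangian]
  simp only [map_add, map_neg, τ_real_smul, map_sum, map_smul, τ_gen_mul, τ_gen_mul_mul]
  simp only [Gen.gh, Gen.deg, Fld.species, Species.gh, Species.deg, zero_mul, add_zero,
    sgn_zero, one_smul, ct, Finset.mul_sum, mul_smul_comm]
  rw [Finset.sum_comm (α := Fin m)]
  rfl

theorem ct_antiEps_sum (Φ : Fin k → Tot k U) :
    (ct ε† fun a => ∑ b, D.η⁻¹ a b • Φ b) = -ct D.epsup Φ := by
  simp only [ct, epsup, Finset.mul_sum, Finset.sum_mul, mul_smul_comm, smul_mul_assoc, neg_mul,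
    Finset.sum_neg_distrib, neg_neg]
  rw [Finset.sum_comm]
  simp only [D.η_inv_symm]

/-- The part of form degree three of the superfield action. -/
theorem gr_akszLagrangian : gr 3 (τ D.akszLagrangian)
    = τ D.classicalLagrangian + τ (∑ s, D.weightedPairing 1 s) + τ (∑ s, D.weightedPairing 2 s)
      + τ (∑ s, D.weightedPairing 3 s) + dT kineticPrimitive := by
  have hL : D.akszLagrangian = (- ∑ μ, superMul (superB μ) (d (superX μ))
      + (1 / 2 : ℝ) • ∑ a, ∑ b, D.η a b • superMul (D.superA a) (d (D.superA b)))
      + (∑ a, ∑ μ, superMul (superMul (superFn (D.ρ a μ)) (superB μ)) (D.superA a)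
      + (1 / 6 : ℝ) • ∑ a, ∑ b, ∑ c,
        superMul (superMul (superMul (superFn (D.C a b c)) (D.superA a)) (D.superA b))
          (D.superA c)) := add_assoc _ _ _
  -- The following identities rewrite the couplings of X†, A† and ε† from the superfield form to the
  -- form φ†·s₀φ by moving the inverse metric off the antifields.
  have sX : (ct negAntiX fun μ => ct εT fun a => D.ρ a μ • (1 : Tot k U))
      = -ct (fun μ => aT (.X μ)) fun μ => ct εT fun a => D.ρ a μ • 1 := ct_neg_left _ _
  have sA : (ct A† fun a => ct ψT fun μ => D.ρup a μ • (1 : Tot k U))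
      = ct ψT fun μ => ct D.aup fun a => D.ρ a μ • 1 := by
    rw [ct_comm fun i j => even_mul_comm (psi_even i) (D.aup j), ← ct_antiA_sum]
    simp only [ρup, Finset.sum_smul, smul_assoc, ← sum_ct, ct_smul_right (S := ℝ)]
  have sC : tri D.Cup A† AT εT = (tri D.C D.aup AT εT : Tot k U) := by
    rw [tri, tri, ← ct_antiA_sum]
    simp only [Cup, Finset.sum_smul, smul_assoc, ← sum_ct, ct_smul_right (S := ℝ)]
  have sE : (ct ε† fun a => ct ψtT fun μ => D.ρup a μ • (1 : Tot k U))
      = -ct ψtT fun μ => ct D.epsup fun a => D.ρ a μ • 1 := by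
    rw [ct_comm fun i j => even_mul_comm (psit_even i) (D.epsup j), ← ct_antiEps_sum]
    simp only [ρup, Finset.sum_smul, smul_assoc, ← sum_ct, ct_smul_right (S := ℝ)]
  have sF : tri D.Cup ε† εT εT = (-tri D.C D.epsup εT εT : Tot k U) := by
    rw [tri, tri, ← ct_antiEps_sum]
    simp only [Cup, Finset.sum_smul, smul_assoc, ← sum_ct, ct_smul_right (S := ℝ)]
  rw [hL, map_add τ, map_add (gr 3), gr_kinetic, gr_interaction, D.gr_cubicSuper_three D.ρ D.isAlt_C,
    τ_classicalLagrangian, sum_weightedPairing_one, sum_weightedPairing_two,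
    sum_weightedPairing_three, dT_kineticPrimitive]
  simp only [τ_brst_X, τ_brst_A, τ_brst_B, τ_brst_eps, τ_brst_psi, τ_brst_psit, cubicGhost,
    cubicGhost₁, cube_eq_tri, ct_eq_tri, ct_add_right, ct_sub_right, ct_neg_right,
    ct_smul_right (S := ℝ), sX, sA, sE, sC, sF]
  module

/-- In form degree three the two integrands differ by d of `kineticPrimitive`, which vanishes in the
quotient by total derivatives. -/
theorem akszAction_eq : D.akszAction = D.classicalAction + integral
    (∑ s, D.weightedPairing 1 s + (∑ s, D.weightedPairing 2 s + ∑ s, D.weightedPairing 3 s)) := by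
  set R := D.classicalLagrangian + ∑ s, D.weightedPairing 1 s + ∑ s, D.weightedPairing 2 s
    + ∑ s, D.weightedPairing 3 s with hR
  have h1 : gr 3 (τ D.akszLagrangian) = τ R + dT kineticPrimitive := by
    rw [gr_akszLagrangian, hR]
    simp only [map_add]
  -- R is purely of degree three, since both other terms of `h1` are.
  have h2 : gr 3 (τ R) = τ R := by
    have h := congrArg (gr 3) h1
    rw [gr_gr, map_add, gr_dT_kineticPrimitive, h1] at h
    exact (add_right_cancel h).symm
  have h3 : part (fun e => e.deg = 3) D.akszLagrangian - part (fun e => e.deg = 3) R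
      = d (τ.symm kineticPrimitive) := by
    refine τ.injective ?_
    rw [map_sub, ← gr_τ, ← gr_τ, h2, h1, add_sub_cancel_left, ← dT_τ, τ.apply_symm_apply]
  have h4 : D.akszAction = integral R :=
    (Submodule.Quotient.eq _).2 ⟨τ.symm kineticPrimitive, h3.symm⟩
  rw [h4, hR, classicalAction]
  simp only [map_add, add_assoc]

end LocalCourantAlgebroid
end CourantSigma
end

theorem proposition4p1 {m k : ℕ} (U : TopologicalSpace.Opens (Fin m → ℝ))
    (D : CourantSigma.LocalCourantAlgebroid m k U) :
    D.akszAction = D.classicalAction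
      + ∑ n ∈ Finset.Icc 1 3, ∑ s : CourantSigma.Species,
          CourantSigma.integral (D.weightedPairing n s) := by
  rw [show Finset.Icc 1 3 = ({1, 2, 3} : Finset ℕ) from rfl]
  simp only [Finset.sum_insert, Finset.sum_singleton, Finset.mem_insert, Finset.mem_singleton,
    OfNat.one_ne_ofNat, Nat.reduceEqDiff, or_self, not_false_eq_true, ← map_sum]
  exact D.akszAction_eq
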